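/- Graphs are finite; loops, multiple edges and disconnected graphs are allowed, and every edge has two opposite orientations. For a graph $\Gamma$ with vertex set $V$ and edge set $E$, let $H_1(\Gamma,A)$ (for $A=\mathbb Z,\mathbb R$) be the kernel of the boundary map on $1$-chains, $\vec e\mapsto t(\vec e)-s(\vec e)$, where the oppositely oriented edge is $-\vec e$. For an oriented edge $\vec e$ let $(\cdot,\vec e)$ denote the corresponding coordinate functional on $H_1(\Gamma,\mathbb R)$. The cographic fan $\mathcal F_\Gamma^\perp$ is the complete fan in $H_1(\Gamma,\mathbb R)$, with lattice $H_1(\Gamma,\mathbb Z)$, given by the cones into which the hyperplanes $(\cdot,e)=0$ ($e$ a non-separating edge) divide the space, together with their faces; its cones are the sets $$\sigma(T,\phi)=\{c : (c,\phi(e))\ge 0 \text{ for } e\notin T,\ (c,e)=0 \text{ for } e\in T\},$$ where $T\subseteq E$ and $\phi$ is an orientation of the edges not in $T$. For a field $k$, the cographic toric face ring $R_k(\Gamma)$ is the $k$-algebra with $k$-basis $\{X^c : c\in H_1(\Gamma,\mathbb Z)\}$ and multiplication $X^c\cdot X^{c'}=X^{c+c'}$ if $c,c'$ lie in a common cone of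 $\mathcal F_\Gamma^\perp$, and $X^c\cdot X^{c'}=0$ otherwise. A graph is cyclic if it is connected, has no separating edge (an edge whose removal increases the number of connected components) and has first Betti number $1$; a circuit of $\Gamma$ is the edge set of a cyclic subgraph. Two graphs are cyclic equivalent if there is a bijection between their edge sets inducing a bijection between their circuits. A separating pair is a pair of distinct non-separating edges whose joint removal increases the number of connected components; being equal or forming a separating pair is an equivalence relation on non-separating edges. A $3$-edge connectivization of $\Gamma$ is a graph obtained by contracting all separating edges and, in each of these equivalence classes, all edges but one. Its cyclic equivalence class does not depend on the choices and is denoted $[\Gamma]^3_{\rm cyc}$. **Theorem.** Let $k$ be a field and let $\Gamma,\Gamma'$ be finite graphs. Then $R_k(\Gamma)\cong R_k(\Gamma')$ as $k$-algebras if and only if $[\Gamma]^3_{\rm cyc}=[\Gamma']^3_{\rm cyc}$. Likewise, $R_k(\Gamma)\cong R_k(\Gamma')$ as rings if and only if $[\Gamma]^3_{\rm cyc}=[\Gamma']^3_{\rm cyc}$. -/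

import Mathlib

universe u v w

noncomputable section

/-! ## Graphs, following Serre -/

/-- A graph in the sense of Serre: vertices `V`, oriented edges `D`, source and target maps, and a
fixed-point free involution reversing the oriented edges.  Loops, multiple edges and disconnected
graphs are allowed. -/
structure SerreGraph where
  V : Type u
  D : Type v
  s : D → V
  t : D → V
  inv : D → D
  inv_inv : ∀ d, inv (inv d) = d
  inv_ne : ∀ d, inv d ≠ d
  s_eq : ∀ d, s d = t (inv d)

namespace SerreGraph

variable (Γ : SerreGraph.{u, v})

/-- Two oriented edges have the same underlying edge. -/
def edgeSetoid : Setoid Γ.D where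
  r a b := b = a ∨ b = Γ.inv a
  iseqv :=
    { refl := fun _ => Or.inl rfl
      symm := by
        rintro a b (rfl | rfl)
        · exact Or.inl rfl
        · exact Or.inr (Γ.inv_inv a).symm
      trans := by
        rintro a b c (rfl | rfl) (rfl | rfl)
        · exact Or.inl rfl
        · exact Or.inr rfl
        · exact Or.inr rfl
        · exact Or.inl (Γ.inv_inv a) }

/-- The set of (unoriented) edges. -/
def E : Type v := Quotient Γ.edgeSetoid

/-- The edge underlying an oriented edge. -/
def edge (d : Γ.D) : Γ.E := Quotient.mk Γ.edgeSetoid d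

theorem t_eq (d : Γ.D) : Γ.t d = Γ.s (Γ.inv d) := by rw [Γ.s_eq, Γ.inv_inv]

theorem edge_eq_iff {a b : Γ.D} : Γ.edge a = Γ.edge b ↔ b = a ∨ b = Γ.inv a :=
  Quotient.eq (r := Γ.edgeSetoid)

theorem edge_inv (d : Γ.D) : Γ.edge (Γ.inv d) = Γ.edge d :=
  (Γ.edge_eq_iff.2 (Or.inr rfl)).symm

instance [Finite Γ.D] : Finite Γ.E := inferInstanceAs (Finite (Quotient Γ.edgeSetoid))

/-- An orientation of `Γ`: a section of the map from oriented edges to edges. -/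
def Orientation : Type v := {φ : Γ.E → Γ.D // ∀ e, Γ.edge (φ e) = e}

instance [Finite Γ.D] : Finite Γ.Orientation :=
  inferInstanceAs (Finite {φ : Γ.E → Γ.D // ∀ e, Γ.edge (φ e) = e})

instance : Nonempty Γ.Orientation :=
  ⟨⟨fun e => Quotient.out (s := Γ.edgeSetoid) e, fun e => Quotient.out_eq (s := Γ.edgeSetoid) e⟩⟩

/-! ### Connected components, deletion, contraction, subgraphs -/

/-- Two vertices joined by an oriented edge. -/
def Joined (v w : Γ.V) : Prop := ∃ d, Γ.s d = v ∧ Γ.t d = w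

/-- The number of connected components; `Quot` identifies two vertices exactly when a path joins
them. -/
def numComponents : ℕ := Nat.card (Quot Γ.Joined)

/-- The spanning subgraph obtained by removing the edges in `S`. -/
def deleteEdges (S : Set Γ.E) : SerreGraph.{u, v} where
  V := Γ.V
  D := {d : Γ.D // Γ.edge d ∉ S}
  s d := Γ.s d
  t d := Γ.t d
  inv d := ⟨Γ.inv d, by rw [Γ.edge_inv]; exact d.2⟩
  inv_inv d := Subtype.ext (Γ.inv_inv d)
  inv_ne d h := Γ.inv_ne d (congrArg Subtype.val h)
  s_eq d := Γ.s_eq d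

/-- The graph obtained by contracting the edges in `F`: those edges disappear and their end points
are identified. -/
def contract (F : Set Γ.E) : SerreGraph.{u, v} where
  V := Quot (fun v w : Γ.V => ∃ d, Γ.edge d ∈ F ∧ Γ.s d = v ∧ Γ.t d = w)
  D := {d : Γ.D // Γ.edge d ∉ F}
  s d := Quot.mk _ (Γ.s d)
  t d := Quot.mk _ (Γ.t d)
  inv d := ⟨Γ.inv d, by rw [Γ.edge_inv]; exact d.2⟩
  inv_inv d := Subtype.ext (Γ.inv_inv d)
  inv_ne d h := Γ.inv_ne d (congrArg Subtype.val h)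
  s_eq d := congrArg _ (Γ.s_eq d)

/-- The subgraph with vertex set `W` and edge set `S`, where `W` contains the end points of all
edges in `S`. -/
def subgraph (W : Set Γ.V) (S : Set Γ.E) (h : ∀ d, Γ.edge d ∈ S → Γ.s d ∈ W) :
    SerreGraph.{u, v} where
  V := W
  D := {d : Γ.D // Γ.edge d ∈ S}
  s d := ⟨Γ.s d, h d d.2⟩
  t d := ⟨Γ.t d, by rw [Γ.t_eq]; exact h _ (by rw [Γ.edge_inv]; exact d.2)⟩
  inv d := ⟨Γ.inv d, by rw [Γ.edge_inv]; exact d.2⟩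
  inv_inv d := Subtype.ext (Γ.inv_inv d)
  inv_ne d h := Γ.inv_ne d (congrArg Subtype.val h)
  s_eq d := Subtype.ext (Γ.s_eq d)

/-- Removing the edge increases the number of connected components. -/
def IsSeparating (e : Γ.E) : Prop :=
  Γ.numComponents < (Γ.deleteEdges {e}).numComponents

/-- Two distinct edges, neither of them separating, whose joint removal increases the number of
connected components. -/
def IsSeparatingPair (e f : Γ.E) : Prop :=
  e ≠ f ∧ ¬ Γ.IsSeparating e ∧ ¬ Γ.IsSeparating f ∧
    Γ.numComponents < (Γ.deleteEdges {e, f}).numComponents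

/-! ### Chains and homology -/

section Homology

variable (A : Type w) [CommRing A]

/-- The finitely supported functions on oriented edges that change sign under reversal. -/
def antisymmetric : Submodule A (Γ.D →₀ A) where
  carrier := {f | ∀ d, f (Γ.inv d) = - f d}
  zero_mem' := by intro d; simp
  add_mem' := by
    intro f g hf hg d
    simp only [Set.mem_ofPred_eq] at hf hg
    rw [Finsupp.add_apply, Finsupp.add_apply, hf, hg, neg_add]
  smul_mem' := by
    intro a f hf d
    simp only [Set.mem_ofPred_eq] at hf
    rw [Finsupp.smul_apply, Finsupp.smul_apply, hf, smul_neg]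

/-- The module of `1`-chains: generated by the oriented edges, with `inv d = - d`.  A chain `c` is
recorded by its coordinates `(d, c)`; the generator `d` is `Γ.chain A d` below. -/
def Chains : Type (max v w) := Γ.antisymmetric A

instance : AddCommGroup (Γ.Chains A) := inferInstanceAs (AddCommGroup (Γ.antisymmetric A))

instance : Module A (Γ.Chains A) := inferInstanceAs (Module A (Γ.antisymmetric A))

/-- The function recording the coordinates of a chain. -/
def chainCoords : Γ.Chains A →ₗ[A] (Γ.D →₀ A) := (Γ.antisymmetric A).subtype

/-- The boundary map, sending the oriented edge `d` to `t d - s d`; see `boundary_chain`. -/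
def boundary : Γ.Chains A →ₗ[A] (Γ.V →₀ A) :=
  (Finsupp.lmapDomain A A Γ.t).comp (Γ.chainCoords A)

/-- The first homology `H₁(Γ, A)`, the kernel of the boundary map. -/
def H1 : Type (max v w) := LinearMap.ker (Γ.boundary A)

instance : AddCommGroup (Γ.H1 A) :=
  inferInstanceAs (AddCommGroup (LinearMap.ker (Γ.boundary A)))

instance : Module A (Γ.H1 A) :=
  inferInstanceAs (Module A (LinearMap.ker (Γ.boundary A)))

/-- The oriented edge `d` as a `1`-chain. -/
def chain (d : Γ.D) : Γ.Chains A :=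
  ⟨Finsupp.single d 1 - Finsupp.single (Γ.inv d) 1, by
    classical
    intro x
    have h1 : d = Γ.inv x ↔ Γ.inv d = x :=
      ⟨fun h => by rw [h, Γ.inv_inv], fun h => by rw [← h, Γ.inv_inv]⟩
    have h2 : Γ.inv d = Γ.inv x ↔ d = x :=
      ⟨fun h => by rw [← Γ.inv_inv d, h, Γ.inv_inv], fun h => by rw [h]⟩
    simp only [Finsupp.sub_apply, Finsupp.single_apply, h1, h2, neg_sub]⟩

theorem chain_inv (d : Γ.D) : Γ.chain A (Γ.inv d) = - Γ.chain A d := by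
  apply Subtype.ext
  change Finsupp.single (Γ.inv d) (1 : A) - Finsupp.single (Γ.inv (Γ.inv d)) 1 =
    -(Finsupp.single d 1 - Finsupp.single (Γ.inv d) 1)
  rw [Γ.inv_inv, neg_sub]

theorem boundary_chain (d : Γ.D) :
    Γ.boundary A (Γ.chain A d) = Finsupp.single (Γ.t d) 1 - Finsupp.single (Γ.s d) 1 := by
  change Finsupp.lmapDomain A A Γ.t (Finsupp.single d 1 - Finsupp.single (Γ.inv d) 1) = _
  rw [map_sub, Finsupp.lmapDomain_apply, Finsupp.lmapDomain_apply, Finsupp.mapDomain_single,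
    Finsupp.mapDomain_single, ← Γ.s_eq]

/-- The pairing `(·, d)` of a cycle with an oriented edge. -/
def coord (d : Γ.D) : Γ.H1 A →ₗ[A] A :=
  (Finsupp.lapply d).comp
    ((Γ.chainCoords A).comp (LinearMap.ker (Γ.boundary A)).subtype)

theorem coord_inv (d : Γ.D) (c : Γ.H1 A) : Γ.coord A (Γ.inv d) c = - Γ.coord A d c :=
  c.1.2 d

theorem H1_ext {c c' : Γ.H1 A} (h : ∀ d, Γ.coord A d c = Γ.coord A d c') : c = c' :=
  Subtype.ext (Subtype.ext (Finsupp.ext h))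

end Homology

/-- The first Betti number. -/
def b1 : ℕ := Module.finrank ℝ (Γ.H1 ℝ)

/-- The inclusion of the lattice `H₁(Γ, ℤ)` into the real vector space `H₁(Γ, ℝ)`. -/
def latticeMap : Γ.H1 ℤ →+ Γ.H1 ℝ where
  toFun c :=
    ⟨⟨Finsupp.mapRange.addMonoidHom (Int.castAddHom ℝ) c.1.1, by
      intro d
      have h := c.1.2 d
      change ((c.1.1 (Γ.inv d) : ℤ) : ℝ) = - ((c.1.1 d : ℤ) : ℝ)
      rw [h]; push_cast; rfl⟩, by
      have h : Finsupp.mapDomain Γ.t c.1.1 = 0 := c.2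
      change Finsupp.mapDomain Γ.t (Finsupp.mapRange (Int.castAddHom ℝ) (map_zero _) c.1.1) = 0
      rw [Finsupp.mapDomain_mapRange (v := c.1.1) Γ.t (Int.castAddHom ℝ) (map_zero _) (map_add _),
        h]
      simp⟩
  map_zero' := by
    apply Subtype.ext; apply Subtype.ext
    exact map_zero (Finsupp.mapRange.addMonoidHom (Int.castAddHom ℝ))
  map_add' c c' := by
    apply Subtype.ext; apply Subtype.ext
    exact map_add (Finsupp.mapRange.addMonoidHom (Int.castAddHom ℝ)) c.1.1 c'.1.1

theorem coord_latticeMap (d : Γ.D) (c : Γ.H1 ℤ) :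
    Γ.coord ℝ d (Γ.latticeMap c) = (Γ.coord ℤ d c : ℝ) := rfl

/-! ### Circuits, cyclic equivalence, `3`-edge connectivization -/

/-- A cyclic graph: connected, free from separating edges, with first Betti number one. -/
def IsCyclic : Prop :=
  Γ.numComponents = 1 ∧ (∀ e, ¬ Γ.IsSeparating e) ∧ Γ.b1 = 1

/-- A circuit of `Γ`, recorded by its set of edges: the edge set of a cyclic subgraph. -/
def IsCircuit (S : Set Γ.E) : Prop :=
  ∃ (W : Set Γ.V) (h : ∀ d, Γ.edge d ∈ S → Γ.s d ∈ W), (Γ.subgraph W S h).IsCyclic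

/-- Cyclic equivalence (`2`-isomorphism): a bijection between the edges inducing a bijection
between the circuits. -/
def CyclicEquivalent (Γ Γ' : SerreGraph.{u, v}) : Prop :=
  ∃ ε : Γ.E ≃ Γ'.E, ∀ S : Set Γ.E, Γ.IsCircuit S ↔ Γ'.IsCircuit (ε '' S)

/-- `F` consists of all separating edges and, from each class of non-separating edges any two of
which form a separating pair, of all edges but one.  Thus each non-separating edge `e` corresponds
to exactly one remaining edge `f`, equal to `e` or forming a separating pair with it. -/
def IsContractionSet (F : Set Γ.E) : Prop :=
  (∀ e, Γ.IsSeparating e → e ∈ F) ∧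
    ∀ e, ¬ Γ.IsSeparating e → ∃! f, f ∉ F ∧ (f = e ∨ Γ.IsSeparatingPair e f)

/-- The `3`-edge connected class of `Γ`: all graphs that are cyclic equivalent to a `3`-edge
connectivization of `Γ`. -/
def threeEdgeConnectedClass : Set SerreGraph.{u, v} :=
  {Δ | ∃ F : Set Γ.E, Γ.IsContractionSet F ∧ CyclicEquivalent (Γ.contract F) Δ}

end SerreGraph

/-! ## Fans and toric face rings -/

/-- A fan of strongly convex rational polyhedral cones in a real vector space `H` with respect to
the lattice `ι : L → H`. -/
structure RationalFan {L : Type u} {H : Type v} [AddCommGroup L] [AddCommGroup H] [Module ℝ H]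
    (ι : L →+ H) where
  cones : Set (PointedCone ℝ H)
  nonempty : cones.Nonempty
  finite : cones.Finite
  /-- each cone is a finite intersection of half-spaces given by functionals that are integral on
  the lattice -/
  rational_polyhedral : ∀ σ ∈ cones, ∃ S : Set (H →ₗ[ℝ] ℝ), S.Finite ∧
    (∀ l ∈ S, ∀ n, ∃ z : ℤ, l (ι n) = z) ∧ ∀ x, x ∈ σ ↔ ∀ l ∈ S, 0 ≤ l x
  strongly_convex : ∀ σ ∈ cones, (σ : ConvexCone ℝ H).Salient
  face_mem : ∀ σ ∈ cones, ∀ τ : PointedCone ℝ H, τ.IsFaceOf σ → τ ∈ cones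
  inter_face : ∀ σ ∈ cones, ∀ τ ∈ cones, (σ ⊓ τ).IsFaceOf σ

namespace RationalFan

variable {L : Type u} {H : Type v} [AddCommGroup L] [AddCommGroup H] [Module ℝ H] {ι : L →+ H}
  (F : RationalFan ι)

/-- The lattice points in the support of the fan. -/
def LatticePoint : Type u := {c : L // ∃ σ ∈ F.cones, ι c ∈ σ}

/-- Two lattice points lie in a common cone. -/
def Together (a b : F.LatticePoint) : Prop := ∃ σ ∈ F.cones, ι a.1 ∈ σ ∧ ι b.1 ∈ σ

/-- The sum of two lattice points lying in a common cone. -/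
def addPoint (a b : F.LatticePoint) (h : F.Together a b) : F.LatticePoint :=
  ⟨a.1 + b.1, by
    obtain ⟨σ, hσ, ha, hb⟩ := h
    exact ⟨σ, hσ, by rw [map_add]; exact add_mem ha hb⟩⟩

/-- The lattice point `0`. -/
def zeroPoint : F.LatticePoint :=
  ⟨0, by
    obtain ⟨σ, hσ⟩ := F.nonempty
    exact ⟨σ, hσ, by rw [map_zero]; exact zero_mem σ⟩⟩

theorem Together.symm {F : RationalFan ι} {a b : F.LatticePoint} (h : F.Together a b) :
    F.Together b a := by
  obtain ⟨σ, hσ, ha, hb⟩ := h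
  exact ⟨σ, hσ, hb, ha⟩

theorem together_zero (a : F.LatticePoint) : F.Together F.zeroPoint a := by
  obtain ⟨σ, hσ, ha⟩ := a.2
  exact ⟨σ, hσ, by change ι 0 ∈ σ; rw [map_zero]; exact zero_mem σ, ha⟩

theorem mem_of_add_mem {σ τ : PointedCone ℝ H} (hσ : σ ∈ F.cones) (hτ : τ ∈ F.cones) {x y : H}
    (hx : x ∈ σ) (hy : y ∈ σ) (h : x + y ∈ τ) : x ∈ τ :=
  ((F.inter_face σ hσ τ hτ).mem_of_smul_add_mem (a := 1) hx hy one_pos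
    ⟨by rw [one_smul]; exact add_mem hx hy, by rw [one_smul]; exact h⟩).2

theorem together_addPoint {a b c : F.LatticePoint} (h : F.Together a b)
    (h' : F.Together (F.addPoint a b h) c) :
    ∃ σ ∈ F.cones, ι a.1 ∈ σ ∧ ι b.1 ∈ σ ∧ ι c.1 ∈ σ := by
  obtain ⟨σ, hσ, ha, hb⟩ := h
  obtain ⟨τ, hτ, hab, hc⟩ := h'
  have e : ι a.1 + ι b.1 ∈ τ := by rw [← map_add]; exact hab
  exact ⟨τ, hτ, F.mem_of_add_mem hσ hτ ha hb e,
    F.mem_of_add_mem hσ hτ hb ha (by rw [add_comm]; exact e), hc⟩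

end RationalFan

section ToricFaceRing

variable {L : Type u} {H : Type v} [AddCommGroup L] [AddCommGroup H] [Module ℝ H] {ι : L →+ H}

/-- The toric face ring of a fan over `k`: the `k`-vector space with a basis `X c` indexed by the
lattice points `c` in the support of the fan, with the multiplication defined below. -/
def ToricFaceRing (k : Type w) [Field k] (F : RationalFan ι) : Type (max u w) :=
  F.LatticePoint →₀ k

namespace ToricFaceRing

variable (k : Type w) [Field k] (F : RationalFan ι)

instance : AddCommGroup (ToricFaceRing k F) := inferInstanceAs (AddCommGroup (F.LatticePoint →₀ k))

instance : Module k (ToricFaceRing k F) := inferInstanceAs (Module k (F.LatticePoint →₀ k))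

/-- The basis of monomials. -/
def monomials : Module.Basis F.LatticePoint k (ToricFaceRing k F) :=
  Module.Basis.ofRepr (LinearEquiv.refl k (F.LatticePoint →₀ k))

/-- The monomial `X c`. -/
def X (c : F.LatticePoint) : ToricFaceRing k F := monomials k F c

open Classical in
/-- The product of two monomials: `X a * X b = X (a + b)` if `a` and `b` lie in a common cone, and
`X a * X b = 0` otherwise. -/
def mulX (a b : F.LatticePoint) : ToricFaceRing k F :=
  if h : F.Together a b then X k F (F.addPoint a b h) else 0

/-- The multiplication, extended bilinearly from the monomials. -/
def mulMap : ToricFaceRing k F →ₗ[k] ToricFaceRing k F →ₗ[k] ToricFaceRing k F :=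
  (monomials k F).constr k fun a => (monomials k F).constr k fun b => mulX k F a b

instance : Mul (ToricFaceRing k F) := ⟨fun x y => mulMap k F x y⟩

instance : One (ToricFaceRing k F) := ⟨X k F F.zeroPoint⟩

theorem mulMap_X (a b : F.LatticePoint) : mulMap k F (X k F a) (X k F b) = mulX k F a b := by
  simp [mulMap, X, Module.Basis.constr_basis]

theorem X_mul_X (a b : F.LatticePoint) : X k F a * X k F b = mulX k F a b := mulMap_X k F a b

theorem mulX_of {a b : F.LatticePoint} (h : F.Together a b) :
    mulX k F a b = X k F (F.addPoint a b h) := dif_pos h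

theorem mulX_of_not {a b : F.LatticePoint} (h : ¬ F.Together a b) : mulX k F a b = 0 :=
  dif_neg h

theorem mulX_comm (a b : F.LatticePoint) : mulX k F a b = mulX k F b a := by
  by_cases h : F.Together a b
  · rw [mulX_of k F h, mulX_of k F h.symm]
    exact congrArg _ (Subtype.ext (add_comm _ _))
  · rw [mulX_of_not k F h, mulX_of_not k F (fun h' => h h'.symm)]

theorem mulMap_assoc_X (a b c : F.LatticePoint) :
    mulMap k F (mulX k F a b) (X k F c) = mulMap k F (X k F a) (mulX k F b c) := by
  by_cases hA : ∃ σ ∈ F.cones, ι a.1 ∈ σ ∧ ι b.1 ∈ σ ∧ ι c.1 ∈ σ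
  · obtain ⟨σ, hσ, ha, hb, hc⟩ := hA
    have hab : F.Together a b := ⟨σ, hσ, ha, hb⟩
    have hbc : F.Together b c := ⟨σ, hσ, hb, hc⟩
    have h1 : F.Together (F.addPoint a b hab) c :=
      ⟨σ, hσ, by change ι (a.1 + b.1) ∈ σ; rw [map_add]; exact add_mem ha hb, hc⟩
    have h2 : F.Together a (F.addPoint b c hbc) :=
      ⟨σ, hσ, ha, by change ι (b.1 + c.1) ∈ σ; rw [map_add]; exact add_mem hb hc⟩
    rw [mulX_of k F hab, mulX_of k F hbc, mulMap_X, mulMap_X, mulX_of k F h1, mulX_of k F h2]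
    exact congrArg _ (Subtype.ext (add_assoc _ _ _))
  · have hl : mulMap k F (mulX k F a b) (X k F c) = 0 := by
      by_cases hab : F.Together a b
      · rw [mulX_of k F hab, mulMap_X, mulX_of_not]
        exact fun h => hA (F.together_addPoint hab h)
      · rw [mulX_of_not k F hab, map_zero, LinearMap.zero_apply]
    have hr : mulMap k F (X k F a) (mulX k F b c) = 0 := by
      by_cases hbc : F.Together b c
      · rw [mulX_of k F hbc, mulMap_X, mulX_of_not]
        intro h
        obtain ⟨σ, hσ, hb, hc, ha⟩ := F.together_addPoint hbc h.symm
        exact hA ⟨σ, hσ, ha, hb, hc⟩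
      · rw [mulX_of_not k F hbc, map_zero]
    rw [hl, hr]

theorem mulMap_comm (x y : ToricFaceRing k F) : mulMap k F x y = mulMap k F y x := by
  have h : mulMap k F = (mulMap k F).flip := by
    refine (monomials k F).ext fun a => (monomials k F).ext fun b => ?_
    rw [LinearMap.flip_apply]
    change mulMap k F (X k F a) (X k F b) = mulMap k F (X k F b) (X k F a)
    rw [mulMap_X, mulMap_X, mulX_comm]
  exact congrArg (fun m => m x y) h

theorem mulMap_assoc (x y z : ToricFaceRing k F) :
    mulMap k F (mulMap k F x y) z = mulMap k F x (mulMap k F y z) := by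
  have h1 : ∀ a b, (mulMap k F (mulMap k F (X k F a) (X k F b))) =
      (mulMap k F (X k F a)).comp (mulMap k F (X k F b)) := fun a b => by
    refine (monomials k F).ext fun c => ?_
    change mulMap k F (mulMap k F (X k F a) (X k F b)) (X k F c) =
      mulMap k F (X k F a) (mulMap k F (X k F b) (X k F c))
    rw [mulMap_X, mulMap_X, mulMap_assoc_X]
  have h2 : ∀ a, (mulMap k F).comp (mulMap k F (X k F a)) =
      (LinearMap.llcomp k (ToricFaceRing k F) (ToricFaceRing k F) (ToricFaceRing k F)
        (mulMap k F (X k F a))).comp (mulMap k F) := fun a =>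
    (monomials k F).ext fun b => h1 a b
  have h3 : ((mulMap k F).flip z).comp ((mulMap k F).flip y) =
      (mulMap k F).flip (mulMap k F y z) :=
    (monomials k F).ext fun a => congrArg (fun m => m y z) (h2 a)
  exact congrArg (fun m => m x) h3

theorem one_mulMap (x : ToricFaceRing k F) : mulMap k F (X k F F.zeroPoint) x = x := by
  have h : mulMap k F (X k F F.zeroPoint) = LinearMap.id := by
    refine (monomials k F).ext fun a => ?_
    change mulMap k F (X k F F.zeroPoint) (X k F a) = X k F a
    rw [mulMap_X, mulX_of k F (F.together_zero a)]
    exact congrArg _ (Subtype.ext (zero_add _))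
  rw [h]; rfl

instance : CommRing (ToricFaceRing k F) where
  __ := (inferInstance : AddCommGroup (ToricFaceRing k F))
  left_distrib x y z := map_add (mulMap k F x) y z
  right_distrib x y z := by
    change mulMap k F (x + y) z = mulMap k F x z + mulMap k F y z
    rw [map_add]; rfl
  zero_mul x := by
    change mulMap k F 0 x = 0
    rw [map_zero]; rfl
  mul_zero x := map_zero (mulMap k F x)
  mul_assoc := mulMap_assoc k F
  one_mul := one_mulMap k F
  mul_one x := (mulMap_comm k F _ _).trans (one_mulMap k F x)
  mul_comm := mulMap_comm k F

instance : Algebra k (ToricFaceRing k F) :=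
  Algebra.ofModule
    (fun r x y => by
      change mulMap k F (r • x) y = r • mulMap k F x y
      rw [map_smul]; rfl)
    (fun r x y => map_smul (mulMap k F x) r y)

end ToricFaceRing

end ToricFaceRing

/-! ## The cographic fan and the cographic ring -/

namespace SerreGraph

variable (Γ : SerreGraph.{u, v})

/-- The cone `σ(T, φ)` in `H₁(Γ, ℝ)` of an orientation `φ` of the spanning subgraph `Γ ∖ T`, cut
out by `(·, φ e) ≥ 0` for `e ∉ T` and `(·, e) = 0` for `e ∈ T`.  Only the values of `φ` outside
`T` matter. -/
def cographicCone (T : Set Γ.E) (φ : Γ.Orientation) : PointedCone ℝ (Γ.H1 ℝ) where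
  carrier := {c | (∀ e ∉ T, 0 ≤ Γ.coord ℝ (φ.1 e) c) ∧ ∀ d, Γ.edge d ∈ T → Γ.coord ℝ d c = 0}
  zero_mem' := ⟨fun _ _ => by rw [map_zero], fun _ _ => by rw [map_zero]⟩
  add_mem' := by
    rintro a b ⟨ha, ha'⟩ ⟨hb, hb'⟩
    refine ⟨fun e he => ?_, fun d hd => ?_⟩
    · rw [map_add]; exact add_nonneg (ha e he) (hb e he)
    · rw [map_add, ha' d hd, hb' d hd, add_zero]
  smul_mem' := by
    rintro r a ⟨ha, ha'⟩
    have key : ∀ d, Γ.coord ℝ d (r • a) = (r : ℝ) * Γ.coord ℝ d a := fun d =>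
      map_smul (Γ.coord ℝ d) (r : ℝ) a
    refine ⟨fun e he => ?_, fun d hd => ?_⟩
    · rw [key]; exact mul_nonneg r.2 (ha e he)
    · rw [key, ha' d hd, mul_zero]

theorem mem_cographicCone {T : Set Γ.E} {φ : Γ.Orientation} {c : Γ.H1 ℝ} :
    c ∈ Γ.cographicCone T φ ↔
      (∀ e ∉ T, 0 ≤ Γ.coord ℝ (φ.1 e) c) ∧ ∀ d, Γ.edge d ∈ T → Γ.coord ℝ d c = 0 := Iff.rfl

theorem eq_or_eq_inv (φ : Γ.Orientation) (d : Γ.D) :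
    d = φ.1 (Γ.edge d) ∨ d = Γ.inv (φ.1 (Γ.edge d)) :=
  Γ.edge_eq_iff.1 (φ.2 (Γ.edge d))

theorem coord_eq_zero (φ : Γ.Orientation) {d : Γ.D} {c : Γ.H1 ℝ}
    (h : Γ.coord ℝ (φ.1 (Γ.edge d)) c = 0) : Γ.coord ℝ d c = 0 := by
  rcases Γ.eq_or_eq_inv φ d with hd | hd
  · rw [hd]; exact h
  · rw [hd, Γ.coord_inv, h, neg_zero]

theorem cographicCone_rational [Finite Γ.D] (T : Set Γ.E) (φ : Γ.Orientation) :
    ∃ S : Set (Γ.H1 ℝ →ₗ[ℝ] ℝ), S.Finite ∧ (∀ l ∈ S, ∀ n, ∃ z : ℤ, l (Γ.latticeMap n) = z) ∧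
      ∀ x, x ∈ Γ.cographicCone T φ ↔ ∀ l ∈ S, 0 ≤ l x := by
  refine ⟨Γ.coord ℝ '' {d | Γ.edge d ∈ T ∨ d = φ.1 (Γ.edge d)}, (Set.toFinite _).image _, ?_, ?_⟩
  · rintro _ ⟨d, -, rfl⟩ n
    exact ⟨_, Γ.coord_latticeMap d n⟩
  · intro x
    rw [mem_cographicCone]
    constructor
    · rintro ⟨h1, h2⟩ _ ⟨d, hd, rfl⟩
      by_cases hT : Γ.edge d ∈ T
      · rw [h2 d hT]
      · rw [hd.resolve_left hT]
        exact h1 _ hT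
    · intro h
      refine ⟨fun e he => h _ ⟨_, Or.inr (by rw [φ.2]), rfl⟩, fun d hd => ?_⟩
      have h1 := h _ ⟨d, Or.inl hd, rfl⟩
      have h2 := h _ ⟨Γ.inv d, Or.inl (by rw [Γ.edge_inv]; exact hd), rfl⟩
      rw [Γ.coord_inv] at h2
      linarith

theorem cographicCone_salient (T : Set Γ.E) (φ : Γ.Orientation) :
    (Γ.cographicCone T φ : ConvexCone ℝ (Γ.H1 ℝ)).Salient := by
  intro x hx hx0 hneg
  obtain ⟨h1, h2⟩ := Γ.mem_cographicCone.1 hx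
  obtain ⟨h3, -⟩ := Γ.mem_cographicCone.1 hneg
  refine hx0 (Γ.H1_ext ℝ fun d => ?_)
  rw [map_zero]
  by_cases hT : Γ.edge d ∈ T
  · exact h2 d hT
  · refine Γ.coord_eq_zero φ ?_
    have := h1 _ hT
    have h4 := h3 _ hT
    rw [map_neg] at h4
    linarith

theorem cographicCone_inter_face (T T' : Set Γ.E) (φ φ' : Γ.Orientation) :
    (Γ.cographicCone T φ ⊓ Γ.cographicCone T' φ').IsFaceOf (Γ.cographicCone T φ) := by
  refine ⟨inf_le_left, ?_⟩
  intro x y a hx hy ha hxy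
  refine ⟨hx, ?_⟩
  obtain ⟨hx1, hx2⟩ := Γ.mem_cographicCone.1 hx
  obtain ⟨hy1, hy2⟩ := Γ.mem_cographicCone.1 hy
  obtain ⟨h1, h2⟩ := Γ.mem_cographicCone.1 hxy.2
  have key : ∀ d, Γ.coord ℝ d (a • x + y) = a * Γ.coord ℝ d x + Γ.coord ℝ d y := fun d => by
    rw [map_add, map_smul, smul_eq_mul]
  refine Γ.mem_cographicCone.2 ⟨fun e he => ?_, fun d hd => ?_⟩
  · by_cases hT : e ∈ T
    · rw [hx2 _ (by rw [φ'.2]; exact hT)]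
    · have h := h1 e he
      rcases Γ.eq_or_eq_inv φ (φ'.1 e) with h' | h'
      · rw [φ'.2] at h'
        rw [h']; exact hx1 e hT
      · rw [φ'.2] at h'
        rw [h', Γ.coord_inv] at h ⊢
        rw [key] at h
        have hx' := hx1 e hT
        have hy' := hy1 e hT
        have : a * Γ.coord ℝ (φ.1 e) x ≤ 0 := by linarith
        nlinarith
  · by_cases hT : Γ.edge d ∈ T
    · exact hx2 d hT
    · refine Γ.coord_eq_zero φ ?_
      have h := h2 (φ.1 (Γ.edge d)) (by rw [φ.2]; exact hd)
      rw [key] at h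
      have hx' := hx1 _ hT
      have hy' := hy1 _ hT
      have : a * Γ.coord ℝ (φ.1 (Γ.edge d)) x ≤ 0 := by linarith
      nlinarith

theorem cographicCone_face_mem [Finite Γ.D] (T : Set Γ.E) (φ : Γ.Orientation)
    (τ : PointedCone ℝ (Γ.H1 ℝ)) (hτ : τ.IsFaceOf (Γ.cographicCone T φ)) :
    ∃ T', Γ.cographicCone T' φ = τ := by
  have hpos : ∀ x ∈ τ, ∀ e ∉ T, 0 ≤ Γ.coord ℝ (φ.1 e) x := fun x hx =>
    (Γ.mem_cographicCone.1 (hτ.le hx)).1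
  have hzero : ∀ x ∈ τ, ∀ d, Γ.edge d ∈ T → Γ.coord ℝ d x = 0 := fun x hx =>
    (Γ.mem_cographicCone.1 (hτ.le hx)).2
  let T' : Set Γ.E := {e | ∀ x ∈ τ, Γ.coord ℝ (φ.1 e) x = 0}
  have hTT' : T ⊆ T' := fun e he x hx => hzero x hx _ (by rw [φ.2]; exact he)
  -- a point of the face that is positive on every edge outside `T'`
  have hw : ∀ e, ∃ x ∈ τ, e ∉ T' → 0 < Γ.coord ℝ (φ.1 e) x := by
    intro e
    by_cases he : e ∈ T'
    · exact ⟨0, zero_mem τ, fun h => absurd he h⟩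
    · have h : ¬ ∀ x ∈ τ, Γ.coord ℝ (φ.1 e) x = 0 := he
      push Not at h
      obtain ⟨x, hx, hx0⟩ := h
      exact ⟨x, hx, fun _ =>
        lt_of_le_of_ne (hpos x hx e fun h => he (hTT' h)) (Ne.symm hx0)⟩
  choose p hpτ hp using hw
  have := Fintype.ofFinite Γ.E
  have hqτ : ∑ e, p e ∈ τ := sum_mem fun e _ => hpτ e
  have hq : ∀ e ∉ T', 0 < Γ.coord ℝ (φ.1 e) (∑ e, p e) := by
    intro e he
    rw [map_sum]
    exact Finset.sum_pos' (fun i _ => hpos _ (hpτ i) e fun h => he (hTT' h))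
      ⟨e, Finset.mem_univ e, hp e he⟩
  refine ⟨T', le_antisymm ?_ ?_⟩
  · intro y hy
    obtain ⟨hy1, hy2⟩ := Γ.mem_cographicCone.1 hy
    have hyσ : y ∈ Γ.cographicCone T φ := by
      refine Γ.mem_cographicCone.2 ⟨fun e he => ?_, fun d hd => hy2 d (hTT' hd)⟩
      by_cases h : e ∈ T'
      · rw [hy2 _ (by rw [φ.2]; exact h)]
      · exact hy1 e h
    -- a large multiple of the positive point dominates `y`
    have hN : ∃ N : ℝ, 0 ≤ N ∧
        ∀ e ∉ T', Γ.coord ℝ (φ.1 e) y ≤ N * Γ.coord ℝ (φ.1 e) (∑ e, p e) := by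
      have hnn : ∀ e, 0 ≤ |Γ.coord ℝ (φ.1 e) y| / |Γ.coord ℝ (φ.1 e) (∑ e, p e)| :=
        fun e => by positivity
      refine ⟨∑ e, |Γ.coord ℝ (φ.1 e) y| / |Γ.coord ℝ (φ.1 e) (∑ e, p e)|,
        Finset.sum_nonneg fun e _ => hnn e, fun e he => ?_⟩
      have h1 := Finset.single_le_sum (fun i _ => hnn i) (Finset.mem_univ e)
      have h2 := hq e he
      rw [abs_of_pos h2, div_le_iff₀ h2] at h1
      exact (le_abs_self _).trans h1
    obtain ⟨N, hN0, hN⟩ := hN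
    have hz : N • (∑ e, p e) - y ∈ Γ.cographicCone T φ := by
      refine Γ.mem_cographicCone.2 ⟨fun e he => ?_, fun d hd => ?_⟩
      · rw [map_sub, map_smul, smul_eq_mul]
        by_cases h : e ∈ T'
        · rw [hy2 _ (by rw [φ.2]; exact h), h _ hqτ]; simp
        · linarith [hN e h]
      · rw [map_sub, map_smul, hzero _ hqτ d hd, hy2 d (hTT' hd)]; simp
    refine hτ.mem_of_smul_add_mem hyσ hz one_pos ?_
    rw [one_smul, add_sub_cancel]
    exact PointedCone.smul_mem τ hN0 hqτ
  · intro x hx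
    exact Γ.mem_cographicCone.2 ⟨fun e he => hpos x hx e fun h => he (hTT' h),
      fun d hd => Γ.coord_eq_zero φ (hd x hx)⟩

/-- The cographic fan of a finite graph: the cones into which the hyperplanes `(·, e) = 0` cut
`H₁(Γ, ℝ)`, together with their faces.  These are the cones `σ(T, φ)`. -/
def cographicFan [Finite Γ.D] : RationalFan Γ.latticeMap where
  cones := {σ | ∃ T φ, Γ.cographicCone T φ = σ}
  nonempty := ⟨_, Set.univ, Classical.arbitrary _, rfl⟩
  finite := by
    refine (Set.finite_range fun p : Set Γ.E × Γ.Orientation => Γ.cographicCone p.1 p.2).subset ?_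
    rintro _ ⟨T, φ, rfl⟩
    exact ⟨(T, φ), rfl⟩
  rational_polyhedral := by
    rintro _ ⟨T, φ, rfl⟩
    exact Γ.cographicCone_rational T φ
  strongly_convex := by
    rintro _ ⟨T, φ, rfl⟩
    exact Γ.cographicCone_salient T φ
  face_mem := by
    rintro _ ⟨T, φ, rfl⟩ τ hτ
    obtain ⟨T', h⟩ := Γ.cographicCone_face_mem T φ τ hτ
    exact ⟨T', φ, h⟩
  inter_face := by
    rintro _ ⟨T, φ, rfl⟩ _ ⟨T', φ', rfl⟩
    exact Γ.cographicCone_inter_face T T' φ φ'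

/-- The cographic toric face ring `R_k(Γ)` of a finite graph. -/
abbrev CographicRing (k : Type w) [Field k] [Finite Γ.D] : Type (max v w) :=
  ToricFaceRing k Γ.cographicFan

end SerreGraph

end

/-!
A ring isomorphism remembers the minimal primes and all sums of minimal primes. In the cographic
ring the minimal primes are the ideals `coneIdeal` spanned by the monomials outside a chamber of
the fan: each is the kernel of a map to a monoid algebra of a free abelian group, which is a domain,
and their intersection is zero because the fan is complete. The sum of the ideals of some chambers
is spanned by the monomials outside the intersection of these chambers. So an isomorphism of
cographic rings, even one that respects neither the grading nor the scalars, gives a bijection of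
chambers respecting the inclusions between intersections of chambers (`exists_tope_equiv`).

Such a bijection respects adjacency of chambers, hence the number of hyperplanes that separate two
chambers, because some wall of a chamber always separates it from any given other chamber
(`exists_flip`). Therefore it induces a bijection of hyperplanes, and it respects the sets of
hyperplanes through a point, which can be read off from the chambers that contain the point
(`exists_equiv_zeroSets`).

Separating edges carry no cycle, and two non-separating edges define the same hyperplane exactly
when they are equal or form a separating pair. Hence contraction to a `3`-edge connectivization does
not change the lattice of cycles, the fan or the ring, and afterwards the hyperplanes are the edges.
The circuits are the complements of the maximal sets of hyperplanes through a nonzero point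
(`isCircuit_iff`), so isomorphic rings have cyclic equivalent `3`-edge connectivizations.

Conversely, a cyclic equivalence lifts to an isomorphism of lattices of cycles that changes each
coordinate by a sign. The fundamental circuits of corresponding maximal forests have corresponding
supports, and what has to be shown is that a matrix of fundamental circuits is determined by its
support up to signs of rows and columns (`exists_signs`). This holds for every matrix in which the
rows of any set have a signed sum with entries in `{-1, 0, 1}`: in a chordless cycle of rows and
columns such a sum must cancel in each column, which ties all the signs together. Cycles have this
property because every integral cycle is congruent modulo two to one with coordinates in
`{-1, 0, 1}` (`exists_small_congruent`).
-/

/-! ### Sign vectors of a finite family of functionals -/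

namespace SignArrangement

variable {L : Type*} [AddCommGroup L] {E : Type*} (l : E → L →+ ℤ)

/-- A family of functionals whose kernels are hyperplanes, no two of them equal. -/
def IsSimple : Prop :=
  (∀ e, ∃ c, l e c ≠ 0) ∧ ∀ e f, e ≠ f → ∃ c, l e c = 0 ∧ l f c ≠ 0

/-- The sign vector `s` is the one of an open chamber of the arrangement. -/
def IsTope (s : E → ℤˣ) : Prop := ∃ c, ∀ e, 0 < (s e : ℤ) * l e c

/-- The topes of the arrangement; they stand for its chambers. -/
abbrev Tope : Type _ := {s : E → ℤˣ // IsTope l s}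

/-- The point `a` lies in the closed chamber with sign vector `s`. -/
def InCone (s : E → ℤˣ) (a : L) : Prop := ∀ e, 0 ≤ (s e : ℤ) * l e a

/-- The intersection of the closed chambers in `T` is contained in the closed chamber `r`. -/
def Closes (T : Set (Tope l)) (r : Tope l) : Prop :=
  ∀ a, (∀ s ∈ T, InCone l s.1 a) → InCone l r.1 a

variable {l}

theorem units_mul_self (s : ℤˣ) : (s : ℤ) * s = 1 := by
  rcases Int.units_eq_one_or s with rfl | rfl <;> rfl

/-- A large multiple of `p` plus `y`: it has the signs of `p`, and those of `y` where `p`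
vanishes. -/
theorem exists_composition [Finite E] (p y : L) : ∃ q, ∀ e, (0 < l e p → 0 < l e q) ∧
    (l e p < 0 → l e q < 0) ∧ (l e p = 0 → l e q = l e y) := by
  have := Fintype.ofFinite E
  set N : ℕ := 1 + ∑ e, (l e y).natAbs with hN
  refine ⟨N • p + y, fun e => ?_⟩
  have h1 : (l e y).natAbs < N := by
    have := Finset.single_le_sum (f := fun e => (l e y).natAbs) (fun _ _ => Nat.zero_le _)
      (Finset.mem_univ e)
    omega
  have h2 : |l e y| < (N : ℤ) := by
    rw [Int.abs_eq_natAbs]; exact_mod_cast h1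
  rw [abs_lt] at h2
  have h3 : l e (N • p + y) = N * l e p + l e y := by
    rw [map_add, map_nsmul, nsmul_eq_mul]
  rw [h3]
  refine ⟨fun h => ?_, fun h => ?_, fun h => by rw [h, mul_zero, zero_add]⟩ <;> nlinarith

theorem exists_generic [Finite E] (h : IsSimple l) : ∃ c, ∀ e, l e c ≠ 0 := by
  classical
  have := Fintype.ofFinite E
  suffices H : ∀ T : Finset E, ∃ c, ∀ e ∈ T, l e c ≠ 0 by
    obtain ⟨c, hc⟩ := H Finset.univ
    exact ⟨c, fun e => hc e (Finset.mem_univ e)⟩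
  intro T
  induction T using Finset.induction_on with
  | empty => exact ⟨0, by simp⟩
  | insert e T _ ih =>
    obtain ⟨c, hc⟩ := ih
    obtain ⟨y, hy⟩ := h.1 e
    obtain ⟨q, hq⟩ := exists_composition (l := l) c y
    refine ⟨q, fun f hf => ?_⟩
    obtain ⟨q1, q2, q3⟩ := hq f
    rcases lt_trichotomy (l f c) 0 with h0 | h0 | h0
    · exact (q2 h0).ne
    · rw [q3 h0]
      rcases Finset.mem_insert.1 hf with rfl | hf
      · exact hy
      · exact absurd h0 (hc f hf)
    · exact (q1 h0).ne'

/-- Every point, moved slightly towards a generic point, lies in an open chamber. -/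
theorem exists_tope_near [Finite E] {d : L} (hd : ∀ e, l e d ≠ 0) (c : L) :
    ∃ s : Tope l, InCone l s.1 c ∧ ∀ e, l e c = 0 → 0 < (s.1 e : ℤ) * l e d := by
  classical
  obtain ⟨q, hq⟩ := exists_composition (l := l) c d
  have hq0 : ∀ e, l e q ≠ 0 := by
    intro e
    obtain ⟨q1, q2, q3⟩ := hq e
    rcases lt_trichotomy (l e c) 0 with h0 | h0 | h0
    · exact (q2 h0).ne
    · rw [q3 h0]; exact hd e
    · exact (q1 h0).ne'
  have hs : ∀ e, 0 < (((if 0 < l e q then 1 else -1 : ℤˣ)) : ℤ) * l e q := by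
    intro e
    split_ifs with h
    · simpa using h
    · have := hq0 e
      simp only [Units.val_neg, Units.val_one]
      omega
  refine ⟨⟨fun e => if 0 < l e q then 1 else -1, q, hs⟩, fun e => ?_, fun e he => ?_⟩
  · obtain ⟨q1, q2, q3⟩ := hq e
    rcases lt_trichotomy (l e c) 0 with h0 | h0 | h0
    · have := q2 h0
      simp only [if_neg this.not_gt, Units.val_neg, Units.val_one]
      omega
    · rw [h0, mul_zero]
    · have := q1 h0
      simp only [if_pos this, Units.val_one]
      omega
  · obtain ⟨q1, q2, q3⟩ := hq e
    rw [← q3 he]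
    exact hs e

/-- Moving from a point `c` that is positive on `Z` in the direction `-z`, some coordinate in `Z`
is the first to vanish. -/
theorem exists_first_zero {Z : Finset E} {c z : L} (hc : ∀ e ∈ Z, 0 < l e c)
    (hz : ∃ e ∈ Z, 0 < l e z) :
    ∃ g ∈ Z, 0 < l g z ∧ ∀ e ∈ Z, 0 ≤ l g z * l e c - l g c * l e z := by
  classical
  obtain ⟨e0, he0, he0'⟩ := hz
  obtain ⟨g, hg, hmin⟩ := Finset.exists_min_image (Z.filter fun e => 0 < l e z)
    (fun e => (l e c : ℚ) / l e z) ⟨e0, Finset.mem_filter.2 ⟨he0, he0'⟩⟩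
  obtain ⟨hgZ, hgz⟩ := Finset.mem_filter.1 hg
  refine ⟨g, hgZ, hgz, fun e he => ?_⟩
  have h1 := hc e he
  have h2 := hc g hgZ
  by_cases h : 0 < l e z
  · have := hmin e (Finset.mem_filter.2 ⟨he, h⟩)
    rw [div_le_div_iff₀ (by exact_mod_cast hgz) (by exact_mod_cast h)] at this
    have h3 : l g c * l e z ≤ l e c * l g z := by exact_mod_cast this
    linarith
  · have h4 : l g c * l e z ≤ 0 := mul_nonpos_of_nonneg_of_nonpos h2.le (not_lt.1 h)
    have : 0 < l g z * l e c := mul_pos hgz h1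
    linarith

/-- The positive chamber has a wall separating it from a given point outside it: some point is
negative on exactly one functional, and that functional is negative on the given point. -/
theorem exists_wall [Finite E] (h : IsSimple l) {c d : L} (hc : ∀ e, 0 < l e c)
    (hd : ∀ e, l e d ≠ 0) (hneg : ∃ e, l e d < 0) :
    ∃ e, l e d < 0 ∧ ∃ q, l e q < 0 ∧ ∀ f ≠ e, 0 < l f q := by
  classical
  have := Fintype.ofFinite E
  let P : Finset E → Prop := fun Z => Z.Nonempty ∧ (∀ e ∈ Z, l e d < 0) ∧
    ∃ p, (∀ e ∈ Z, l e p = 0) ∧ ∀ e ∉ Z, 0 < l e p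
  have hP : ∃ Z, P Z := by
    obtain ⟨g, -, hg, hmin⟩ := exists_first_zero (l := l) (Z := Finset.univ) (c := c) (z := -d)
      (fun e _ => hc e) (by
        obtain ⟨e, he⟩ := hneg
        exact ⟨e, Finset.mem_univ e, by rw [map_neg]; omega⟩)
    have hp : ∀ e, l e ((l g (-d)) • c - (l g c) • (-d)) =
        l g (-d) * l e c - l g c * l e (-d) := fun e => by
      rw [map_sub, map_zsmul, map_zsmul, smul_eq_mul, smul_eq_mul]
    refine ⟨Finset.univ.filter fun e => l e ((l g (-d)) • c - (l g c) • (-d)) = 0,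
      ⟨g, Finset.mem_filter.2 ⟨Finset.mem_univ g, by rw [hp]; ring⟩⟩, fun e he => ?_,
      (l g (-d)) • c - (l g c) • (-d), fun e he => (Finset.mem_filter.1 he).2, fun e he => ?_⟩
    · have h1 := (Finset.mem_filter.1 he).2
      rw [hp] at h1
      by_contra h2
      have h3 : 0 < l e d := lt_of_le_of_ne (not_lt.1 h2) (hd e).symm
      have h4 : 0 < l g (-d) * l e c := mul_pos hg (hc e)
      have h5 : 0 < l g c * l e d := mul_pos (hc g) h3
      rw [map_neg (l e), mul_neg] at h1
      linarith
    · have h1 := hmin e (Finset.mem_univ e)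
      rw [← hp] at h1
      exact lt_of_le_of_ne h1 fun h2 => he (Finset.mem_filter.2 ⟨Finset.mem_univ e, h2.symm⟩)
  obtain ⟨Z, ⟨⟨e, he⟩, hZd, p, hp0, hp1⟩, hmin⟩ :
      ∃ Z, P Z ∧ ∀ Z', P Z' → Z.card ≤ Z'.card := by
    obtain ⟨Z, hZ, hm⟩ := Set.exists_min_image {Z | P Z} Finset.card (Set.toFinite _) hP
    exact ⟨Z, hZ, hm⟩
  -- a zero set with a second element could be made smaller by moving `p` slightly
  have hZ : ∀ f ∈ Z, f = e := by
    intro f hf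
    by_contra hfe
    obtain ⟨z, hz0, hzf⟩ := h.2 e f (Ne.symm hfe)
    obtain ⟨z, hz0, hzf⟩ : ∃ z, l e z = 0 ∧ 0 < l f z := by
      rcases lt_or_gt_of_ne hzf with h' | h'
      · exact ⟨-z, by rw [map_neg, hz0, neg_zero], by rw [map_neg]; omega⟩
      · exact ⟨z, hz0, h'⟩
    obtain ⟨g, hgZ, hg, hmin'⟩ := exists_first_zero (l := l) (fun e _ => hc e) ⟨f, hf, hzf⟩
    have hy : ∀ e, l e ((l g z) • c - (l g c) • z) = l g z * l e c - l g c * l e z := fun e => by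
      rw [map_sub, map_zsmul, map_zsmul, smul_eq_mul, smul_eq_mul]
    obtain ⟨q, hq⟩ := exists_composition (l := l) p ((l g z) • c - (l g c) • z)
    have hqe : 0 < l e q := by
      rw [(hq e).2.2 (hp0 e he), hy, hz0, mul_zero, sub_zero]
      exact mul_pos hg (hc e)
    have hq' : P (Z.filter fun e => l e q = 0) := by
      refine ⟨⟨g, Finset.mem_filter.2 ⟨hgZ, ?_⟩⟩, fun e he => hZd e (Finset.mem_filter.1 he).1,
        q, fun e he => (Finset.mem_filter.1 he).2, fun e' he' => ?_⟩
      · rw [(hq g).2.2 (hp0 g hgZ), hy]; ring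
      · by_cases h1 : e' ∈ Z
        · have h2 := hmin' e' h1
          rw [← hy, ← (hq e').2.2 (hp0 e' h1)] at h2
          exact lt_of_le_of_ne h2 fun h3 => he' (Finset.mem_filter.2 ⟨h1, h3.symm⟩)
        · exact (hq e').1 (hp1 e' h1)
    have h1 := hmin _ hq'
    have h2 := Finset.card_lt_card (Finset.filter_ssubset.2 ⟨e, he, hqe.ne'⟩ :
      (Z.filter fun e => l e q = 0) ⊂ Z)
    omega
  refine ⟨e, hZd e he, ?_⟩
  obtain ⟨q, hq⟩ := exists_composition (l := l) p (-c)
  refine ⟨q, ?_, fun f hf => (hq f).1 (hp1 f fun h' => hf (hZ f h'))⟩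
  rw [(hq e).2.2 (hp0 e he), map_neg]
  have := hc e
  omega

/-- The family with the signs changed by `s`. -/
def twist (l : E → L →+ ℤ) (s : E → ℤˣ) : E → L →+ ℤ := fun e => (s e : ℤ) • l e

theorem twist_apply (s : E → ℤˣ) (e : E) (c : L) : twist l s e c = (s e : ℤ) * l e c := by
  simp [twist]

theorem units_mul_eq_zero {s : ℤˣ} {x : ℤ} : (s : ℤ) * x = 0 ↔ x = 0 := by simp

theorem IsSimple.twist (h : IsSimple l) (s : E → ℤˣ) :
    IsSimple (SignArrangement.twist l s) := by
  simpa only [IsSimple, twist_apply, ne_eq, units_mul_eq_zero] using h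

section Flip

variable [DecidableEq E]

/-- The sign vector `s` with its sign at `e` changed. -/
def flip (s : E → ℤˣ) (e : E) : E → ℤˣ := Function.update s e (-s e)

theorem flip_same (s : E → ℤˣ) (e : E) : flip s e e = -s e := Function.update_self ..

theorem flip_of_ne (s : E → ℤˣ) {e f : E} (h : f ≠ e) : flip s e f = s f :=
  Function.update_of_ne h ..

/-- One of the walls of a chamber separates it from a given other chamber. -/
theorem exists_flip [Finite E] (h : IsSimple l) {s r : E → ℤˣ} (hs : IsTope l s)
    (hr : IsTope l r) (hne : s ≠ r) : ∃ e, s e ≠ r e ∧ IsTope l (flip s e) := by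
  obtain ⟨c, hc⟩ := hs
  obtain ⟨d, hd⟩ := hr
  have key : ∀ e, twist l s e d < 0 ↔ s e ≠ r e := by
    intro e
    rw [twist_apply]
    have h1 := hd e
    rcases Int.units_eq_one_or (s e) with h2 | h2 <;>
      rcases Int.units_eq_one_or (r e) with h3 | h3 <;> simp [h2, h3] at h1 ⊢ <;> omega
  obtain ⟨e, he, q, hq, hq'⟩ := exists_wall (h.twist s) (c := c) (d := d)
    (fun e => by rw [twist_apply]; exact hc e)
    (fun e => by
      rw [twist_apply, Ne, units_mul_eq_zero]
      intro h0
      have := hd e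
      rw [h0, mul_zero] at this
      exact lt_irrefl _ this)
    (by
      obtain ⟨e, he⟩ := Function.ne_iff.1 hne
      exact ⟨e, (key e).2 he⟩)
  refine ⟨e, (key e).1 he, q, fun f => ?_⟩
  by_cases hf : f = e
  · subst hf
    rw [flip_same, Units.val_neg, neg_mul]
    rw [twist_apply] at hq
    omega
  · rw [flip_of_ne s hf, ← twist_apply]
    exact hq' f hf

end Flip

theorem eq_neg_of_ne {a b : ℤˣ} (h : a ≠ b) : b = -a := by
  rw [Int.units_ne_iff_eq_neg.1 h, neg_neg]

/-- Two topes differ in one place exactly when no third chamber contains the intersection of their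
chambers. -/
theorem adjacent_iff [Finite E] (h : IsSimple l) (s r : Tope l) :
    (∃ e, s.1 e ≠ r.1 e ∧ ∀ f ≠ e, s.1 f = r.1 f) ↔
      s ≠ r ∧ ∀ t : Tope l, Closes l {s, r} t → t = s ∨ t = r := by
  classical
  constructor
  · rintro ⟨e, he, hf⟩
    refine ⟨fun h => he (by rw [h]), fun t ht => ?_⟩
    obtain ⟨c, hc⟩ := s.2
    obtain ⟨d, hd⟩ := r.2
    -- a point in the relative interior of the common wall
    set p : L := |l e d| • c + |l e c| • d with hp
    have hpf : ∀ f, l f p = |l e d| * l f c + |l e c| * l f d := fun f => by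
      rw [hp, map_add, map_zsmul, map_zsmul, smul_eq_mul, smul_eq_mul]
    have hd0 : l e d ≠ 0 := fun h0 => by simpa [h0] using hd e
    have hc0 : l e c ≠ 0 := fun h0 => by simpa [h0] using hc e
    have hp0 : l e p = 0 := by
      rw [hpf]
      have h1 := hc e
      have h2 := hd e
      rw [eq_neg_of_ne he] at h2
      rcases Int.units_eq_one_or (s.1 e) with h3 | h3 <;> simp [h3] at h1 h2
      · rw [abs_of_pos h1, abs_of_neg h2]; ring
      · rw [abs_of_neg h1, abs_of_pos h2]; ring
    have hp1 : ∀ f ≠ e, 0 < (s.1 f : ℤ) * l f p := by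
      intro f hfe
      have h1 := hc f
      have h2 := hd f
      rw [← hf f hfe] at h2
      rw [hpf]
      have h3 := mul_pos (abs_pos.2 hd0) h1
      have h4 := mul_pos (abs_pos.2 hc0) h2
      linarith
    have hpt : InCone l t.1 p := by
      refine ht p fun t ht => ?_
      rcases ht with rfl | ht
      · intro f
        by_cases hfe : f = e
        · rw [hfe, hp0, mul_zero]
        · exact (hp1 f hfe).le
      · rw [Set.mem_singleton_iff] at ht
        subst ht
        intro f
        by_cases hfe : f = e
        · rw [hfe, hp0, mul_zero]
        · rw [← hf f hfe]; exact (hp1 f hfe).le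
    have htf : ∀ f ≠ e, t.1 f = s.1 f := by
      intro f hfe
      by_contra hne
      have h1 := hp1 f hfe
      have h2 := hpt f
      rw [eq_neg_of_ne (Ne.symm hne), Units.val_neg] at h2
      linarith
    by_cases hte : t.1 e = s.1 e
    · left
      refine Subtype.ext (funext fun f => ?_)
      by_cases hfe : f = e
      · rw [hfe, hte]
      · exact htf f hfe
    · right
      refine Subtype.ext (funext fun f => ?_)
      by_cases hfe : f = e
      · rw [hfe, eq_neg_of_ne (Ne.symm hte), eq_neg_of_ne he]
      · rw [htf f hfe, hf f hfe]
  · rintro ⟨hne, ht⟩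
    obtain ⟨e, he, hflip⟩ := exists_flip h s.2 r.2 (fun h => hne (Subtype.ext h))
    have h1 := ht ⟨flip s.1 e, hflip⟩ (by
      intro a ha f
      have h1 := ha s (Or.inl rfl) f
      have h2 := ha r (Or.inr rfl) f
      change 0 ≤ (flip s.1 e f : ℤ) * l f a
      by_cases hfe : f = e
      · subst hfe
        rw [flip_same, ← eq_neg_of_ne he]
        exact h2
      · rw [flip_of_ne _ hfe]
        exact h1)
    refine ⟨e, he, fun f hf => ?_⟩
    rcases h1 with h1 | h1
    · have h2 := congrFun (congrArg Subtype.val h1) e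
      change flip s.1 e e = s.1 e at h2
      rw [flip_same] at h2
      exact absurd h2 (by
        rcases Int.units_eq_one_or (s.1 e) with h3 | h3 <;> rw [h3] <;> decide)
    · have h2 := congrFun (congrArg Subtype.val h1) f
      change flip s.1 e f = r.1 f at h2
      rw [← h2, flip_of_ne _ hf]

section Hamming

variable [Fintype E]

theorem hammingDist_eq_one_iff {s r : E → ℤˣ} :
    hammingDist s r = 1 ↔ ∃ e, s e ≠ r e ∧ ∀ f ≠ e, s f = r f := by
  unfold hammingDist
  rw [Finset.card_eq_one]
  constructor
  · rintro ⟨e, he⟩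
    have h : ∀ f, s f ≠ r f ↔ f = e := fun f => by
      have := congrArg (f ∈ ·) he
      simpa using this
    exact ⟨e, (h e).2 rfl, fun f hf => not_not.1 fun h' => hf ((h f).1 h')⟩
  · rintro ⟨e, he, hf⟩
    refine ⟨e, Finset.ext fun f => ?_⟩
    simp only [Finset.mem_filter, Finset.mem_univ, true_and, Finset.mem_singleton]
    exact ⟨fun h => not_not.1 fun h' => h (hf f h'), fun h => h ▸ he⟩

variable [DecidableEq E]

theorem hammingDist_flip_self (s : E → ℤˣ) (e : E) : hammingDist s (flip s e) = 1 :=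
  hammingDist_eq_one_iff.2 ⟨e, by
    rw [flip_same]
    rcases Int.units_eq_one_or (s e) with h | h <;> rw [h] <;> decide,
    fun _ hf => (flip_of_ne s hf).symm⟩

theorem hammingDist_flip {s r : E → ℤˣ} {e : E} (h : s e ≠ r e) :
    hammingDist (flip s e) r + 1 = hammingDist s r := by
  unfold hammingDist
  have : ({i | s i ≠ r i} : Finset E) = insert e ({i | flip s e i ≠ r i} : Finset E) := by
    ext f
    by_cases hf : f = e
    · subst hf; simp [h]
    · simp [hf, flip_of_ne s hf]
  rw [this, Finset.card_insert_of_notMem]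
  simp [flip_same, eq_neg_of_ne h]

/-- The sign at `e` of a tope tells on which side of the wall between `s` and `flip s e` it
lies. -/
theorem eq_iff_hammingDist_lt {s r : E → ℤˣ} {e : E} :
    r e = s e ↔ hammingDist s r < hammingDist (flip s e) r := by
  by_cases h : s e = r e
  · have h1 : flip s e e ≠ r e := by
      rw [flip_same, ← h]
      rcases Int.units_eq_one_or (s e) with h | h <;> rw [h] <;> decide
    have h2 := hammingDist_flip h1
    have h3 : flip (flip s e) e = s := by
      funext f
      by_cases hf : f = e
      · subst hf; rw [flip_same, flip_same, neg_neg]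
      · rw [flip_of_ne _ hf, flip_of_ne _ hf]
    rw [h3] at h2
    exact ⟨fun _ => by omega, fun _ => h.symm⟩
  · have := hammingDist_flip h
    exact ⟨fun h' => absurd h'.symm h, fun h' => by omega⟩

/-- Every functional vanishes on a wall of some chamber. -/
theorem exists_flippable (h : IsSimple l) (e : E) :
    ∃ s : E → ℤˣ, IsTope l s ∧ IsTope l (flip s e) := by
  obtain ⟨c, hc⟩ := exists_generic h
  obtain ⟨s, -, hs⟩ := exists_tope_near hc 0
  obtain ⟨r, -, hr⟩ := exists_tope_near (l := l) (d := -c) (fun e => by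
    rw [map_neg]; exact neg_ne_zero.2 (hc e)) 0
  -- walk from `s` to its opposite; the sign at `e` changes at some step
  have key : ∀ n, ∀ s r : E → ℤˣ, IsTope l s → IsTope l r → s e ≠ r e → hammingDist s r = n →
      ∃ s : E → ℤˣ, IsTope l s ∧ IsTope l (flip s e) := by
    intro n
    induction n with
    | zero =>
      intro s r _ _ hne h0
      exact absurd (congrFun (hammingDist_eq_zero.1 h0) e) hne
    | succ n ih =>
      intro s r hs hr hne hn
      obtain ⟨f, hf, hflip⟩ := exists_flip h hs hr (fun h => hne (by rw [h]))
      by_cases hfe : e = f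
      · subst hfe; exact ⟨s, hs, hflip⟩
      · have := hammingDist_flip hf
        exact ih _ r hflip hr (by rw [flip_of_ne _ hfe]; exact hne) (by omega)
  refine key _ s.1 r.1 s.2 r.2 (fun heq => ?_) rfl
  have h1 := hs e (map_zero _)
  have h2 := hr e (map_zero _)
  rw [map_neg, ← heq] at h2
  linarith

end Hamming

section Transport

variable {L' : Type*} [AddCommGroup L'] {E' : Type*} {l' : E' → L' →+ ℤ}

/-- A bijection between the chambers of two arrangements that is compatible with the inclusions
between intersections of chambers. -/
def PreservesCloses (b : Tope l ≃ Tope l') : Prop :=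
  ∀ T r, Closes l T r ↔ Closes l' (b '' T) (b r)

theorem PreservesCloses.symm {b : Tope l ≃ Tope l'} (hb : PreservesCloses b) :
    PreservesCloses b.symm := by
  intro T r
  rw [hb (b.symm '' T) (b.symm r), ← Set.image_comp]
  simp

variable [Fintype E]

/-- Different functionals correspond to different functionals: two chambers on the two sides of a
wall are separated by one functional only. -/
theorem index_injective {b : Tope l ≃ Tope l'} (h : IsSimple l) {η : E → E'}
    (hη : ∀ e, ∀ r t : Tope l, r.1 e = t.1 e ↔ (b r).1 (η e) = (b t).1 (η e)) :
    Function.Injective η := by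
  classical
  intro e f hef
  by_contra hne
  obtain ⟨s, hs, hflip⟩ := exists_flippable h e
  have h1 := (hη f ⟨s, hs⟩ ⟨flip s e, hflip⟩).1 (flip_of_ne s (Ne.symm hne)).symm
  rw [← hef, ← hη] at h1
  change s e = flip s e e at h1
  rw [flip_same] at h1
  rcases Int.units_eq_one_or (s e) with h2 | h2 <;> rw [h2] at h1 <;> exact absurd h1 (by decide)

variable [Fintype E']

theorem PreservesCloses.hammingDist_le {b : Tope l ≃ Tope l'} (hb : PreservesCloses b)
    (h : IsSimple l) (h' : IsSimple l') (s r : Tope l) :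
    hammingDist (b s).1 (b r).1 ≤ hammingDist s.1 r.1 := by
  classical
  have hadj : ∀ s r : Tope l, hammingDist s.1 r.1 = 1 → hammingDist (b s).1 (b r).1 = 1 := by
    intro s r hsr
    rw [hammingDist_eq_one_iff, adjacent_iff h] at hsr
    rw [hammingDist_eq_one_iff, adjacent_iff h']
    refine ⟨fun h0 => hsr.1 (b.injective h0), fun t ht => ?_⟩
    have h1 : Closes l {s, r} (b.symm t) := by
      rw [hb, Set.image_pair, b.apply_symm_apply]
      exact ht
    rcases hsr.2 _ h1 with h2 | h2
    · exact Or.inl ((b.symm_apply_eq).1 h2)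
    · exact Or.inr ((b.symm_apply_eq).1 h2)
  generalize hn : hammingDist s.1 r.1 = n
  induction n generalizing s with
  | zero =>
    have : s = r := Subtype.ext (hammingDist_eq_zero.1 hn)
    rw [this, hammingDist_self]
  | succ n ih =>
    obtain ⟨e, he, hflip⟩ := exists_flip h s.2 r.2 (fun h => by
      rw [h, hammingDist_self] at hn
      omega)
    have h1 := hammingDist_flip he
    have h2 := ih ⟨flip s.1 e, hflip⟩ (by change hammingDist (flip s.1 e) r.1 = n; omega)
    have h3 := hadj s ⟨flip s.1 e, hflip⟩ (hammingDist_flip_self _ _)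
    have h4 := hammingDist_triangle (b s).1 (b ⟨flip s.1 e, hflip⟩).1 (b r).1
    omega

theorem PreservesCloses.hammingDist_eq {b : Tope l ≃ Tope l'} (hb : PreservesCloses b)
    (h : IsSimple l) (h' : IsSimple l') (s r : Tope l) :
    hammingDist (b s).1 (b r).1 = hammingDist s.1 r.1 := by
  refine le_antisymm (hb.hammingDist_le h h' s r) ?_
  have := hb.symm.hammingDist_le h' h (b s) (b r)
  simpa using this

/-- A functional of the first arrangement corresponds to one of the second that separates
corresponding pairs of chambers. -/
theorem PreservesCloses.exists_index {b : Tope l ≃ Tope l'} (hb : PreservesCloses b)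
    (h : IsSimple l) (h' : IsSimple l') (e : E) :
    ∃ e', ∀ r t : Tope l, r.1 e = t.1 e ↔ (b r).1 e' = (b t).1 e' := by
  classical
  obtain ⟨s, hs, hflip⟩ := exists_flippable h e
  obtain ⟨e', he', hf'⟩ := hammingDist_eq_one_iff.1
    ((hb.hammingDist_eq h h' ⟨s, hs⟩ ⟨flip s e, hflip⟩).trans (hammingDist_flip_self s e))
  have hb' : (b ⟨flip s e, hflip⟩).1 = flip (b ⟨s, hs⟩).1 e' := by
    funext f
    by_cases hf : f = e'
    · subst hf
      rw [flip_same]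
      exact eq_neg_of_ne he'
    · rw [flip_of_ne _ hf]; exact (hf' f hf).symm
  have key : ∀ r : Tope l, r.1 e = s e ↔ (b r).1 e' = (b ⟨s, hs⟩).1 e' := by
    intro r
    have h1 := hb.hammingDist_eq h h' ⟨s, hs⟩ r
    have h2 := hb.hammingDist_eq h h' ⟨flip s e, hflip⟩ r
    rw [eq_iff_hammingDist_lt, eq_iff_hammingDist_lt, ← hb', h1, h2]
  refine ⟨e', fun r t => ?_⟩
  have two : ∀ x y z : ℤˣ, x = y ↔ (x = z ↔ y = z) := by decide
  rw [two (r.1 e) _ (s e), two ((b r).1 e') _ ((b ⟨s, hs⟩).1 e'), key, key]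

/-- The zero sets of points are the sets of functionals separating two chambers of some closed set
of chambers. -/
theorem zeroSet_iff (h : IsSimple l) (Z : Set E) : (∃ c, ∀ e, l e c = 0 ↔ e ∈ Z) ↔
    ∃ T : Set (Tope l), T.Nonempty ∧ (∀ r, Closes l T r → r ∈ T) ∧
      ∀ e, (∃ r ∈ T, ∃ t ∈ T, r.1 e ≠ t.1 e) ↔ e ∈ Z := by
  obtain ⟨d, hd⟩ := exists_generic h
  have hd' : ∀ e, l e (-d) ≠ 0 := fun e => by rw [map_neg]; exact neg_ne_zero.2 (hd e)
  have key : ∀ c e, (∃ r : Tope l, InCone l r.1 c ∧ ∃ t : Tope l, InCone l t.1 c ∧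
      r.1 e ≠ t.1 e) ↔ l e c = 0 := by
    intro c e
    constructor
    · rintro ⟨r, hr, t, ht, hne⟩
      have h1 := hr e
      have h2 := ht e
      rw [eq_neg_of_ne hne, Units.val_neg, neg_mul] at h2
      exact units_mul_eq_zero.1 (le_antisymm (by linarith) h1 : (r.1 e : ℤ) * l e c = 0)
    · intro h0
      obtain ⟨r, hr, hr'⟩ := exists_tope_near hd c
      obtain ⟨t, ht, ht'⟩ := exists_tope_near hd' c
      refine ⟨r, hr, t, ht, fun heq => ?_⟩
      have h1 := hr' e h0
      have h2 := ht' e h0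
      rw [map_neg, ← heq] at h2
      linarith
  constructor
  · rintro ⟨c, hc⟩
    refine ⟨{r | InCone l r.1 c}, ?_, fun r hr => hr c fun s hs => hs, fun e => ?_⟩
    · obtain ⟨r, hr, -⟩ := exists_tope_near hd c
      exact ⟨r, hr⟩
    · rw [← hc, ← key c e]
      simp only [Set.mem_ofPred_eq]
  · rintro ⟨T, ⟨t, ht⟩, hT, hZ⟩
    -- a point of the common face of the chambers in `T` with as few zeros as possible
    have hw : ∀ e, ∃ a, (∀ s ∈ T, InCone l s.1 a) ∧
        ((∃ a, (∀ s ∈ T, InCone l s.1 a) ∧ l e a ≠ 0) → l e a ≠ 0) := by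
      intro e
      by_cases he : ∃ a, (∀ s ∈ T, InCone l s.1 a) ∧ l e a ≠ 0
      · obtain ⟨a, ha, ha'⟩ := he
        exact ⟨a, ha, fun _ => ha'⟩
      · exact ⟨0, fun s _ e => by simp, fun h => absurd h he⟩
    choose a ha ha' using hw
    have hsum : ∀ e, l e (∑ f, a f) = ∑ f, l e (a f) := fun e => map_sum _ _ _
    have hcT : ∀ s ∈ T, InCone l s.1 (∑ f, a f) := by
      intro s hs e
      rw [hsum, Finset.mul_sum]
      exact Finset.sum_nonneg fun f _ => ha f s hs e
    have hc0 : ∀ e, l e (∑ f, a f) = 0 → ∀ y, (∀ s ∈ T, InCone l s.1 y) → l e y = 0 := by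
      intro e he y hy
      by_contra hne
      have h1 := ha' e ⟨y, hy, hne⟩
      have h2 : (t.1 e : ℤ) * l e (∑ f, a f) = 0 := by rw [he, mul_zero]
      rw [hsum, Finset.mul_sum, Finset.sum_eq_zero_iff_of_nonneg fun f _ => ha f t ht e] at h2
      exact h1 (units_mul_eq_zero.1 (h2 e (Finset.mem_univ e)))
    refine ⟨∑ f, a f, fun e => ?_⟩
    rw [← hZ, ← key]
    have hmem : ∀ r : Tope l, InCone l r.1 (∑ f, a f) ↔ r ∈ T := by
      intro r
      refine ⟨fun hr => hT r fun y hy e => ?_, fun hr => hcT r hr⟩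
      by_cases he : l e (∑ f, a f) = 0
      · rw [hc0 e he y hy, mul_zero]
      · have h1 := hr e
        have h2 := hcT t ht e
        have h3 := hy t ht e
        by_cases heq : r.1 e = t.1 e
        · rw [heq]; exact h3
        · rw [eq_neg_of_ne (Ne.symm heq), Units.val_neg, neg_mul] at h1
          exact absurd (units_mul_eq_zero.1
            (le_antisymm (by linarith) h2 : (t.1 e : ℤ) * l e (∑ f, a f) = 0)) he
    simp only [hmem]

end Transport

/-- The inclusions between intersections of chambers determine the hyperplanes, and which of them
are the ones that contain a given point. -/
theorem exists_equiv_zeroSets [Finite E] {L' : Type*} [AddCommGroup L'] {E' : Type*} [Finite E']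
    {l' : E' → L' →+ ℤ} (h : IsSimple l) (h' : IsSimple l') (b : Tope l ≃ Tope l')
    (hb : PreservesCloses b) :
    ∃ η : E ≃ E', ∀ Z : Set E, (∃ c, ∀ e, l e c = 0 ↔ e ∈ Z) ↔
      ∃ c', ∀ e, l' (η e) c' = 0 ↔ e ∈ Z := by
  have := Fintype.ofFinite E
  have := Fintype.ofFinite E'
  choose η hη using hb.exists_index h h'
  choose θ hθ using hb.symm.exists_index h' h
  have hηi := index_injective h hη
  have hθi := index_injective h' hθ
  have hbij : Function.Bijective η := (Fintype.bijective_iff_injective_and_card η).2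
    ⟨hηi, le_antisymm (Fintype.card_le_of_injective η hηi) (Fintype.card_le_of_injective θ hθi)⟩
  refine ⟨Equiv.ofBijective η hbij, fun Z => ?_⟩
  have h1 : (∃ c', ∀ e, l' (η e) c' = 0 ↔ e ∈ Z) ↔ ∃ c', ∀ e', l' e' c' = 0 ↔ e' ∈ η '' Z := by
    refine exists_congr fun c' => ⟨fun hc e' => ?_, fun hc e => ?_⟩
    · obtain ⟨e, rfl⟩ := hbij.2 e'
      rw [hc, hηi.mem_set_image]
    · rw [hc, hηi.mem_set_image]
  change _ ↔ ∃ c', ∀ e, l' (η e) c' = 0 ↔ e ∈ Z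
  rw [h1, zeroSet_iff h, zeroSet_iff h']
  have hsep : ∀ (T : Set (Tope l)) e, (∃ r ∈ T, ∃ t ∈ T, r.1 e ≠ t.1 e) ↔
      ∃ r ∈ b '' T, ∃ t ∈ b '' T, r.1 (η e) ≠ t.1 (η e) := by
    intro T e
    simp only [Set.exists_mem_image, ne_eq, ← hη e]
  have hcl : ∀ T : Set (Tope l), (∀ r, Closes l T r → r ∈ T) ↔
      ∀ r, Closes l' (b '' T) r → r ∈ b '' T := by
    intro T
    rw [b.forall_congr_left]
    refine forall_congr' fun r => ?_
    rw [hb, b.apply_symm_apply, Set.mem_image_equiv]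
  constructor
  · rintro ⟨T, hT, hT', hZ⟩
    refine ⟨b '' T, hT.image _, (hcl T).1 hT', fun e' => ?_⟩
    obtain ⟨e, rfl⟩ := hbij.2 e'
    rw [← hsep, hZ, hηi.mem_set_image]
  · rintro ⟨T, hT, hT', hZ⟩
    have hTT : b '' (b ⁻¹' T) = T := Set.image_preimage_eq T b.surjective
    rw [← hTT] at hT hT'
    refine ⟨b ⁻¹' T, hT.of_image, (hcl _).2 hT', fun e => ?_⟩
    rw [hsep, hTT, hZ, hηi.mem_set_image]

end SignArrangement

/-! ### Cycles -/

namespace SerreGraph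

variable (Γ : SerreGraph.{u, v})

section Cycles

variable {A : Type w} [CommRing A]

theorem linearCombination_boundary [Fintype Γ.D] {M : Type*} [AddCommGroup M] [Module A M]
    (y : Γ.Chains A) (g : Γ.V → M) :
    Finsupp.linearCombination A g (Γ.boundary A y) = ∑ d, Γ.chainCoords A y d • g (Γ.t d) := by
  change Finsupp.linearCombination A g (Finsupp.mapDomain Γ.t (Γ.chainCoords A y)) = _
  rw [Finsupp.linearCombination_mapDomain, Finsupp.linearCombination_apply,
    Finsupp.sum_fintype _ _ (by intro i; exact zero_smul _ _)]
  rfl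

theorem sum_coord_smul_target [Fintype Γ.D] {M : Type*} [AddCommGroup M] [Module A M]
    (c : Γ.H1 A) (g : Γ.V → M) : ∑ d, Γ.coord A d c • g (Γ.t d) = 0 := by
  have h := Γ.linearCombination_boundary c.1 g
  have h0 : Γ.boundary A c.1 = 0 := c.2
  rw [h0, map_zero] at h
  exact h.symm

/-- Reversal of oriented edges, as a permutation. -/
def reverse : Equiv.Perm Γ.D := Function.Involutive.toPerm Γ.inv Γ.inv_inv

theorem sum_antisymm [Fintype Γ.D] {f : Γ.D → A} (hf : ∀ d, f (Γ.inv d) = - f d)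
    (g : Γ.V → A) : ∑ d, f d * g (Γ.s d) = - ∑ d, f d * g (Γ.t d) := by
  rw [← Equiv.sum_comp Γ.reverse, ← Finset.sum_neg_distrib]
  refine Finset.sum_congr rfl fun d _ => ?_
  change f (Γ.inv d) * g (Γ.s (Γ.inv d)) = _
  rw [hf, ← Γ.t_eq, neg_mul]

/-- A cycle is orthogonal to every coboundary. -/
theorem sum_coord_mul_sub [Fintype Γ.D] (c : Γ.H1 A) (g : Γ.V → A) :
    ∑ d, Γ.coord A d c * (g (Γ.t d) - g (Γ.s d)) = 0 := by
  simp only [mul_sub, Finset.sum_sub_distrib]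
  rw [Γ.sum_antisymm (f := fun d => Γ.coord A d c) (fun d => Γ.coord_inv A d c)]
  have := Γ.sum_coord_smul_target c g
  simp only [smul_eq_mul] at this
  rw [this, neg_zero, sub_zero]

theorem exists_chain [Finite Γ.D] (f : Γ.D → A) (hf : ∀ d, f (Γ.inv d) = - f d) :
    ∃ y : Γ.Chains A, ∀ d, Γ.chainCoords A y d = f d :=
  ⟨⟨Finsupp.equivFunOnFinite.symm f, hf⟩, fun _ => rfl⟩

/-- An antisymmetric function orthogonal to every coboundary is a cycle. -/
theorem exists_cycle [Fintype Γ.D] [NoZeroDivisors A] [CharZero A] (f : Γ.D → A)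
    (hf : ∀ d, f (Γ.inv d) = - f d)
    (hg : ∀ g : Γ.V → A, ∑ d, f d * (g (Γ.t d) - g (Γ.s d)) = 0) :
    ∃ c : Γ.H1 A, ∀ d, Γ.coord A d c = f d := by
  classical
  obtain ⟨y, hy⟩ := Γ.exists_chain f hf
  refine ⟨⟨y, ?_⟩, hy⟩
  change Γ.boundary A y = 0
  have key : ∀ g : Γ.V → A, Finsupp.linearCombination A g (Γ.boundary A y) = 0 := by
    intro g
    have h := hg g
    simp only [mul_sub, Finset.sum_sub_distrib] at h
    rw [Γ.sum_antisymm hf, sub_neg_eq_add, add_self_eq_zero] at h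
    rw [Γ.linearCombination_boundary]
    simpa only [hy, smul_eq_mul] using h
  ext v
  have h := key (Pi.single v 1)
  rw [Finsupp.linearCombination_apply] at h
  rw [Finsupp.zero_apply, ← h, Finsupp.sum]
  by_cases hv : v ∈ (Γ.boundary A y).support
  · rw [Finset.sum_eq_single v]
    · simp
    · intro b _ hb
      simp [hb]
    · intro h'; exact absurd hv h'
  · rw [Finsupp.notMem_support_iff.1 hv, Finset.sum_eq_zero]
    intro b hb
    have : b ≠ v := fun h' => hv (h' ▸ hb)
    simp [this]

theorem coord_eq_zero_of_edge {d f : Γ.D} (h : Γ.edge d = Γ.edge f) {c : Γ.H1 A}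
    (hf : Γ.coord A f c = 0) : Γ.coord A d c = 0 := by
  rcases Γ.edge_eq_iff.1 h with h' | h'
  · rw [← h', hf]
  · rw [h', Γ.coord_inv, neg_eq_zero] at hf
    exact hf

theorem chainCoords_chain [DecidableEq Γ.D] (d f : Γ.D) : Γ.chainCoords A (Γ.chain A d) f =
    (if d = f then 1 else 0) - if Γ.inv d = f then 1 else 0 := by
  change (Finsupp.single d (1 : A) - Finsupp.single (Γ.inv d) 1 : Γ.D →₀ A) f = _
  rw [Finsupp.sub_apply, Finsupp.single_apply, Finsupp.single_apply]

theorem chainCoords_inv (y : Γ.Chains A) (d : Γ.D) :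
    Γ.chainCoords A y (Γ.inv d) = - Γ.chainCoords A y d := y.2 d

end Cycles

section Directed

/-- There is a walk with `n` steps from `a` to the given vertex, along oriented edges satisfying
`P`. -/
inductive ReachIn (P : Γ.D → Prop) (a : Γ.V) : ℕ → Γ.V → Prop
  | start : ReachIn P a 0 a
  | step {n : ℕ} (f : Γ.D) : ReachIn P a n (Γ.s f) → P f → ReachIn P a (n + 1) (Γ.t f)

/-- A shortest directed walk is a chain with coordinates at most one. -/
theorem exists_path_chain {P : Γ.D → Prop} {a : Γ.V} {n : ℕ} {b : Γ.V}
    (h : Γ.ReachIn P a n b) (hmin : ∀ m < n, ¬ Γ.ReachIn P a m b) :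
    ∃ y : Γ.Chains ℤ, Γ.boundary ℤ y = Finsupp.single b 1 - Finsupp.single a 1 ∧
      (∀ f, Γ.chainCoords ℤ y f ≤ 1) ∧
      ∀ f, 0 < Γ.chainCoords ℤ y f → P f ∧ ∃ m < n, Γ.ReachIn P a m (Γ.s f) := by
  classical
  induction h with
  | start =>
    refine ⟨0, by rw [map_zero, sub_self], fun f => ?_, fun f hf => ?_⟩
    · rw [map_zero, Finsupp.zero_apply]; exact zero_le_one
    · rw [map_zero, Finsupp.zero_apply] at hf; exact absurd hf (lt_irrefl _)
  | @step n g hg hPg ih =>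
    have hmin' : ∀ m < n, ¬ Γ.ReachIn P a m (Γ.s g) :=
      fun m hm hr => hmin (m + 1) (by omega) (.step g hr hPg)
    obtain ⟨y, hy, hy1, hyP⟩ := ih hmin'
    have hyg : Γ.chainCoords ℤ y g ≤ 0 := by
      by_contra h
      obtain ⟨-, m, hm, hr⟩ := hyP g (not_le.1 h)
      exact hmin' m hm hr
    have hval : ∀ f, Γ.chainCoords ℤ (y + Γ.chain ℤ g) f = Γ.chainCoords ℤ y f +
        ((if g = f then 1 else 0) - if Γ.inv g = f then 1 else 0) := fun f => by
      rw [map_add, Finsupp.add_apply, chainCoords_chain]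
    have hne := Γ.inv_ne g
    refine ⟨y + Γ.chain ℤ g, ?_, fun f => ?_, fun f hf => ?_⟩
    · rw [map_add, hy, boundary_chain]; abel
    · rw [hval]
      by_cases h : g = f
      · subst h; simp only [if_true, if_neg hne]; omega
      · rw [if_neg h]
        have := hy1 f
        split_ifs <;> omega
    · rw [hval] at hf
      by_cases h : g = f
      · subst h; exact ⟨hPg, n, Nat.lt_succ_self n, hg⟩
      · rw [if_neg h] at hf
        obtain ⟨h1, m, hm, h2⟩ := hyP f (by split_ifs at hf <;> omega)
        exact ⟨h1, m, by omega, h2⟩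

/-- Every oriented edge on which a cycle is positive lies on a directed simple closed walk along
which the cycle is positive. -/
theorem exists_conformal [Finite Γ.D] {A : Type w} [CommRing A] [LinearOrder A]
    [IsStrictOrderedRing A] (c : Γ.H1 A) {d : Γ.D} (hd : 0 < Γ.coord A d c) :
    ∃ x : Γ.H1 ℤ, Γ.coord ℤ d x = 1 ∧ (∀ f, Γ.coord ℤ f x ≤ 1) ∧
      ∀ f, 0 < Γ.coord ℤ f x → 0 < Γ.coord A f c := by
  classical
  have := Fintype.ofFinite Γ.D
  set P : Γ.D → Prop := fun f => 0 < Γ.coord A f c with hP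
  -- otherwise the flow of `c` out of the set of reachable vertices would be nonzero
  have hreach : ∃ n, Γ.ReachIn P (Γ.t d) n (Γ.s d) := by
    by_contra hno
    have hsum := Γ.sum_coord_mul_sub c fun v => if ∃ n, Γ.ReachIn P (Γ.t d) n v then 1 else 0
    have hterm : ∀ f, 0 ≤ Γ.coord A f c * ((if ∃ n, Γ.ReachIn P (Γ.t d) n (Γ.t f) then 1 else 0) -
        if ∃ n, Γ.ReachIn P (Γ.t d) n (Γ.s f) then 1 else 0) := by
      intro f
      by_cases h1 : ∃ n, Γ.ReachIn P (Γ.t d) n (Γ.t f) <;>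
        by_cases h2 : ∃ n, Γ.ReachIn P (Γ.t d) n (Γ.s f)
      · simp [h1, h2]
      · rw [if_pos h1, if_neg h2, sub_zero, mul_one]
        by_contra h3
        obtain ⟨n, hn⟩ := h1
        rw [Γ.t_eq f] at hn
        refine h2 ⟨n + 1, ?_⟩
        rw [Γ.s_eq f]
        refine .step _ hn ?_
        change 0 < Γ.coord A (Γ.inv f) c
        rw [Γ.coord_inv]
        exact neg_pos.2 (not_le.1 h3)
      · rw [if_neg h1, if_pos h2, zero_sub, mul_neg, mul_one, neg_nonneg]
        by_contra h3
        obtain ⟨n, hn⟩ := h2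
        exact h1 ⟨n + 1, .step f hn (not_le.1 h3)⟩
      · simp [h1, h2]
    have h1 := (Finset.sum_eq_zero_iff_of_nonneg fun f _ => hterm f).1 hsum d (Finset.mem_univ d)
    rw [if_pos ⟨0, .start⟩, if_neg hno, sub_zero, mul_one] at h1
    exact hd.ne' h1
  obtain ⟨y, hy, hy1, hyP⟩ := Γ.exists_path_chain (Nat.find_spec hreach)
    fun m hm => Nat.find_min hreach hm
  have hyd : Γ.chainCoords ℤ y d = 0 := by
    refine le_antisymm ?_ ?_
    · by_contra h
      obtain ⟨-, m, hm, hr⟩ := hyP d (not_le.1 h)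
      exact Nat.find_min hreach hm hr
    · by_contra h
      obtain ⟨h1, -⟩ := hyP (Γ.inv d) (by rw [chainCoords_inv]; omega)
      change 0 < Γ.coord A (Γ.inv d) c at h1
      rw [Γ.coord_inv] at h1
      exact lt_asymm hd (neg_pos.1 h1)
  have hval : ∀ f, Γ.chainCoords ℤ (y + Γ.chain ℤ d) f = Γ.chainCoords ℤ y f +
      ((if d = f then 1 else 0) - if Γ.inv d = f then 1 else 0) := fun f => by
    rw [map_add, Finsupp.add_apply, chainCoords_chain]
  have hcyc : Γ.boundary ℤ (y + Γ.chain ℤ d) = 0 := by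
    rw [map_add, hy, boundary_chain]; abel
  have hne := Γ.inv_ne d
  refine ⟨⟨y + Γ.chain ℤ d, hcyc⟩, ?_, fun f => ?_, fun f hf => ?_⟩
  · change Γ.chainCoords ℤ (y + Γ.chain ℤ d) d = 1
    rw [hval, hyd, if_pos rfl, if_neg hne]; rfl
  · change Γ.chainCoords ℤ (y + Γ.chain ℤ d) f ≤ 1
    rw [hval]
    by_cases h : d = f
    · subst h; rw [hyd, if_pos rfl, if_neg hne]; omega
    · rw [if_neg h]
      have := hy1 f
      split_ifs <;> omega
  · change 0 < Γ.chainCoords ℤ (y + Γ.chain ℤ d) f at hf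
    rw [hval] at hf
    by_cases h : d = f
    · subst h; exact hd
    · rw [if_neg h] at hf
      exact (hyP f (by split_ifs at hf <;> omega)).1

/-- Every integral cycle is congruent modulo two to one with coordinates in `{-1, 0, 1}`. -/
theorem exists_small_congruent [Finite Γ.D] (c : Γ.H1 ℤ) :
    ∃ x : Γ.H1 ℤ, ∀ d, |Γ.coord ℤ d x| ≤ 1 ∧ Γ.coord ℤ d x ≡ Γ.coord ℤ d c [ZMOD 2] := by
  have := Fintype.ofFinite Γ.D
  generalize hn : ∑ d, (Γ.coord ℤ d c).natAbs = n
  induction n using Nat.strong_induction_on generalizing c with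
  | _ n ih =>
    by_cases h : ∃ d, 2 ≤ Γ.coord ℤ d c
    · obtain ⟨d, hd⟩ := h
      obtain ⟨x, hx1, hx2, hx3⟩ := Γ.exists_conformal c (d := d) (by omega)
      have hval : ∀ f, Γ.coord ℤ f (c - (2 : ℤ) • x) = Γ.coord ℤ f c - 2 * Γ.coord ℤ f x :=
        fun f => by rw [map_sub, map_zsmul, smul_eq_mul]
      have hle : ∀ f, (Γ.coord ℤ f (c - (2 : ℤ) • x)).natAbs ≤ (Γ.coord ℤ f c).natAbs := by
        intro f
        rw [hval]
        have h1 := hx2 f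
        have h2 := hx2 (Γ.inv f)
        have h3 := hx3 f
        have h4 := hx3 (Γ.inv f)
        rw [Γ.coord_inv] at h2 h4
        rw [Γ.coord_inv] at h4
        omega
      have hlt : ∑ f, (Γ.coord ℤ f (c - (2 : ℤ) • x)).natAbs < n := by
        rw [← hn]
        refine Finset.sum_lt_sum (fun f _ => hle f) ⟨d, Finset.mem_univ d, ?_⟩
        rw [hval, hx1]
        omega
      obtain ⟨z, hz⟩ := ih _ hlt (c - (2 : ℤ) • x) rfl
      refine ⟨z, fun f => ⟨(hz f).1, ?_⟩⟩
      have := (hz f).2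
      rw [hval] at this
      simp only [Int.ModEq] at this ⊢
      omega
    · refine ⟨c, fun f => ⟨?_, rfl⟩⟩
      push Not at h
      have h1 := h f
      have h2 := h (Γ.inv f)
      rw [Γ.coord_inv] at h2
      rw [abs_le]
      omega

end Directed

/-! ### Separating edges -/

section Separating

/-- Removing edges increases the number of components exactly when it disconnects the end points of
one of them. -/
theorem numComponents_lt_iff [Finite Γ.V] (S : Set Γ.E) :
    Γ.numComponents < (Γ.deleteEdges S).numComponents ↔ ∃ d, Γ.edge d ∈ S ∧
      Quot.mk (Γ.deleteEdges S).Joined (Γ.s d) ≠ Quot.mk (Γ.deleteEdges S).Joined (Γ.t d) := by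
  let q : Quot (Γ.deleteEdges S).Joined → Quot Γ.Joined :=
    Quot.lift (fun v => Quot.mk Γ.Joined v) (by
      rintro a b ⟨d, hd, hd'⟩
      exact Quot.sound ⟨d.1, hd, hd'⟩)
  have hq : Function.Surjective q := by
    rintro ⟨v⟩
    exact ⟨Quot.mk _ v, rfl⟩
  have : Finite (Quot (Γ.deleteEdges S).Joined) :=
    Finite.of_surjective (fun v : Γ.V => Quot.mk (Γ.deleteEdges S).Joined v) Quot.mk_surjective
  have hlt : Γ.numComponents < (Γ.deleteEdges S).numComponents ↔ ¬ Function.Injective q := by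
    constructor
    · intro h hi
      exact absurd (Nat.card_eq_of_bijective q ⟨hi, hq⟩) h.ne'
    · intro hi
      refine lt_of_le_of_ne (Nat.card_le_card_of_surjective q hq) fun heq => hi ?_
      exact ((Nat.bijective_iff_surjective_and_card q).2 ⟨hq, heq.symm⟩).1
  rw [hlt]
  constructor
  · intro hi
    by_contra! h
    let r : Quot Γ.Joined → Quot (Γ.deleteEdges S).Joined :=
      Quot.lift (fun v => Quot.mk (Γ.deleteEdges S).Joined v) (by
        rintro a b ⟨d, rfl, rfl⟩
        by_cases hd : Γ.edge d ∈ S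
        · exact h d hd
        · exact Quot.sound ⟨⟨d, hd⟩, rfl, rfl⟩)
    refine hi (Function.LeftInverse.injective (g := r) ?_)
    rintro ⟨v⟩
    rfl
  · rintro ⟨d, -, hd⟩ hi
    exact hd (hi (Quot.sound ⟨d, rfl, rfl⟩))

theorem exists_chain_of_connected (S : Set Γ.E) {a b : Γ.V}
    (h : Quot.mk (Γ.deleteEdges S).Joined a = Quot.mk (Γ.deleteEdges S).Joined b) :
    ∃ y : Γ.Chains ℤ, Γ.boundary ℤ y = Finsupp.single b 1 - Finsupp.single a 1 ∧
      ∀ f, Γ.edge f ∈ S → Γ.chainCoords ℤ y f = 0 := by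
  classical
  have h' := Quot.eqvGen_exact h
  clear h
  induction h' with
  | rel a b hab =>
    obtain ⟨d, rfl, rfl⟩ := hab
    refine ⟨Γ.chain ℤ d.1, Γ.boundary_chain ℤ d.1, fun f hf => ?_⟩
    have h1 : d.1 ≠ f := fun h => d.2 (by rw [h]; exact hf)
    have h2 : Γ.inv d.1 ≠ f := fun h => d.2 (by rw [← Γ.edge_inv, h]; exact hf)
    rw [chainCoords_chain, if_neg h1, if_neg h2, sub_zero]
  | refl a => exact ⟨0, by rw [map_zero, sub_self], fun f _ => by rw [map_zero]; rfl⟩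
  | symm a b _ ih =>
    obtain ⟨y, hy, hy'⟩ := ih
    refine ⟨-y, by rw [map_neg, hy]; abel, fun f hf => ?_⟩
    rw [map_neg, Finsupp.neg_apply, hy' f hf, neg_zero]
  | trans a b c _ _ ih1 ih2 =>
    obtain ⟨y, hy, hy'⟩ := ih1
    obtain ⟨z, hz, hz'⟩ := ih2
    refine ⟨y + z, by rw [map_add, hy, hz]; abel, fun f hf => ?_⟩
    rw [map_add, Finsupp.add_apply, hy' f hf, hz' f hf, add_zero]

/-- The end points of a removed edge remain connected exactly when a cycle passes through this edge
and through no other removed edge. -/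
theorem connected_iff_exists_cycle [Finite Γ.D] (S : Set Γ.E) {d : Γ.D} (hd : Γ.edge d ∈ S) :
    Quot.mk (Γ.deleteEdges S).Joined (Γ.s d) = Quot.mk (Γ.deleteEdges S).Joined (Γ.t d) ↔
      ∃ c : Γ.H1 ℤ, Γ.coord ℤ d c ≠ 0 ∧
        ∀ f, Γ.edge f ∈ S → Γ.edge f ≠ Γ.edge d → Γ.coord ℤ f c = 0 := by
  classical
  have := Fintype.ofFinite Γ.D
  constructor
  · intro h
    obtain ⟨y, hy, hy'⟩ := Γ.exists_chain_of_connected S h.symm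
    have hval : ∀ f, Γ.chainCoords ℤ (y + Γ.chain ℤ d) f = Γ.chainCoords ℤ y f +
        ((if d = f then 1 else 0) - if Γ.inv d = f then 1 else 0) := fun f => by
      rw [map_add, Finsupp.add_apply, chainCoords_chain]
    have hcyc : Γ.boundary ℤ (y + Γ.chain ℤ d) = 0 := by
      rw [map_add, hy, boundary_chain]; abel
    refine ⟨⟨y + Γ.chain ℤ d, hcyc⟩, ?_, fun f hf hfd => ?_⟩
    · change Γ.chainCoords ℤ (y + Γ.chain ℤ d) d ≠ 0
      rw [hval, hy' d hd, if_pos rfl, if_neg (Γ.inv_ne d)]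
      decide
    · change Γ.chainCoords ℤ (y + Γ.chain ℤ d) f = 0
      rw [hval, hy' f hf, if_neg (fun h => hfd (by rw [h])),
        if_neg (fun h => hfd (by rw [← h, Γ.edge_inv]))]
      rfl
  · rintro ⟨c, hc, hc'⟩
    by_contra hne
    -- the flow of `c` out of the component of the target of `d`
    set U : Γ.V → Prop := fun v =>
      Quot.mk (Γ.deleteEdges S).Joined v = Quot.mk (Γ.deleteEdges S).Joined (Γ.t d) with hU
    have hsum := Γ.sum_coord_mul_sub c fun v => if U v then 1 else 0
    have hUd : ¬ U (Γ.s d) := hne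
    have hUd' : U (Γ.t d) := rfl
    have hterm : ∀ f, Γ.edge f ≠ Γ.edge d →
        Γ.coord ℤ f c * ((if U (Γ.t f) then 1 else 0) - if U (Γ.s f) then 1 else 0) = 0 := by
      intro f hf
      by_cases hS : Γ.edge f ∈ S
      · rw [hc' f hS hf, zero_mul]
      · have : Quot.mk (Γ.deleteEdges S).Joined (Γ.s f) =
            Quot.mk (Γ.deleteEdges S).Joined (Γ.t f) := Quot.sound ⟨⟨f, hS⟩, rfl, rfl⟩
        have h : U (Γ.t f) ↔ U (Γ.s f) := by simp only [hU, this]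
        simp only [h, sub_self, mul_zero]
    have hpair : ∑ f, Γ.coord ℤ f c * ((if U (Γ.t f) then 1 else 0) - if U (Γ.s f) then 1 else 0) =
        ∑ f ∈ {d, Γ.inv d}, Γ.coord ℤ f c *
          ((if U (Γ.t f) then 1 else 0) - if U (Γ.s f) then 1 else 0) := by
      refine (Finset.sum_subset (Finset.subset_univ _) fun f _ hf => hterm f fun h => ?_).symm
      simp only [Finset.mem_insert, Finset.mem_singleton, not_or] at hf
      rcases Γ.edge_eq_iff.1 h.symm with h' | h'
      · exact hf.1 h'
      · exact hf.2 h'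
    rw [hpair, Finset.sum_pair (Γ.inv_ne d).symm, Γ.coord_inv, ← Γ.s_eq, ← Γ.t_eq, if_pos hUd',
      if_neg hUd] at hsum
    omega

theorem isSeparating_iff [Finite Γ.V] [Finite Γ.D] (d : Γ.D) :
    Γ.IsSeparating (Γ.edge d) ↔ ∀ c : Γ.H1 ℤ, Γ.coord ℤ d c = 0 := by
  unfold IsSeparating
  rw [numComponents_lt_iff]
  constructor
  · rintro ⟨f, hf, hne⟩ c
    by_contra hc
    refine hne ((Γ.connected_iff_exists_cycle _ hf).2 ⟨c, fun h => hc ?_, fun g hg hgf => ?_⟩)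
    · exact Γ.coord_eq_zero_of_edge (Set.mem_singleton_iff.1 hf).symm h
    · exact absurd ((Set.mem_singleton_iff.1 hg).trans (Set.mem_singleton_iff.1 hf).symm) hgf
  · intro h
    refine ⟨d, rfl, fun heq => ?_⟩
    obtain ⟨c, hc, -⟩ := (Γ.connected_iff_exists_cycle {Γ.edge d} rfl).1 heq
    exact hc (h c)

/-- Two non-separating edges are equal or form a separating pair exactly when the same cycles avoid
them. -/
theorem eq_or_isSeparatingPair_iff [Finite Γ.V] [Finite Γ.D] {d f : Γ.D}
    (hd : ¬ Γ.IsSeparating (Γ.edge d)) :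
    (Γ.edge f = Γ.edge d ∨ Γ.IsSeparatingPair (Γ.edge d) (Γ.edge f)) ↔
      ∀ c : Γ.H1 ℤ, Γ.coord ℤ d c = 0 ↔ Γ.coord ℤ f c = 0 := by
  by_cases hdf : Γ.edge f = Γ.edge d
  · exact ⟨fun _ c => ⟨Γ.coord_eq_zero_of_edge hdf, Γ.coord_eq_zero_of_edge hdf.symm⟩,
      fun _ => Or.inl hdf⟩
  have hcomp : (∀ c : Γ.H1 ℤ, Γ.coord ℤ f c = 0 → Γ.coord ℤ d c = 0) ∨
      (∀ c : Γ.H1 ℤ, Γ.coord ℤ d c = 0 → Γ.coord ℤ f c = 0) ↔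
      Γ.numComponents < (Γ.deleteEdges {Γ.edge d, Γ.edge f}).numComponents := by
    rw [numComponents_lt_iff]
    constructor
    · rintro (h | h)
      · refine ⟨d, Or.inl rfl, fun heq => ?_⟩
        obtain ⟨c, hc, hc'⟩ :=
          (Γ.connected_iff_exists_cycle {Γ.edge d, Γ.edge f} (Or.inl rfl)).1 heq
        exact hc (h c (hc' f (Or.inr rfl) hdf))
      · refine ⟨f, Or.inr rfl, fun heq => ?_⟩
        obtain ⟨c, hc, hc'⟩ :=
          (Γ.connected_iff_exists_cycle {Γ.edge d, Γ.edge f} (Or.inr rfl)).1 heq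
        exact hc (h c (hc' d (Or.inl rfl) (Ne.symm hdf)))
    · rintro ⟨g, hg, hne⟩
      by_contra! h
      obtain ⟨⟨c, hc1, hc2⟩, ⟨c', hc1', hc2'⟩⟩ := h
      rcases hg with hg | hg
      · refine hne ((Γ.connected_iff_exists_cycle _ (Or.inl hg)).2
          ⟨c, fun h => hc2 (Γ.coord_eq_zero_of_edge hg.symm h), fun g' hg' hne' => ?_⟩)
        rcases hg' with hg' | hg'
        · exact absurd (hg'.trans hg.symm) hne'
        · exact Γ.coord_eq_zero_of_edge hg' hc1
      · refine hne ((Γ.connected_iff_exists_cycle _ (Or.inr hg)).2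
          ⟨c', fun h => hc2' (Γ.coord_eq_zero_of_edge (Set.mem_singleton_iff.1 hg).symm h),
            fun g' hg' hne' => ?_⟩)
        rcases hg' with hg' | hg'
        · exact Γ.coord_eq_zero_of_edge hg' hc1'
        · exact absurd ((Set.mem_singleton_iff.1 hg').trans (Set.mem_singleton_iff.1 hg).symm) hne'
  -- two functionals, both nonzero, have equal kernels as soon as one kernel contains the other
  have hker : ∀ a b : Γ.D, ¬ Γ.IsSeparating (Γ.edge a) →
      (∀ c : Γ.H1 ℤ, Γ.coord ℤ b c = 0 → Γ.coord ℤ a c = 0) →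
      ∀ c : Γ.H1 ℤ, Γ.coord ℤ a c = 0 → Γ.coord ℤ b c = 0 := by
    intro a b ha h c hc
    rw [isSeparating_iff] at ha
    push Not at ha
    obtain ⟨z, hz⟩ := ha
    have h1 := h ((Γ.coord ℤ b z) • c - (Γ.coord ℤ b c) • z) (by
      rw [map_sub, map_smul, map_smul, smul_eq_mul, smul_eq_mul]; ring)
    rw [map_sub, map_smul, map_smul, smul_eq_mul, smul_eq_mul, hc, mul_zero, zero_sub,
      neg_eq_zero] at h1
    exact (mul_eq_zero.1 h1).resolve_right hz
  constructor
  · rintro (h | ⟨-, -, hf, hlt⟩)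
    · exact absurd h hdf
    · rcases hcomp.2 hlt with h | h
      · exact fun c => ⟨hker d f hd h c, h c⟩
      · exact fun c => ⟨h c, hker f d hf h c⟩
  · intro h
    refine Or.inr ⟨Ne.symm hdf, hd, fun hf => hd ?_, hcomp.1 (Or.inl fun c => (h c).2)⟩
    rw [isSeparating_iff] at hf ⊢
    exact fun c => (h c).2 (hf c)

end Separating

end SerreGraph

namespace SerreGraph

variable (Γ : SerreGraph.{u, v})

/-! ### Supports of cycles and contractions -/

section Support

variable {Γ}

/-- The set of edges through which an integral cycle passes. -/
def cycleSupport (c : Γ.H1 ℤ) : Set Γ.E := {e | ∃ d, Γ.edge d = e ∧ Γ.coord ℤ d c ≠ 0}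

theorem edge_mem_cycleSupport {c : Γ.H1 ℤ} {d : Γ.D} :
    Γ.edge d ∈ cycleSupport c ↔ Γ.coord ℤ d c ≠ 0 :=
  ⟨fun ⟨_, hf, h⟩ h0 => h (Γ.coord_eq_zero_of_edge hf h0), fun h => ⟨d, rfl, h⟩⟩

theorem edge_surjective : Function.Surjective Γ.edge := Quot.mk_surjective

theorem isSeparating_iff_notMem [Finite Γ.V] [Finite Γ.D] (e : Γ.E) :
    Γ.IsSeparating e ↔ ∀ c : Γ.H1 ℤ, e ∉ cycleSupport c := by
  obtain ⟨d, rfl⟩ := edge_surjective e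
  simp only [isSeparating_iff, edge_mem_cycleSupport, not_not]

theorem eq_or_isSeparatingPair_iff_mem [Finite Γ.V] [Finite Γ.D] {e f : Γ.E}
    (he : ¬ Γ.IsSeparating e) : (f = e ∨ Γ.IsSeparatingPair e f) ↔
      ∀ c : Γ.H1 ℤ, e ∈ cycleSupport c ↔ f ∈ cycleSupport c := by
  obtain ⟨d, rfl⟩ := edge_surjective e
  obtain ⟨d', rfl⟩ := edge_surjective f
  rw [Γ.eq_or_isSeparatingPair_iff he]
  simp only [edge_mem_cycleSupport, not_iff_not]

end Support

/-- A contraction set consists of the separating edges and of the edges that are not the chosen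
representative of the edges lying on the same cycles. -/
theorem exists_isContractionSet [Finite Γ.V] [Finite Γ.D] : ∃ F, Γ.IsContractionSet F := by
  classical
  rcases isEmpty_or_nonempty Γ.E with hE | hE
  · exact ⟨∅, fun e => isEmptyElim e, fun e => isEmptyElim e⟩
  set vanishing : Γ.E → Set (Γ.H1 ℤ) := fun e => {c | e ∈ cycleSupport c} with hv
  have hiff : ∀ e f, vanishing e = vanishing f ↔
      ∀ c : Γ.H1 ℤ, e ∈ cycleSupport c ↔ f ∈ cycleSupport c := fun e f => Set.ext_iff
  have hrep : ∀ e, vanishing (Function.invFun vanishing (vanishing e)) = vanishing e :=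
    fun e => Function.invFun_eq ⟨e, rfl⟩
  refine ⟨{e | Γ.IsSeparating e ∨ e ≠ Function.invFun vanishing (vanishing e)},
    fun e he => Or.inl he, fun e he => ⟨Function.invFun vanishing (vanishing e), ⟨?_, ?_⟩, ?_⟩⟩
  · rintro (h | h)
    · refine he ?_
      rw [isSeparating_iff_notMem] at h ⊢
      exact fun c hc => h c (((hiff _ _).1 (hrep e) c).2 hc)
    · exact h (by rw [hrep])
  · rw [eq_or_isSeparatingPair_iff_mem he, ← hiff, hrep]
  · rintro f ⟨hf, hf'⟩
    rw [eq_or_isSeparatingPair_iff_mem he, ← hiff] at hf'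
    have : f = Function.invFun vanishing (vanishing f) := by
      by_contra h; exact hf (Or.inr h)
    rw [this, hf']

section Contract

instance (F : Set Γ.E) [Finite Γ.V] : Finite (Γ.contract F).V :=
  Finite.of_surjective (fun v : Γ.V => (Quot.mk _ v : (Γ.contract F).V)) Quot.mk_surjective

instance (F : Set Γ.E) [Finite Γ.D] : Finite (Γ.contract F).D :=
  inferInstanceAs (Finite {d : Γ.D // Γ.edge d ∉ F})

instance (W : Set Γ.V) (S : Set Γ.E) (h : ∀ d, Γ.edge d ∈ S → Γ.s d ∈ W) [Finite Γ.V] :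
    Finite (Γ.subgraph W S h).V := inferInstanceAs (Finite W)

instance (W : Set Γ.V) (S : Set Γ.E) (h : ∀ d, Γ.edge d ∈ S → Γ.s d ∈ W) [Finite Γ.D] :
    Finite (Γ.subgraph W S h).D := inferInstanceAs (Finite {d : Γ.D // Γ.edge d ∈ S})

/-- The oriented edges of a contracted graph are oriented edges of the graph. -/
def contractEmb (F : Set Γ.E) : (Γ.contract F).D ↪ Γ.D :=
  ⟨fun d : {d // Γ.edge d ∉ F} => d.1, Subtype.val_injective⟩

/-- The oriented edges of a subgraph are oriented edges of the graph. -/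
def subgraphEmb (W : Set Γ.V) (S : Set Γ.E) (h : ∀ d, Γ.edge d ∈ S → Γ.s d ∈ W) :
    (Γ.subgraph W S h).D ↪ Γ.D :=
  ⟨fun d : {d // Γ.edge d ∈ S} => d.1, Subtype.val_injective⟩

/-- Forgetting the coordinates at the contracted edges turns cycles into cycles. -/
theorem exists_contract_cycle [Finite Γ.D] (F : Set Γ.E) (c : Γ.H1 ℤ) :
    ∃ c' : (Γ.contract F).H1 ℤ, ∀ d : {d // Γ.edge d ∉ F},
      (Γ.contract F).coord ℤ d c' = Γ.coord ℤ d.1 c := by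
  have := Fintype.ofFinite Γ.D
  have := Fintype.ofFinite (Γ.contract F).D
  refine (Γ.contract F).exists_cycle (fun d => Γ.coord ℤ d.1 c) (fun d => Γ.coord_inv ℤ d.1 c)
    fun g => ?_
  refine Eq.trans (Fintype.sum_of_injective (Γ.contractEmb F)
    (Γ.contractEmb F).injective _ _ (fun d hd => ?_) fun d => rfl)
    (Γ.sum_coord_mul_sub c fun v => g (Quot.mk _ v))
  have hd' : Γ.edge d ∈ F := not_not.1 fun h => hd ⟨⟨d, h⟩, rfl⟩
  have : (Quot.mk _ (Γ.s d) : (Γ.contract F).V) = Quot.mk _ (Γ.t d) :=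
    Quot.sound ⟨d, hd', rfl, rfl⟩
  change Γ.coord ℤ d c * (g (Quot.mk _ (Γ.t d)) - g (Quot.mk _ (Γ.s d))) = 0
  rw [this, sub_self, mul_zero]

/-- Cycles lift along contractions: the boundary of the extension by zero of a cycle of the
contracted graph is a combination of boundaries of contracted edges. -/
theorem exists_cycle_of_contract [Finite Γ.D] (F : Set Γ.E) (c' : (Γ.contract F).H1 ℤ) :
    ∃ c : Γ.H1 ℤ, ∀ d : {d // Γ.edge d ∉ F},
      (Γ.contract F).coord ℤ d c' = Γ.coord ℤ d.1 c := by
  classical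
  have := Fintype.ofFinite Γ.D
  have := Fintype.ofFinite (Γ.contract F).D
  let K : Submodule ℤ (Γ.Chains ℤ) :=
    { carrier := {y | ∀ d, Γ.edge d ∉ F → Γ.chainCoords ℤ y d = 0}
      zero_mem' := fun d _ => by rw [map_zero]; rfl
      add_mem' := fun {y z} hy hz d hd => by
        rw [map_add, Finsupp.add_apply, hy d hd, hz d hd, add_zero]
      smul_mem' := fun r y hy d hd => by
        rw [map_smul, Finsupp.smul_apply, hy d hd, smul_zero] }
  let N : Submodule ℤ (Γ.V →₀ ℤ) := K.map (Γ.boundary ℤ)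
  let φ : (Γ.contract F).V → (Γ.V →₀ ℤ) ⧸ N :=
    Quot.lift (fun v => N.mkQ (Finsupp.single v 1)) (by
      rintro a b ⟨d, hd, rfl, rfl⟩
      refine Eq.symm ((Submodule.Quotient.eq N).2 ?_)
      rw [← boundary_chain]
      refine ⟨Γ.chain ℤ d, fun f hf => ?_, rfl⟩
      have h1 : d ≠ f := fun h => hf (h ▸ hd)
      have h2 : Γ.inv d ≠ f := fun h => hf (by rw [← h, Γ.edge_inv]; exact hd)
      rw [chainCoords_chain, if_neg h1, if_neg h2, sub_zero])
  obtain ⟨y, hy⟩ := Γ.exists_chain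
    (fun d => if h : Γ.edge d ∈ F then 0 else (Γ.contract F).coord ℤ ⟨d, h⟩ c') (by
      intro d
      by_cases h : Γ.edge d ∈ F
      · rw [dif_pos h, dif_pos (by rw [Γ.edge_inv]; exact h), neg_zero]
      · rw [dif_neg h, dif_neg (by rw [Γ.edge_inv]; exact h)]
        exact (Γ.contract F).coord_inv ℤ ⟨d, h⟩ c')
  have h0 : N.mkQ (Γ.boundary ℤ y) = 0 := by
    have h1 : N.mkQ = Finsupp.linearCombination ℤ fun v => N.mkQ (Finsupp.single v 1) := by
      refine Finsupp.lhom_ext' fun v => LinearMap.ext_ring ?_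
      simp
    rw [h1, Γ.linearCombination_boundary]
    refine Eq.trans (Fintype.sum_of_injective (Γ.contractEmb F)
      (Γ.contractEmb F).injective _ _ (fun d hd => ?_) fun d => ?_).symm
      ((Γ.contract F).sum_coord_smul_target c' φ)
    · have hd' : Γ.edge d ∈ F := not_not.1 fun h => hd ⟨⟨d, h⟩, rfl⟩
      rw [hy, dif_pos hd', zero_smul]
    · change _ = Γ.chainCoords ℤ y d.1 • _
      rw [hy, dif_neg d.2]
      rfl
  obtain ⟨z, hz, hzy⟩ : Γ.boundary ℤ y ∈ N := (Submodule.Quotient.mk_eq_zero N).1 h0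
  refine ⟨⟨y - z, by change Γ.boundary ℤ (y - z) = 0; rw [map_sub, hzy, sub_self]⟩, fun d => ?_⟩
  change _ = Γ.chainCoords ℤ (y - z) d.1
  rw [map_sub, Finsupp.sub_apply, hz d.1 d.2, sub_zero, hy, dif_neg d.2]

/-- Contracting a contraction set does not change the lattice of cycles. -/
theorem exists_contract_equiv [Finite Γ.V] [Finite Γ.D] {F : Set Γ.E}
    (hF : Γ.IsContractionSet F) :
    ∃ ψ : Γ.H1 ℤ ≃+ (Γ.contract F).H1 ℤ, ∀ c (d : {d // Γ.edge d ∉ F}),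
      (Γ.contract F).coord ℤ d (ψ c) = Γ.coord ℤ d.1 c := by
  choose ψ hψ using Γ.exists_contract_cycle F
  refine ⟨AddEquiv.ofBijective (AddMonoidHom.mk' ψ fun a b => ?_) ⟨?_, fun c' => ?_⟩, hψ⟩
  · refine (Γ.contract F).H1_ext ℤ fun d => ?_
    rw [map_add]
    exact (hψ _ d).trans ((map_add _ _ _).trans (congrArg₂ _ (hψ a d).symm (hψ b d).symm))
  · rw [injective_iff_map_eq_zero]
    intro c hc
    refine Γ.H1_ext ℤ fun d => ?_
    rw [map_zero]
    have hc' : ∀ f : {d // Γ.edge d ∉ F}, Γ.coord ℤ f.1 c = 0 := fun f => by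
      rw [← hψ]
      change ψ c = 0 at hc
      rw [hc, map_zero]
    by_cases hd : Γ.IsSeparating (Γ.edge d)
    · exact (Γ.isSeparating_iff d).1 hd c
    · obtain ⟨f, ⟨hf, hf'⟩, -⟩ := hF.2 _ hd
      obtain ⟨f, rfl⟩ := edge_surjective f
      exact ((Γ.eq_or_isSeparatingPair_iff hd).1 hf' c).2 (hc' ⟨f, hf⟩)
  · obtain ⟨c, hc⟩ := Γ.exists_cycle_of_contract F c'
    exact ⟨c, (Γ.contract F).H1_ext ℤ fun d => (hψ c d).trans (hc d).symm⟩

/-- If every cycle avoiding one of two edges avoids the other, then the signs of two cycles agree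
on one edge exactly when they do on the other. -/
theorem mul_nonneg_iff_of_zero_iff {d f : Γ.D}
    (h : ∀ c : Γ.H1 ℤ, Γ.coord ℤ d c = 0 ↔ Γ.coord ℤ f c = 0) (a b : Γ.H1 ℤ) :
    0 ≤ Γ.coord ℤ d a * Γ.coord ℤ d b ↔ 0 ≤ Γ.coord ℤ f a * Γ.coord ℤ f b := by
  have h1 : Γ.coord ℤ f ((Γ.coord ℤ d b) • a - (Γ.coord ℤ d a) • b) = 0 := by
    rw [← h, map_sub, map_smul, map_smul, smul_eq_mul, smul_eq_mul]; ring
  rw [map_sub, map_smul, map_smul, smul_eq_mul, smul_eq_mul, sub_eq_zero] at h1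
  by_cases ha : Γ.coord ℤ d a = 0
  · rw [ha, (h a).1 ha, zero_mul, zero_mul]
  by_cases hb : Γ.coord ℤ d b = 0
  · rw [hb, (h b).1 hb, mul_zero, mul_zero]
  have ha' : 0 < Γ.coord ℤ f a * Γ.coord ℤ f a := mul_self_pos.2 fun h0 => ha ((h a).2 h0)
  have ha2 : 0 < Γ.coord ℤ d a * Γ.coord ℤ d a := mul_self_pos.2 ha
  have h2 : Γ.coord ℤ d a * Γ.coord ℤ d b * (Γ.coord ℤ f a * Γ.coord ℤ f a) =
      Γ.coord ℤ f a * Γ.coord ℤ f b * (Γ.coord ℤ d a * Γ.coord ℤ d a) := by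
    linear_combination Γ.coord ℤ d a * Γ.coord ℤ f a * h1
  rw [← mul_nonneg_iff_of_pos_right ha', h2, mul_nonneg_iff_of_pos_right ha2]

end Contract

/-! ### Circuits -/

section Circuit

variable {A : Type w} [CommRing A] [NoZeroDivisors A] [CharZero A]

/-- Cycles of a subgraph, extended by zero, are cycles. -/
theorem exists_extend_cycle [Finite Γ.D] {W : Set Γ.V} {S : Set Γ.E}
    (h : ∀ d, Γ.edge d ∈ S → Γ.s d ∈ W) (c : (Γ.subgraph W S h).H1 A) :
    ∃ c' : Γ.H1 A, (∀ d : {d // Γ.edge d ∈ S}, Γ.coord A d.1 c' =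
      (Γ.subgraph W S h).coord A d c) ∧ ∀ d, Γ.edge d ∉ S → Γ.coord A d c' = 0 := by
  classical
  have := Fintype.ofFinite Γ.D
  have := Fintype.ofFinite (Γ.subgraph W S h).D
  obtain ⟨c', hc'⟩ := Γ.exists_cycle
    (fun d => if hd : Γ.edge d ∈ S then (Γ.subgraph W S h).coord A ⟨d, hd⟩ c else 0) (by
      intro d
      by_cases hd : Γ.edge d ∈ S
      · rw [dif_pos hd, dif_pos (by rw [Γ.edge_inv]; exact hd)]
        exact (Γ.subgraph W S h).coord_inv A ⟨d, hd⟩ c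
      · rw [dif_neg hd, dif_neg (by rw [Γ.edge_inv]; exact hd), neg_zero]) (by
      intro g
      refine Eq.trans (Fintype.sum_of_injective (Γ.subgraphEmb W S h)
        (Γ.subgraphEmb W S h).injective _ _ (fun d hd => ?_) fun d => ?_).symm
        ((Γ.subgraph W S h).sum_coord_mul_sub c fun v => g v.1)
      · rw [dif_neg fun h => hd ⟨⟨d, h⟩, rfl⟩, zero_mul]
      · have hd : Γ.edge (Γ.subgraphEmb W S h d) ∈ S := d.2
        rw [dif_pos hd]
        rfl)
  exact ⟨c', fun d => by rw [hc', dif_pos d.2], fun d hd => by rw [hc', dif_neg hd]⟩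

/-- Cycles with support in a subgraph are cycles of the subgraph. -/
theorem exists_restrict_cycle [Finite Γ.D] {W : Set Γ.V} {S : Set Γ.E}
    (h : ∀ d, Γ.edge d ∈ S → Γ.s d ∈ W) (c : Γ.H1 A)
    (hc : ∀ d, Γ.edge d ∉ S → Γ.coord A d c = 0) :
    ∃ c' : (Γ.subgraph W S h).H1 A, ∀ d : {d // Γ.edge d ∈ S},
      (Γ.subgraph W S h).coord A d c' = Γ.coord A d.1 c := by
  classical
  have := Fintype.ofFinite Γ.D
  have := Fintype.ofFinite (Γ.subgraph W S h).D
  refine (Γ.subgraph W S h).exists_cycle (fun d => Γ.coord A d.1 c)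
    (fun d => Γ.coord_inv A d.1 c) fun g => ?_
  refine Eq.trans (Fintype.sum_of_injective (Γ.subgraphEmb W S h)
    (Γ.subgraphEmb W S h).injective _ _
    (fun d hd => mul_eq_zero_of_left (hc d fun h => hd ⟨⟨d, h⟩, rfl⟩) _) fun d => ?_)
    (Γ.sum_coord_mul_sub c fun v => if hv : v ∈ W then g ⟨v, hv⟩ else 0)
  have hs : Γ.s (Γ.subgraphEmb W S h d) ∈ W := h d.1 d.2
  have ht : Γ.t (Γ.subgraphEmb W S h d) ∈ W := by
    rw [Γ.t_eq]; exact h _ (by rw [Γ.edge_inv]; exact d.2)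
  rw [dif_pos hs, dif_pos ht]
  rfl

/-- In a cyclic graph, every nonzero cycle passes through all edges. -/
theorem IsCyclic.coord_ne_zero {Γ : SerreGraph.{u, v}} [Finite Γ.V] [Finite Γ.D]
    (hΓ : Γ.IsCyclic) {c : Γ.H1 ℤ} {d : Γ.D} (hd : Γ.coord ℤ d c ≠ 0) (f : Γ.D) :
    Γ.coord ℤ f c ≠ 0 := by
  obtain ⟨-, hsep, hb⟩ := hΓ
  obtain ⟨b, -, hspan⟩ := finrank_eq_one_iff'.1 hb
  obtain ⟨x, hx⟩ : ∃ x : Γ.H1 ℤ, Γ.coord ℤ f x ≠ 0 := by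
    have := hsep (Γ.edge f)
    rw [isSeparating_iff] at this
    push Not at this
    exact this
  obtain ⟨r, hr⟩ := hspan (Γ.latticeMap x)
  obtain ⟨q, hq⟩ := hspan (Γ.latticeMap c)
  have hbf : Γ.coord ℝ f b ≠ 0 := by
    intro h0
    have h1 := Γ.coord_latticeMap f x
    rw [← hr, map_smul, h0, smul_zero] at h1
    exact hx (by exact_mod_cast h1.symm)
  have hq0 : q ≠ 0 := by
    rintro rfl
    have h1 := Γ.coord_latticeMap d c
    rw [← hq, zero_smul, map_zero] at h1
    exact hd (by exact_mod_cast h1.symm)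
  intro h0
  have h1 := Γ.coord_latticeMap f c
  rw [← hq, map_smul, h0, Int.cast_zero, smul_eq_mul] at h1
  exact (mul_ne_zero hq0 hbf) h1

theorem exists_coord_ne_zero {Γ : SerreGraph.{u, v}} {A : Type w} [CommRing A] {c : Γ.H1 A}
    (hc : c ≠ 0) : ∃ d, Γ.coord A d c ≠ 0 := by
  by_contra! h
  exact hc (Γ.H1_ext A fun d => by rw [h d, map_zero])

/-- A graph without isolated vertices on which every nonzero cycle passes through all edges, and
which carries a nonzero cycle, is cyclic. -/
theorem isCyclic_of_coord_ne_zero {Γ : SerreGraph.{u, v}} [Finite Γ.V] [Finite Γ.D]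
    (hV : ∀ v, ∃ d, Γ.s d = v) (hne : ∃ c : Γ.H1 ℤ, c ≠ 0)
    (hfull : ∀ (c : Γ.H1 ℤ) d f, Γ.coord ℤ d c ≠ 0 → Γ.coord ℤ f c ≠ 0) : Γ.IsCyclic := by
  classical
  have := Fintype.ofFinite Γ.D
  obtain ⟨c, hc⟩ := hne
  obtain ⟨d, hd⟩ := exists_coord_ne_zero hc
  refine ⟨?_, ?_, ?_⟩
  · refine Nat.card_eq_one_iff_exists.2 ⟨Quot.mk _ (Γ.s d), ?_⟩
    rintro ⟨v⟩
    obtain ⟨f, rfl⟩ := hV v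
    -- the part of `c` in the component of `d` is a cycle
    obtain ⟨z, hz⟩ := Γ.exists_cycle (A := ℤ)
      (fun f => if Quot.mk Γ.Joined (Γ.s f) = Quot.mk Γ.Joined (Γ.s d) then Γ.coord ℤ f c else 0)
      (by
        intro f
        have : Quot.mk Γ.Joined (Γ.s (Γ.inv f)) = Quot.mk Γ.Joined (Γ.s f) := by
          rw [← Γ.t_eq]; exact (Quot.sound ⟨f, rfl, rfl⟩).symm
        rw [this, Γ.coord_inv]
        split_ifs <;> simp)
      (by
        intro g
        refine Eq.trans (Fintype.sum_congr _ _ fun f => ?_) (Γ.sum_coord_mul_sub c fun v =>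
          if Quot.mk Γ.Joined v = Quot.mk Γ.Joined (Γ.s d) then g v else 0)
        have : Quot.mk Γ.Joined (Γ.t f) = Quot.mk Γ.Joined (Γ.s f) :=
          (Quot.sound ⟨f, rfl, rfl⟩).symm
        rw [this]
        split_ifs <;> simp)
    have h1 := hfull z d f (by rw [hz, if_pos rfl]; exact hd)
    rw [hz] at h1
    exact not_not.1 fun h => h1 (if_neg h)
  · intro e
    obtain ⟨f, rfl⟩ := edge_surjective e
    rw [isSeparating_iff]
    exact fun h => hfull c d f hd (h c)
  · refine finrank_eq_one_iff'.2 ⟨Γ.latticeMap c, fun h0 => ?_, fun y => ?_⟩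
    · have h1 := Γ.coord_latticeMap d c
      rw [h0, map_zero] at h1
      exact hd (by exact_mod_cast h1.symm)
    · refine ⟨Γ.coord ℝ d y / Γ.coord ℤ d c, ?_⟩
      by_contra hne
      set z : Γ.H1 ℝ := y - (Γ.coord ℝ d y / Γ.coord ℤ d c) • Γ.latticeMap c with hz
      have hzd : Γ.coord ℝ d z = 0 := by
        have : (Γ.coord ℤ d c : ℝ) ≠ 0 := by exact_mod_cast hd
        rw [hz, map_sub, map_smul, Γ.coord_latticeMap, smul_eq_mul, div_mul_cancel₀ _ this,
          sub_self]
      obtain ⟨f, hf⟩ := exists_coord_ne_zero (c := z) (fun h0 => hne (sub_eq_zero.1 h0).symm)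
      obtain ⟨f, hf⟩ : ∃ f, 0 < Γ.coord ℝ f z := by
        rcases lt_or_gt_of_ne hf with h | h
        · exact ⟨Γ.inv f, by rw [Γ.coord_inv]; exact neg_pos.2 h⟩
        · exact ⟨f, h⟩
      obtain ⟨x, hx1, -, hx⟩ := Γ.exists_conformal z hf
      have h1 := hfull x f d (by rw [hx1]; exact one_ne_zero)
      rcases lt_or_gt_of_ne h1 with h2 | h2
      · have h3 := hx (Γ.inv d) (by rw [Γ.coord_inv]; omega)
        rw [Γ.coord_inv, hzd, neg_zero] at h3
        exact lt_irrefl _ h3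
      · exact (hx d h2).ne' hzd

/-- Circuits are the minimal nonempty supports of integral cycles. -/
theorem isCircuit_iff [Finite Γ.V] [Finite Γ.D] (S : Set Γ.E) : Γ.IsCircuit S ↔
    S.Nonempty ∧ (∃ c : Γ.H1 ℤ, cycleSupport c = S) ∧
      ∀ c : Γ.H1 ℤ, (cycleSupport c).Nonempty → cycleSupport c ⊆ S → cycleSupport c = S := by
  constructor
  · rintro ⟨W, h, hcyc⟩
    -- a nonzero integral cycle of the cyclic subgraph
    obtain ⟨d, hd⟩ : ∃ d : {d // Γ.edge d ∈ S}, True := by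
      obtain ⟨b, hb, -⟩ := finrank_eq_one_iff'.1 hcyc.2.2
      obtain ⟨d, -⟩ := exists_coord_ne_zero hb
      exact ⟨d, trivial⟩
    obtain ⟨x, hx⟩ : ∃ x : (Γ.subgraph W S h).H1 ℤ, (Γ.subgraph W S h).coord ℤ d x ≠ 0 := by
      have := hcyc.2.1 ((Γ.subgraph W S h).edge d)
      rw [(Γ.subgraph W S h).isSeparating_iff d] at this
      push Not at this
      exact this
    refine ⟨⟨_, d.2⟩, ?_, fun c hc hcS => ?_⟩
    · obtain ⟨x', hx', hx0⟩ := Γ.exists_extend_cycle h x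
      refine ⟨x', Set.ext fun e => ?_⟩
      obtain ⟨f, rfl⟩ := edge_surjective e
      rw [edge_mem_cycleSupport]
      refine ⟨fun h1 => not_not.1 fun h2 => h1 (hx0 f h2), fun hf => ?_⟩
      rw [hx' ⟨f, hf⟩]
      exact hcyc.coord_ne_zero hx _
    · obtain ⟨c', hc'⟩ := Γ.exists_restrict_cycle h c fun f hf =>
        not_not.1 fun h' => hf (hcS (edge_mem_cycleSupport.2 h'))
      obtain ⟨e, he⟩ := hc
      obtain ⟨f, rfl⟩ := edge_surjective e
      refine Set.Subset.antisymm hcS fun e' he' => ?_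
      obtain ⟨f', rfl⟩ := edge_surjective e'
      rw [edge_mem_cycleSupport, ← hc' ⟨f', he'⟩]
      refine hcyc.coord_ne_zero (d := ⟨f, hcS he⟩) ?_ _
      rw [hc' ⟨f, hcS he⟩]
      exact edge_mem_cycleSupport.1 he
  · rintro ⟨hne, ⟨c, rfl⟩, hmin⟩
    refine ⟨{v | ∃ d, Γ.edge d ∈ cycleSupport c ∧ Γ.s d = v}, fun d hd => ⟨d, hd, rfl⟩,
      isCyclic_of_coord_ne_zero ?_ ?_ ?_⟩
    · rintro ⟨v, d, hd, rfl⟩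
      exact ⟨⟨d, hd⟩, rfl⟩
    · obtain ⟨c', hc'⟩ := Γ.exists_restrict_cycle
        (W := {v | ∃ d, Γ.edge d ∈ cycleSupport c ∧ Γ.s d = v})
        (fun d hd => ⟨d, hd, rfl⟩) c fun f hf =>
          not_not.1 fun h' => hf (edge_mem_cycleSupport.2 h')
      refine ⟨c', fun h0 => ?_⟩
      obtain ⟨e, he⟩ := hne
      obtain ⟨f, rfl⟩ := edge_surjective e
      have h1 := hc' ⟨f, he⟩
      rw [h0, map_zero] at h1
      exact edge_mem_cycleSupport.1 he h1.symm
    · intro x d f hd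
      obtain ⟨x', hx', hx0⟩ := Γ.exists_extend_cycle _ x
      have h1 := hmin x' ⟨Γ.edge d.1, edge_mem_cycleSupport.2 (by rw [hx' d]; exact hd)⟩ (by
        intro e he
        obtain ⟨g, rfl⟩ := edge_surjective e
        exact not_not.1 fun h => edge_mem_cycleSupport.1 he (hx0 g h))
      have h2 : Γ.edge f.1 ∈ cycleSupport x' := by rw [h1]; exact f.2
      rw [edge_mem_cycleSupport, hx' f] at h2
      exact h2

/-- A bijection of edges that induces a bijection of the supports of cycles is a cyclic
equivalence. -/
theorem cyclicEquivalent_of_cycleSupport {Γ Γ' : SerreGraph.{u, v}} [Finite Γ.V] [Finite Γ.D]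
    [Finite Γ'.V] [Finite Γ'.D] (ε : Γ.E ≃ Γ'.E)
    (h : ∀ S : Set Γ.E, (∃ c : Γ.H1 ℤ, cycleSupport c = S) ↔
      ∃ c : Γ'.H1 ℤ, cycleSupport c = ε '' S) : CyclicEquivalent Γ Γ' := by
  refine ⟨ε, fun S => ?_⟩
  rw [isCircuit_iff, isCircuit_iff, h, Set.image_nonempty]
  refine and_congr_right fun _ => and_congr_right fun _ => ⟨fun hm c hc hcS => ?_,
    fun hm c hc hcS => ?_⟩
  · have hc' : ε '' (ε ⁻¹' cycleSupport c) = cycleSupport c :=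
      Set.image_preimage_eq _ ε.surjective
    obtain ⟨z, hz⟩ := (h (ε ⁻¹' cycleSupport c)).2 ⟨c, hc'.symm⟩
    rw [← hc', ← hz] at hc hcS ⊢
    rw [hm z hc.of_image ((Set.image_subset_image_iff ε.injective).1 hcS)]
  · obtain ⟨z, hz⟩ := (h (cycleSupport c)).1 ⟨c, rfl⟩
    have := hm z (by rw [hz]; exact hc.image _) (by rw [hz]; exact Set.image_mono hcS)
    rw [hz] at this
    exact ε.injective.image_injective this

end Circuit

theorem CyclicEquivalent.symm {Γ Γ' : SerreGraph.{u, v}} (h : CyclicEquivalent Γ Γ') :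
    CyclicEquivalent Γ' Γ := by
  obtain ⟨ε, hε⟩ := h
  refine ⟨ε.symm, fun S => ?_⟩
  rw [hε, ← Set.image_comp]
  simp

theorem CyclicEquivalent.trans {Γ Γ' Γ'' : SerreGraph.{u, v}} (h : CyclicEquivalent Γ Γ')
    (h' : CyclicEquivalent Γ' Γ'') : CyclicEquivalent Γ Γ'' := by
  obtain ⟨ε, hε⟩ := h
  obtain ⟨ε', hε'⟩ := h'
  refine ⟨ε.trans ε', fun S => ?_⟩
  rw [hε, hε', ← Set.image_comp]
  rfl

theorem CyclicEquivalent.refl (Γ : SerreGraph.{u, v}) : CyclicEquivalent Γ Γ :=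
  ⟨Equiv.refl _, fun S => by simp⟩

end SerreGraph

/-! ### Cographic rings and lattice isomorphisms -/

namespace ToricFaceRing

variable {L : Type u} {H : Type v} [AddCommGroup L] [AddCommGroup H] [Module ℝ H] {ι : L →+ H}
  {k : Type w} [Field k] {F : RationalFan ι}

/-- A linear map is multiplicative if it is so on monomials. -/
theorem map_mul_of_X {B : Type*} [CommRing B] [Algebra k B] (f : ToricFaceRing k F →ₗ[k] B)
    (h : ∀ a b, f (X k F a * X k F b) = f (X k F a) * f (X k F b)) (x y : ToricFaceRing k F) :
    f (x * y) = f x * f y := by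
  have : (mulMap k F).compr₂ f = (LinearMap.mul k B).compl₁₂ f f :=
    (monomials k F).ext fun a => (monomials k F).ext fun b => h a b
  exact congrArg (fun m => m x y) this

theorem X_mul_X_of {a b : F.LatticePoint} (h : F.Together a b) :
    X k F a * X k F b = X k F (F.addPoint a b h) := by
  rw [X_mul_X, mulX_of k F h]

theorem X_mul_X_of_not {a b : F.LatticePoint} (h : ¬ F.Together a b) :
    X k F a * X k F b = 0 := by
  rw [X_mul_X, mulX_of_not k F h]

end ToricFaceRing

namespace SerreGraph

variable {Γ : SerreGraph.{u, v}}

section Together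

/-- The fan is complete, and two lattice points lie in a common cone exactly when none of their
coordinates have opposite signs. -/
theorem exists_cone_iff [Finite Γ.D] (a b : Γ.H1 ℤ) :
    (∃ σ ∈ Γ.cographicFan.cones, Γ.latticeMap a ∈ σ ∧ Γ.latticeMap b ∈ σ) ↔
      ∀ d, 0 ≤ Γ.coord ℤ d a * Γ.coord ℤ d b := by
  constructor
  · rintro ⟨_, ⟨T, φ, rfl⟩, ha, hb⟩ d
    obtain ⟨ha1, ha2⟩ := Γ.mem_cographicCone.1 ha
    obtain ⟨hb1, hb2⟩ := Γ.mem_cographicCone.1 hb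
    have hR : (0 : ℝ) ≤ (Γ.coord ℤ d a : ℝ) * Γ.coord ℤ d b := by
      by_cases hT : Γ.edge d ∈ T
      · rw [← coord_latticeMap, ha2 d hT, zero_mul]
      · have h1 := ha1 _ hT
        have h2 := hb1 _ hT
        rw [← coord_latticeMap, ← coord_latticeMap]
        rcases Γ.eq_or_eq_inv φ d with h | h
        · rw [h]; exact mul_nonneg h1 h2
        · rw [h, Γ.coord_inv, Γ.coord_inv, neg_mul_neg]; exact mul_nonneg h1 h2
    exact_mod_cast hR
  · intro h
    have hφ : ∀ e : Γ.E, ∃ d, Γ.edge d = e ∧ 0 ≤ Γ.coord ℤ d a ∧ 0 ≤ Γ.coord ℤ d b := by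
      intro e
      obtain ⟨d, rfl⟩ := edge_surjective e
      rcases mul_nonneg_iff.1 (h d) with h1 | h1
      · exact ⟨d, rfl, h1⟩
      · refine ⟨Γ.inv d, Γ.edge_inv d, ?_⟩
        rw [Γ.coord_inv, Γ.coord_inv]
        omega
    choose φ hφ ha hb using hφ
    refine ⟨_, ⟨∅, ⟨φ, hφ⟩, rfl⟩, ?_, ?_⟩
    · refine Γ.mem_cographicCone.2 ⟨fun e _ => ?_, fun _ hd => absurd hd (Set.notMem_empty _)⟩
      rw [coord_latticeMap]
      exact_mod_cast ha e
    · refine Γ.mem_cographicCone.2 ⟨fun e _ => ?_, fun _ hd => absurd hd (Set.notMem_empty _)⟩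
      rw [coord_latticeMap]
      exact_mod_cast hb e

/-- A cycle as a lattice point of the cographic fan. -/
def latticePoint [Finite Γ.D] (c : Γ.H1 ℤ) : Γ.cographicFan.LatticePoint :=
  ⟨c, by
    obtain ⟨σ, hσ, h, -⟩ := (exists_cone_iff c c).2 fun d => mul_self_nonneg _
    exact ⟨σ, hσ, h⟩⟩

theorem together_iff [Finite Γ.D] (a b : Γ.cographicFan.LatticePoint) :
    Γ.cographicFan.Together a b ↔ ∀ d, 0 ≤ Γ.coord ℤ d a.1 * Γ.coord ℤ d b.1 :=
  exists_cone_iff a.1 b.1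

open ToricFaceRing in
/-- An isomorphism of lattices of cycles that respects the relation of lying in a common cone
induces an isomorphism of cographic rings. -/
theorem nonempty_algEquiv_of_addEquiv {Γ' : SerreGraph.{u, v}} [Finite Γ.D] [Finite Γ'.D]
    (k : Type w) [Field k] (ψ : Γ.H1 ℤ ≃+ Γ'.H1 ℤ)
    (h : ∀ a b, (∀ d, 0 ≤ Γ.coord ℤ d a * Γ.coord ℤ d b) ↔
      ∀ d, 0 ≤ Γ'.coord ℤ d (ψ a) * Γ'.coord ℤ d (ψ b)) :
    Nonempty (Γ.CographicRing k ≃ₐ[k] Γ'.CographicRing k) := by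
  let p : Γ.cographicFan.LatticePoint ≃ Γ'.cographicFan.LatticePoint :=
    { toFun := fun a => latticePoint (ψ a.1)
      invFun := fun a => latticePoint (ψ.symm a.1)
      left_inv := fun a => Subtype.ext (ψ.symm_apply_apply a.1)
      right_inv := fun a => Subtype.ext (ψ.apply_symm_apply a.1) }
  let f : Γ.CographicRing k ≃ₗ[k] Γ'.CographicRing k :=
    (monomials k Γ.cographicFan).equiv (monomials k Γ'.cographicFan) p
  have hf : ∀ a, f (X k _ a) = X k _ (p a) := fun a => Module.Basis.equiv_apply ..
  have hp : ∀ a b, Γ.cographicFan.Together a b ↔ Γ'.cographicFan.Together (p a) (p b) := by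
    intro a b
    rw [together_iff, together_iff, h]
    rfl
  refine ⟨AlgEquiv.ofLinearEquiv f ?_ (map_mul_of_X f.toLinearMap fun a b => ?_)⟩
  · change f (X k _ _) = X k _ _
    rw [hf]
    exact congrArg _ (Subtype.ext (map_zero ψ))
  · change f (X k _ a * X k _ b) = f (X k _ a) * f (X k _ b)
    rw [hf, hf]
    by_cases hab : Γ.cographicFan.Together a b
    · rw [X_mul_X_of hab, X_mul_X_of ((hp a b).1 hab), hf]
      exact congrArg _ (Subtype.ext (map_add ψ _ _))
    · rw [X_mul_X_of_not hab, X_mul_X_of_not fun h => hab ((hp a b).2 h), map_zero]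

end Together

/-! ### The minimal primes of a cographic ring -/

section Primes

open SignArrangement ToricFaceRing

/-- The coordinate functionals of the edges with respect to an orientation. -/
noncomputable def edgeCoord (φ : Γ.Orientation) (e : Γ.E) : Γ.H1 ℤ →+ ℤ := (Γ.coord ℤ (φ.1 e)).toAddMonoidHom

theorem forall_mul_nonneg_iff (φ : Γ.Orientation) (a b : Γ.H1 ℤ) :
    (∀ d, 0 ≤ Γ.coord ℤ d a * Γ.coord ℤ d b) ↔ ∀ e, 0 ≤ edgeCoord φ e a * edgeCoord φ e b := by
  refine ⟨fun h e => h _, fun h d => ?_⟩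
  have h1 := h (Γ.edge d)
  rcases Γ.eq_or_eq_inv φ d with hd | hd
  · rw [hd]; exact h1
  · rw [hd, Γ.coord_inv, Γ.coord_inv, neg_mul_neg]; exact h1

/-- A closed chamber contains the sum of two points of a common cone only if it contains both. -/
theorem inCone_add_iff (φ : Γ.Orientation) (s : Γ.E → ℤˣ) {a b : Γ.H1 ℤ}
    (h : ∀ d, 0 ≤ Γ.coord ℤ d a * Γ.coord ℤ d b) :
    InCone (edgeCoord φ) s (a + b) ↔ InCone (edgeCoord φ) s a ∧ InCone (edgeCoord φ) s b := by
  rw [forall_mul_nonneg_iff φ] at h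
  unfold InCone
  rw [← forall_and]
  refine forall_congr' fun e => ?_
  rw [map_add]
  rcases mul_nonneg_iff.1 (h e) with h1 | h1 <;>
    rcases Int.units_eq_one_or (s e) with h2 | h2 <;> simp only [h2, Units.val_neg, Units.val_one] <;>
    omega

theorem mul_nonneg_of_inCone (φ : Γ.Orientation) {s : Γ.E → ℤˣ} {a b : Γ.H1 ℤ}
    (ha : InCone (edgeCoord φ) s a) (hb : InCone (edgeCoord φ) s b) :
    ∀ d, 0 ≤ Γ.coord ℤ d a * Γ.coord ℤ d b := by
  rw [forall_mul_nonneg_iff φ]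
  intro e
  have h1 := mul_nonneg (ha e) (hb e)
  rwa [mul_mul_mul_comm, units_mul_self, one_mul] at h1

variable [Finite Γ.D] (k : Type w) [Field k] (φ : Γ.Orientation)

open Classical in
/-- The projection from the cographic ring to the monoid algebra of the lattice that keeps the
monomials in the closed chamber of `s` and kills the others, as a linear map. -/
noncomputable def coneLinearMap (s : Γ.E → ℤˣ) :
    Γ.CographicRing k →ₗ[k] AddMonoidAlgebra k (Γ.D →₀ ℤ) :=
  (monomials k Γ.cographicFan).constr k fun c =>
    if InCone (edgeCoord φ) s c.1 then AddMonoidAlgebra.single (Γ.chainCoords ℤ c.1.1) 1 else 0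

open Classical in
theorem coneLinearMap_X (s : Γ.E → ℤˣ) (c : Γ.cographicFan.LatticePoint) :
    coneLinearMap k φ s (X k _ c) = if InCone (edgeCoord φ) s c.1 then
      AddMonoidAlgebra.single (Γ.chainCoords ℤ c.1.1) 1 else 0 :=
  Module.Basis.constr_basis ..

/-- The projection from the cographic ring to the monoid algebra of the lattice that keeps the
monomials in the closed chamber of `s` and kills the others. -/
noncomputable def coneHom (s : Γ.E → ℤˣ) : Γ.CographicRing k →ₐ[k] AddMonoidAlgebra k (Γ.D →₀ ℤ) :=
  AlgHom.ofLinearMap (coneLinearMap k φ s)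
    (by
      change coneLinearMap k φ s (X k _ _) = 1
      have h0 : InCone (edgeCoord φ) s (0 : Γ.H1 ℤ) := fun e => by rw [map_zero, mul_zero]
      rw [coneLinearMap_X, AddMonoidAlgebra.one_def]
      exact if_pos h0)
    (map_mul_of_X _ fun a b => by
      rw [coneLinearMap_X, coneLinearMap_X]
      by_cases hab : Γ.cographicFan.Together a b
      · have h1 := inCone_add_iff φ s ((together_iff a b).1 hab)
        have h2 : InCone (edgeCoord φ) s (Γ.cographicFan.addPoint a b hab).1 ↔ _ := h1
        rw [X_mul_X_of hab, coneLinearMap_X]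
        by_cases ha : InCone (edgeCoord φ) s a.1
        · by_cases hb : InCone (edgeCoord φ) s b.1
          · rw [if_pos ha, if_pos hb, if_pos (h2.2 ⟨ha, hb⟩), AddMonoidAlgebra.single_mul_single,
              one_mul]
            rfl
          · rw [if_neg hb, if_neg fun h => hb (h2.1 h).2, mul_zero]
        · rw [if_neg ha, if_neg fun h => ha (h2.1 h).1, zero_mul]
      · rw [X_mul_X_of_not hab, map_zero]
        by_cases ha : InCone (edgeCoord φ) s a.1
        · by_cases hb : InCone (edgeCoord φ) s b.1
          · exact absurd ((together_iff a b).2 (mul_nonneg_of_inCone φ ha hb)) hab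
          · rw [if_neg hb, mul_zero]
        · rw [if_neg ha, zero_mul])

theorem coneHom_apply (s : Γ.E → ℤˣ) (x : Γ.CographicRing k) :
    coneHom k φ s x = coneLinearMap k φ s x := rfl

/-- The ideal spanned by the monomials outside the closed chamber of `s`. -/
noncomputable def coneIdeal (s : Γ.E → ℤˣ) : Ideal (Γ.CographicRing k) := RingHom.ker (coneHom k φ s)

theorem coneIdeal_isPrime (s : Γ.E → ℤˣ) : (coneIdeal k φ s).IsPrime := by
  have : IsDomain (AddMonoidAlgebra k (Γ.D →₀ ℤ)) := NoZeroDivisors.to_isDomain _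
  exact RingHom.ker_isPrime _

/-- The ideal of a chamber consists of the elements without monomials in the chamber. -/
theorem mem_coneIdeal_iff (s : Γ.E → ℤˣ) (x : Γ.CographicRing k) : x ∈ coneIdeal k φ s ↔
    ∀ c : Γ.cographicFan.LatticePoint, InCone (edgeCoord φ) s c.1 →
      (monomials k Γ.cographicFan).coord c x = 0 := by
  classical
  unfold coneIdeal
  rw [RingHom.mem_ker, coneHom_apply]
  constructor
  · intro h c hc
    let ev : AddMonoidAlgebra k (Γ.D →₀ ℤ) →ₗ[k] k :=
      (Finsupp.lapply (Γ.chainCoords ℤ c.1.1)).comp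
        (AddMonoidAlgebra.coeffLinearEquiv k).toLinearMap
    have hev : ev.comp (coneLinearMap k φ s) = (monomials k Γ.cographicFan).coord c := by
      refine (monomials k Γ.cographicFan).ext fun b => ?_
      change ev (coneLinearMap k φ s (X k _ b)) = _
      rw [coneLinearMap_X, Module.Basis.coord_apply, Module.Basis.repr_self,
        Finsupp.single_apply]
      by_cases hb : InCone (edgeCoord φ) s b.1
      · rw [if_pos hb]
        change (Finsupp.single (Γ.chainCoords ℤ b.1.1) (1 : k)) (Γ.chainCoords ℤ c.1.1) = _
        rw [Finsupp.single_apply]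
        refine if_congr ⟨fun h => ?_, fun h => by rw [h]⟩ rfl rfl
        exact Subtype.ext (Γ.H1_ext ℤ fun d => DFunLike.congr_fun h d)
      · rw [if_neg hb, map_zero, if_neg]
        rintro rfl
        exact hb hc
    rw [← hev, LinearMap.comp_apply, h, map_zero]
  · intro h
    rw [coneLinearMap, Module.Basis.constr_apply]
    refine Finset.sum_eq_zero fun c _ => ?_
    by_cases hc : InCone (edgeCoord φ) s c.1
    · have h1 := h c hc
      rw [Module.Basis.coord_apply] at h1
      simp only [h1, zero_smul]
    · simp only [if_neg hc, smul_zero]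

theorem X_mem_coneIdeal_iff (s : Γ.E → ℤˣ) (c : Γ.cographicFan.LatticePoint) :
    X k _ c ∈ coneIdeal k φ s ↔ ¬ InCone (edgeCoord φ) s c.1 := by
  classical
  unfold coneIdeal
  rw [RingHom.mem_ker, coneHom_apply, coneLinearMap_X]
  by_cases hc : InCone (edgeCoord φ) s c.1
  · rw [if_pos hc]
    simp [hc]
  · simp [hc]

/-- The sums of ideals of chambers know the inclusions between intersections of chambers. -/
theorem coneIdeal_le_iSup_iff (T : Set (Tope (edgeCoord φ))) (r : Tope (edgeCoord φ)) :
    coneIdeal k φ r.1 ≤ ⨆ s : T, coneIdeal k φ s.1.1 ↔ Closes (edgeCoord φ) T r := by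
  constructor
  · intro h a ha
    by_contra har
    have h1 := h ((X_mem_coneIdeal_iff k φ r.1 (latticePoint a)).2 har)
    have h2 : (monomials k Γ.cographicFan).coord (latticePoint a) (X k _ (latticePoint a)) = 0 := by
      refine Submodule.iSup_induction (fun s : T => coneIdeal k φ s.1.1)
        (motive := fun x => (monomials k Γ.cographicFan).coord (latticePoint a) x = 0) h1
        (fun s x hx => ?_) (map_zero _) fun x y hx hy => by rw [map_add, hx, hy, add_zero]
      exact (mem_coneIdeal_iff k φ _ _).1 hx (latticePoint a) (ha s.1 s.2)
    unfold X at h2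
    rw [Module.Basis.coord_apply, Module.Basis.repr_self, Finsupp.single_eq_same] at h2
    exact one_ne_zero h2
  · intro h x hx
    rw [← (monomials k Γ.cographicFan).linearCombination_repr x, Finsupp.linearCombination_apply]
    refine sum_mem fun c _ => ?_
    change (monomials k Γ.cographicFan).coord c x • X k _ c ∈ _
    by_cases hc : InCone (edgeCoord φ) r.1 c.1
    · rw [(mem_coneIdeal_iff k φ _ _).1 hx c hc, zero_smul]
      exact zero_mem _
    · have h1 : ∃ s ∈ T, ¬ InCone (edgeCoord φ) s.1 c.1 := by
        by_contra! h2
        exact hc (h c.1 h2)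
      obtain ⟨s, hs, hsc⟩ := h1
      refine Submodule.smul_of_tower_mem _ _ ?_
      exact (le_iSup (fun s : T => coneIdeal k φ s.1.1) ⟨s, hs⟩)
        ((X_mem_coneIdeal_iff k φ s.1 c).2 hsc)

/-- There are no inclusions between the ideals of different chambers: a chamber containing an
interior point of another one coincides with it. -/
theorem coneIdeal_le_iff (s r : Tope (edgeCoord φ)) :
    coneIdeal k φ s.1 ≤ coneIdeal k φ r.1 ↔ s = r := by
  refine ⟨fun h => ?_, fun h => by rw [h]⟩
  obtain ⟨c, hc⟩ := r.2
  have h1 : InCone (edgeCoord φ) s.1 c := by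
    by_contra h2
    exact (X_mem_coneIdeal_iff k φ r.1 (latticePoint c)).1
      (h ((X_mem_coneIdeal_iff k φ s.1 (latticePoint c)).2 h2)) fun e => (hc e).le
  refine Subtype.ext (funext fun e => ?_)
  by_contra hne
  have h3 := h1 e
  have h4 := hc e
  rw [eq_neg_of_ne hne, Units.val_neg] at h4
  linarith

/-- Every prime ideal contains the ideal of a chamber. -/
theorem exists_coneIdeal_le (hsimple : IsSimple (edgeCoord φ)) (P : Ideal (Γ.CographicRing k))
    (hP : P.IsPrime) : ∃ s : Tope (edgeCoord φ), coneIdeal k φ s.1 ≤ P := by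
  have := Fintype.ofFinite (Tope (edgeCoord φ))
  have h : Finset.univ.inf (fun s : Tope (edgeCoord φ) => coneIdeal k φ s.1) ≤ P := by
    intro x hx
    have hx' : ∀ s : Tope (edgeCoord φ), x ∈ coneIdeal k φ s.1 := fun s =>
      Finset.inf_le (f := fun s : Tope (edgeCoord φ) => coneIdeal k φ s.1) (Finset.mem_univ s) hx
    have hx0 : x = 0 := by
      refine (monomials k Γ.cographicFan).ext_elem fun c => ?_
      obtain ⟨d, hd⟩ := exists_generic hsimple
      obtain ⟨s, hs, -⟩ := exists_tope_near hd c.1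
      rw [map_zero]
      exact (mem_coneIdeal_iff k φ s.1 x).1 (hx' s) c hs
    rw [hx0]
    exact zero_mem P
  obtain ⟨s, -, hs⟩ := (Ideal.IsPrime.inf_le' hP).1 h
  exact ⟨s, hs⟩

/-- An isomorphism of cographic rings matches the chambers, compatibly with the inclusions between
their intersections. -/
theorem exists_tope_equiv {Γ' : SerreGraph.{u, v}} [Finite Γ'.D] (φ' : Γ'.Orientation)
    (h : IsSimple (edgeCoord φ)) (h' : IsSimple (edgeCoord φ'))
    (Φ : Γ.CographicRing k ≃+* Γ'.CographicRing k) :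
    ∃ b : Tope (edgeCoord φ) ≃ Tope (edgeCoord φ'), PreservesCloses b := by
  have step : ∀ {Δ Δ' : SerreGraph.{u, v}} [Finite Δ.D] [Finite Δ'.D] (α : Δ.Orientation)
      (α' : Δ'.Orientation), IsSimple (edgeCoord α) → IsSimple (edgeCoord α') →
      ∀ Ψ : Δ.CographicRing k ≃+* Δ'.CographicRing k, ∀ s : Tope (edgeCoord α),
      ∃ s' : Tope (edgeCoord α'),
        coneIdeal k α' s'.1 = (coneIdeal k α s.1).comap Ψ.symm.toRingHom := by
    intro Δ Δ' _ _ α α' hα hα' Ψ s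
    have := coneIdeal_isPrime k α s.1
    obtain ⟨s', hs'⟩ := exists_coneIdeal_le k α' hα'
      ((coneIdeal k α s.1).comap Ψ.symm.toRingHom) inferInstance
    have := coneIdeal_isPrime k α' s'.1
    obtain ⟨r, hr⟩ := exists_coneIdeal_le k α hα
      ((coneIdeal k α' s'.1).comap Ψ.toRingHom) inferInstance
    have hrs : r = s := by
      refine (coneIdeal_le_iff k α r s).1 fun x hx => ?_
      have h1 : Ψ x ∈ coneIdeal k α' s'.1 := hr hx
      have h2 : Ψ.symm (Ψ x) ∈ coneIdeal k α s.1 := hs' h1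
      rwa [Ψ.symm_apply_apply] at h2
    refine ⟨s', le_antisymm hs' fun y hy => ?_⟩
    have h1 : Ψ.symm y ∈ coneIdeal k α s.1 := hy
    rw [← hrs] at h1
    have h2 : Ψ (Ψ.symm y) ∈ coneIdeal k α' s'.1 := hr h1
    rwa [Ψ.apply_symm_apply] at h2
  -- the ideals of the chambers are the minimal primes, so an isomorphism permutes them
  choose b hb using step φ φ' h h' Φ
  choose c hc using step φ' φ h' h Φ.symm
  have hcb : ∀ s, c (b s) = s := by
    intro s
    rw [← coneIdeal_le_iff k φ, hc, hb]
    intro x hx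
    have h1 : Φ.symm (Φ x) ∈ coneIdeal k φ s.1 := hx
    rwa [Φ.symm_apply_apply] at h1
  have hbc : ∀ s, b (c s) = s := by
    intro s
    rw [← coneIdeal_le_iff k φ', hb, hc]
    intro x hx
    have h1 : Φ (Φ.symm x) ∈ coneIdeal k φ' s.1 := hx
    rwa [Φ.apply_symm_apply] at h1
  let β : Tope (edgeCoord φ) ≃ Tope (edgeCoord φ') := ⟨b, c, hcb, hbc⟩
  refine ⟨β, fun T r => ?_⟩
  rw [← coneIdeal_le_iSup_iff k, ← coneIdeal_le_iSup_iff k]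
  have ho : ∀ s, coneIdeal k φ' (β s).1 = Φ.symm.idealComapOrderIso (coneIdeal k φ s.1) := hb
  have hsup : (⨆ s : (β '' T : Set _), coneIdeal k φ' s.1.1) =
      Φ.symm.idealComapOrderIso (⨆ s : T, coneIdeal k φ s.1.1) := by
    rw [OrderIso.map_iSup]
    exact (Equiv.iSup_congr (β.image T) fun s => ho s.1).symm
  change _ ↔ coneIdeal k φ' (β r).1 ≤ ⨆ s : (β '' T : Set _), coneIdeal k φ' s.1.1
  rw [hsup, ho, OrderIso.le_iff_le]

end Primes

end SerreGraph

/-! ### Uniqueness of signs -/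

namespace SignUniqueness

variable {B E : Type*}

/-- Every set of rows has a signed sum with all entries in `{-1, 0, 1}`. -/
def IsBalanced (A : B → E → ℤ) : Prop :=
  ∀ R : Finset B, ∃ w : B → ℤ, (∀ b ∈ R, w b = 1 ∨ w b = -1) ∧ ∀ e, |∑ b ∈ R, w b * A b e| ≤ 1

/-- Two columns have a nonzero entry in a common row of `R`. -/
def ShareRow (A : B → E → ℤ) (R : Finset B) (e f : E) : Prop := ∃ b ∈ R, A b e ≠ 0 ∧ A b f ≠ 0

/-- `v 0, …, v n` is a chain of columns, consecutive ones sharing a row. -/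
def IsColumnChain (A : B → E → ℤ) (R : Finset B) (n : ℕ) (v : ℕ → E) : Prop :=
  ∀ i < n, ShareRow A R (v i) (v (i + 1))

theorem exists_columnChain {A : B → E → ℤ} {R : Finset B} {e f : E}
    (h : Quot.mk (ShareRow A R) e = Quot.mk (ShareRow A R) f) :
    ∃ n v, v 0 = e ∧ v n = f ∧ IsColumnChain A R n v := by
  have : Std.Symm (ShareRow A R) := ⟨fun e f ⟨b, hb, h1, h2⟩ => ⟨b, hb, h2, h1⟩⟩
  have h' : Relation.ReflTransGen (ShareRow A R) e f := by
    have h' := Quot.eqvGen_exact h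
    clear h
    induction h' with
    | rel _ _ h => exact .single h
    | refl _ => exact .refl
    | symm _ _ _ ih => exact Relation.ReflTransGen.stdSymm.symm _ _ ih
    | trans _ _ _ _ _ ih1 ih2 => exact ih1.trans ih2
  clear h
  induction h' with
  | refl => exact ⟨0, fun _ => e, rfl, rfl, fun i hi => absurd hi (Nat.not_lt_zero i)⟩
  | @tail f g _ hfg ih =>
    obtain ⟨n, v, h0, hn, hv⟩ := ih
    refine ⟨n + 1, fun i => if i ≤ n then v i else g, by simpa using h0, by simp, fun i hi => ?_⟩
    by_cases h : i + 1 ≤ n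
    · simp only [if_pos h, if_pos (by omega : i ≤ n)]
      exact hv i (by omega)
    · have : i = n := by omega
      subst this
      simp only [if_neg h, le_refl, if_true, hn]
      exact hfg

/-- Two entries equal to one up to sign whose sum is at most one in absolute value cancel. -/
theorem eq_neg_of_abs_add_le {x y : ℤ} (hx : x = 1 ∨ x = -1) (hy : y = 1 ∨ y = -1)
    (h : |x + y| ≤ 1) : x = -y := by
  rw [abs_le] at h
  omega

theorem mul_eq_one_or {x y : ℤ} (hx : x = 1 ∨ x = -1) (hy : y = 1 ∨ y = -1) :
    x * y = 1 ∨ x * y = -1 := by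
  rcases hx with rfl | rfl <;> rcases hy with rfl | rfl <;> simp

section Chordless

variable [DecidableEq B] {M : B → E → ℤ} {n : ℕ} {v : ℕ → E} {b : ℕ → B} {r : B}

/-- Along a chordless cycle of rows `r, b 0, …, b n` and columns `v 0, …, v (n + 1)`, in which
consecutive members have a nonzero common entry, the signs of the entries of a balanced matrix are
related by signs of the rows. -/
theorem exists_signs_of_chordless (hM : IsBalanced M)
    (hent : ∀ b e, M b e ≠ 0 → M b e = 1 ∨ M b e = -1) (hr : ∀ i ≤ n, r ≠ b i)
    (hb : ∀ i ≤ n, ∀ j ≤ n + 1, M (b i) (v j) ≠ 0 ↔ j = i ∨ j = i + 1)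
    (hrv : ∀ j ≤ n + 1, M r (v j) ≠ 0 ↔ j = 0 ∨ j = n + 1) :
    ∃ (t : ℤ) (w : ℕ → ℤ), (t = 1 ∨ t = -1) ∧ (∀ i ≤ n, w i = 1 ∨ w i = -1) ∧
      t * M r (v 0) = -(w 0 * M (b 0) (v 0)) ∧
      t * M r (v (n + 1)) = -(w n * M (b n) (v (n + 1))) ∧
      ∀ j < n, w j * M (b j) (v (j + 1)) = -(w (j + 1) * M (b (j + 1)) (v (j + 1))) := by
  have hinj : Set.InjOn b (Finset.range (n + 1)) := by
    intro i hi j hj hij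
    simp only [Finset.coe_range, Set.mem_Iio] at hi hj
    have h1 := (hb i (by omega) (j + 1) (by omega)).1
      (by rw [hij]; exact (hb j (by omega) (j + 1) (by omega)).2 (Or.inr rfl))
    have h2 := (hb j (by omega) (i + 1) (by omega)).1
      (by rw [← hij]; exact (hb i (by omega) (i + 1) (by omega)).2 (Or.inr rfl))
    omega
  obtain ⟨w, hw, hsum⟩ := hM (insert r ((Finset.range (n + 1)).image b))
  have hrmem : r ∉ (Finset.range (n + 1)).image b := by
    simp only [Finset.mem_image, Finset.mem_range, not_exists, not_and]
    exact fun i hi h => hr i (by omega) h.symm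
  have hwb : ∀ i ≤ n, w (b i) = 1 ∨ w (b i) = -1 := fun i hi => hw _ (Finset.mem_insert_of_mem
    (Finset.mem_image_of_mem b (Finset.mem_range.2 (by omega))))
  have hwr := hw r (Finset.mem_insert_self ..)
  have hsum' : ∀ e, |w r * M r e + ∑ i ∈ Finset.range (n + 1), w (b i) * M (b i) e| ≤ 1 := by
    intro e
    have := hsum e
    rwa [Finset.sum_insert hrmem, Finset.sum_image hinj] at this
  have hzero : ∀ i ≤ n, ∀ j ≤ n + 1, ¬ (j = i ∨ j = i + 1) → M (b i) (v j) = 0 :=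
    fun i hi j hj h => not_not.1 fun h' => h ((hb i hi j hj).1 h')
  refine ⟨w r, fun i => w (b i), hwr, hwb, ?_, ?_, fun j hj => ?_⟩
  · have h1 := hsum' (v 0)
    rw [Finset.sum_eq_single 0 (fun i hi h0 => by
      rw [hzero i (by have := Finset.mem_range.1 hi; omega) 0 (by omega) (by omega), mul_zero])
      (fun h => absurd (Finset.mem_range.2 (by omega)) h)] at h1
    exact eq_neg_of_abs_add_le
      (mul_eq_one_or hwr (hent _ _ ((hrv 0 (by omega)).2 (Or.inl rfl))))
      (mul_eq_one_or (hwb 0 (by omega)) (hent _ _ ((hb 0 (by omega) 0 (by omega)).2 (Or.inl rfl))))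
      h1
  · have h1 := hsum' (v (n + 1))
    rw [Finset.sum_eq_single n (fun i (hi : i ∈ Finset.range (n + 1)) (h0 : i ≠ n) => by
      have := Finset.mem_range.1 hi
      rw [hzero i (by omega) (n + 1) (by omega) (by omega), mul_zero])
      (fun h => absurd (Finset.mem_range.2 (by omega)) h)] at h1
    exact eq_neg_of_abs_add_le
      (mul_eq_one_or hwr (hent _ _ ((hrv (n + 1) (by omega)).2 (Or.inr rfl))))
      (mul_eq_one_or (hwb n (by omega))
        (hent _ _ ((hb n (by omega) (n + 1) (by omega)).2 (Or.inr rfl)))) h1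
  · have h1 := hsum' (v (j + 1))
    have h2 : M r (v (j + 1)) = 0 := not_not.1 fun h => by
      have := (hrv (j + 1) (by omega)).1 h
      omega
    have h3 : ∑ i ∈ Finset.range (n + 1), w (b i) * M (b i) (v (j + 1)) =
        ∑ i ∈ {j, j + 1}, w (b i) * M (b i) (v (j + 1)) := by
      refine (Finset.sum_subset ?_ fun i hi hi' => ?_).symm
      · intro i hi
        simp only [Finset.mem_insert, Finset.mem_singleton] at hi
        exact Finset.mem_range.2 (by omega)
      · simp only [Finset.mem_insert, Finset.mem_singleton, not_or] at hi'
        rw [hzero i (by have := Finset.mem_range.1 hi; omega) (j + 1) (by omega) (by omega),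
          mul_zero]
    rw [h2, mul_zero, zero_add, h3, Finset.sum_pair (by omega)] at h1
    exact eq_neg_of_abs_add_le
      (mul_eq_one_or (hwb j (by omega))
        (hent _ _ ((hb j (by omega) (j + 1) (by omega)).2 (Or.inr rfl))))
      (mul_eq_one_or (hwb (j + 1) (by omega))
        (hent _ _ ((hb (j + 1) (by omega) (j + 1) (by omega)).2 (Or.inl rfl)))) h1

end Chordless

section Extend

variable [DecidableEq B] {A A' : B → E → ℤ} {R : Finset B} {r : B} {κ : E → ℤˣ} {ρ : B → ℤˣ}

/-- If two balanced matrices with the same zero entries agree in the rows of `R` up to signs of rows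
and columns, then two columns connected through rows of `R` have the same relative sign in any
further row. -/
theorem relative_sign_eq (hA : IsBalanced A) (hA' : IsBalanced A')
    (hent : ∀ b e, A b e ≠ 0 → A b e = 1 ∨ A b e = -1)
    (hent' : ∀ b e, A' b e ≠ 0 → A' b e = 1 ∨ A' b e = -1)
    (hsupp : ∀ b e, A b e = 0 ↔ A' b e = 0) (hr : r ∉ R)
    (hκ : ∀ b ∈ R, ∀ e, A' b e = ρ b * κ e * A b e) {e f : E} (he : A r e ≠ 0) (hf : A r f ≠ 0)
    (hef : Quot.mk (ShareRow A R) e = Quot.mk (ShareRow A R) f) :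
    A r e * A' r e * κ e = A r f * A' r f * κ f := by
  classical
  by_contra hcon
  set a : E → ℤ := fun e => A r e * A' r e * κ e with ha
  -- a shortest chain between two columns with different relative signs is chordless
  have hex : ∃ n v, IsColumnChain A R n v ∧ A r (v 0) ≠ 0 ∧ A r (v n) ≠ 0 ∧ a (v 0) ≠ a (v n) := by
    obtain ⟨n, v, rfl, rfl, hv⟩ := exists_columnChain hef
    exact ⟨n, v, hv, he, hf, hcon⟩
  obtain ⟨v, hv, hv0, hvn, hne⟩ := Nat.find_spec hex
  have hmin : ∀ m < Nat.find hex, ∀ v, IsColumnChain A R m v → A r (v 0) ≠ 0 → A r (v m) ≠ 0 →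
      a (v 0) = a (v m) := fun m hm v h1 h2 h3 =>
    not_not.1 fun h4 => Nat.find_min hex hm ⟨v, h1, h2, h3, h4⟩
  generalize Nat.find hex = N at *
  obtain _ | n := N
  · exact hne rfl
  have hshort : ∀ i j, i + 1 < j → j ≤ n + 1 → ¬ ShareRow A R (v i) (v j) := by
    intro i j hij hj hshare
    have h1 := hmin (n + 1 - (j - i - 1)) (by omega)
      (fun k => if k ≤ i then v k else v (k + (j - i - 1))) (fun k hk => by
        by_cases h2 : k + 1 ≤ i
        · simp only [if_pos h2, if_pos (by omega : k ≤ i)]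
          exact hv k (by omega)
        · by_cases h3 : k ≤ i
          · have : k = i := by omega
            subst this
            simp only [if_neg h2, le_refl, if_true]
            rw [show k + 1 + (j - k - 1) = j by omega]
            exact hshare
          · simp only [if_neg h2, if_neg h3]
            rw [show k + 1 + (j - i - 1) = k + (j - i - 1) + 1 by omega]
            exact hv _ (by omega))
      (by simpa using hv0)
      (by
        simp only [if_neg (by omega : ¬ n + 1 - (j - i - 1) ≤ i)]
        rw [show n + 1 - (j - i - 1) + (j - i - 1) = n + 1 by omega]
        exact hvn)
    simp only [if_neg (by omega : ¬ n + 1 - (j - i - 1) ≤ i), Nat.zero_le, if_true] at h1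
    rw [show n + 1 - (j - i - 1) + (j - i - 1) = n + 1 by omega] at h1
    exact hne h1
  have hrv : ∀ j ≤ n + 1, A r (v j) ≠ 0 ↔ j = 0 ∨ j = n + 1 := by
    intro j hj
    refine ⟨fun h => ?_, ?_⟩
    · by_contra hj'
      have h1 := hmin j (by omega) v (fun i hi => hv i (by omega)) hv0 h
      have h2 := hmin (n + 1 - j) (by omega) (fun i => v (j + i)) (fun i hi => hv (j + i) (by omega))
        h (by rw [show j + (n + 1 - j) = n + 1 by omega]; exact hvn)
      rw [show j + (n + 1 - j) = n + 1 by omega] at h2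
      exact hne (h1.trans h2)
    · rintro (rfl | rfl)
      · exact hv0
      · exact hvn
  have hrow : ∀ i, ∃ b, i < n + 1 → b ∈ R ∧ A b (v i) ≠ 0 ∧ A b (v (i + 1)) ≠ 0 := by
    intro i
    by_cases hi : i < n + 1
    · obtain ⟨b, h⟩ := hv i hi
      exact ⟨b, fun _ => h⟩
    · exact ⟨r, fun h => absurd h hi⟩
  choose b hb using hrow
  have hbv : ∀ i ≤ n, ∀ j ≤ n + 1, A (b i) (v j) ≠ 0 ↔ j = i ∨ j = i + 1 := by
    intro i hi j hj
    obtain ⟨h1, h2, h3⟩ := hb i (by omega)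
    refine ⟨fun h => ?_, ?_⟩
    · by_contra hj'
      rcases Nat.lt_or_ge j i with h4 | h4
      · exact hshort j (i + 1) (by omega) (by omega) ⟨b i, h1, h, h3⟩
      · exact hshort i j (by omega) hj ⟨b i, h1, h2, h⟩
    · rintro (rfl | rfl)
      · exact h2
      · exact h3
  have hrb : ∀ i ≤ n, r ≠ b i := fun i hi h => hr (h ▸ (hb i (by omega)).1)
  obtain ⟨t, w, ht, hw, h0, h1, h2⟩ := exists_signs_of_chordless hA hent hrb hbv hrv
  obtain ⟨t', w', ht', hw', h0', h1', h2'⟩ := exists_signs_of_chordless hA' hent' hrb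
    (fun i hi j hj => by rw [Ne, ← hsupp]; exact hbv i hi j hj)
    (fun j hj => by rw [Ne, ← hsupp]; exact hrv j hj)
  have hsq : ∀ i ≤ n, ∀ j ≤ n + 1, A (b i) (v j) ≠ 0 →
      A (b i) (v j) * A' (b i) (v j) = ρ (b i) * κ (v j) := by
    intro i hi j hj h
    rw [hκ _ (hb i (by omega)).1]
    rcases hent _ _ h with h | h <;> rw [h] <;> ring
  have hκ2 : ∀ e, (κ e : ℤ) * κ e = 1 := fun e => SignArrangement.units_mul_self _
  -- the relative sign of the rows is constant along the chain
  have hconst : ∀ j ≤ n, w j * w' j * ρ (b j) = w 0 * w' 0 * ρ (b 0) := by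
    intro j
    induction j with
    | zero => exact fun _ => rfl
    | succ j ih =>
      intro hj
      rw [← ih (by omega)]
      have e1 := hsq j (by omega) (j + 1) (by omega)
        ((hbv j (by omega) (j + 1) (by omega)).2 (Or.inr rfl))
      have e2 := hsq (j + 1) (by omega) (j + 1) (by omega)
        ((hbv (j + 1) (by omega) (j + 1) (by omega)).2 (Or.inl rfl))
      have e3 := congrArg₂ (· * ·) (h2 j (by omega)) (h2' j (by omega))
      have e4 : w j * w' j * ρ (b j) * κ (v (j + 1)) =
          w (j + 1) * w' (j + 1) * ρ (b (j + 1)) * κ (v (j + 1)) := by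
        linear_combination e3 - w j * w' j * e1 + w (j + 1) * w' (j + 1) * e2
      linear_combination (-(κ (v (j + 1)) : ℤ)) * e4 +
        (w j * w' j * ρ (b j) - w (j + 1) * w' (j + 1) * ρ (b (j + 1))) * hκ2 (v (j + 1))
  have e0 : t * t' * a (v 0) = w 0 * w' 0 * ρ (b 0) := by
    have e1 := hsq 0 (by omega) 0 (by omega) ((hbv 0 (by omega) 0 (by omega)).2 (Or.inl rfl))
    have e3 := congrArg₂ (· * ·) h0 h0'
    simp only [ha]
    linear_combination (κ (v 0) : ℤ) * e3 + w 0 * w' 0 * κ (v 0) * e1 +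
      w 0 * w' 0 * ρ (b 0) * hκ2 (v 0)
  have e1 : t * t' * a (v (n + 1)) = w n * w' n * ρ (b n) := by
    have e1 := hsq n le_rfl (n + 1) le_rfl ((hbv n le_rfl (n + 1) le_rfl).2 (Or.inr rfl))
    have e3 := congrArg₂ (· * ·) h1 h1'
    simp only [ha]
    linear_combination (κ (v (n + 1)) : ℤ) * e3 + w n * w' n * κ (v (n + 1)) * e1 +
      w n * w' n * ρ (b n) * hκ2 (v (n + 1))
  have ht0 : t * t' ≠ 0 := by
    rcases mul_eq_one_or ht ht' with h | h <;> rw [h] <;> decide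
  exact hne (mul_left_cancel₀ ht0 (e0.trans ((hconst n le_rfl).symm.trans e1.symm)))

end Extend

/-- A balanced matrix with entries in `{-1, 0, 1}` is determined by its zero entries, up to signs of
rows and columns. -/
theorem exists_signs [Finite B] {A A' : B → E → ℤ} (hA : IsBalanced A) (hA' : IsBalanced A')
    (hent : ∀ b e, A b e ≠ 0 → A b e = 1 ∨ A b e = -1)
    (hent' : ∀ b e, A' b e ≠ 0 → A' b e = 1 ∨ A' b e = -1)
    (hsupp : ∀ b e, A b e = 0 ↔ A' b e = 0) :
    ∃ (ρ : B → ℤˣ) (κ : E → ℤˣ), ∀ b e, A' b e = ρ b * κ e * A b e := by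
  classical
  have := Fintype.ofFinite B
  suffices H : ∀ R : Finset B, ∃ (ρ : B → ℤˣ) (κ : E → ℤˣ),
      ∀ b ∈ R, ∀ e, A' b e = ρ b * κ e * A b e by
    obtain ⟨ρ, κ, h⟩ := H Finset.univ
    exact ⟨ρ, κ, fun b => h b (Finset.mem_univ b)⟩
  intro R
  induction R using Finset.induction_on with
  | empty => exact ⟨1, 1, by simp⟩
  | insert r R hr ih =>
    obtain ⟨ρ, κ, hκ⟩ := ih
    -- change the signs of the columns in each component so as to match the new row
    have hδ : ∀ q : Quot (ShareRow A R), ∃ δ : ℤˣ, ∀ e, Quot.mk _ e = q → A r e ≠ 0 →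
        A r e * A' r e * κ e = δ := by
      intro q
      by_cases hq : ∃ e, Quot.mk _ e = q ∧ A r e ≠ 0
      · obtain ⟨e, rfl, he⟩ := hq
        have he' : A' r e ≠ 0 := by rwa [Ne, ← hsupp]
        obtain ⟨δ, hδ⟩ : ∃ δ : ℤˣ, A r e * A' r e = δ := by
          rcases mul_eq_one_or (hent _ _ he) (hent' _ _ he') with h | h
          · exact ⟨1, h⟩
          · exact ⟨-1, h⟩
        refine ⟨δ * κ e, fun f hf hf' => ?_⟩
        rw [relative_sign_eq hA hA' hent hent' hsupp hr hκ hf' he hf, hδ, Units.val_mul]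
      · exact ⟨1, fun e he he' => absurd ⟨e, he, he'⟩ hq⟩
    choose δ hδ using hδ
    have hρ : ∀ b, ∃ ρ' : ℤˣ, b ∈ insert r R → ∀ e,
        A' b e = ρ' * (κ e * δ (Quot.mk _ e) : ℤˣ) * A b e := by
      intro b
      by_cases hb : b ∈ R
      · by_cases hbe : ∃ e, A b e ≠ 0
        · obtain ⟨e₀, he₀⟩ := hbe
          refine ⟨ρ b * δ (Quot.mk _ e₀), fun _ e => ?_⟩
          by_cases he : A b e = 0
          · rw [he, mul_zero, ← hsupp]; exact he
          · have h1 : Quot.mk (ShareRow A R) e = Quot.mk _ e₀ := Quot.sound ⟨b, hb, he, he₀⟩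
            rw [hκ b hb, h1]
            have h2 := SignArrangement.units_mul_self (δ (Quot.mk (ShareRow A R) e₀))
            push_cast
            linear_combination -(ρ b : ℤ) * κ e * A b e * h2
        · push Not at hbe
          exact ⟨1, fun _ e => by rw [hbe e, mul_zero, ← hsupp]; exact hbe e⟩
      · refine ⟨1, fun hb' e => ?_⟩
        obtain rfl : b = r := (Finset.mem_insert.1 hb').resolve_right hb
        by_cases he : A b e = 0
        · rw [he, mul_zero, ← hsupp]; exact he
        · have h1 := hδ _ e rfl he
          have h2 : A b e * A b e = 1 := by rcases hent _ _ he with h | h <;> rw [h] <;> rfl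
          have h3 := SignArrangement.units_mul_self (κ e)
          push_cast
          rw [← h1]
          linear_combination -A' b e * h2 - A b e * A b e * A' b e * h3
    choose ρ' hρ' using hρ
    exact ⟨ρ', fun e => κ e * δ (Quot.mk _ e), fun b hb => hρ' b hb⟩

end SignUniqueness

/-! ### Cyclic equivalences and lattices of cycles -/

namespace SerreGraph

variable {Γ : SerreGraph.{u, v}}

section Cobasis

variable {B : Type*}

/-- The edges `j b` form the complement of a maximal forest: they meet the support of every nonzero
cycle, and no proper subfamily does. -/
def IsCobasis (Γ : SerreGraph.{u, v}) (j : B → Γ.E) : Prop :=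
  (∀ c : Γ.H1 ℤ, (∀ b, j b ∉ cycleSupport c) → c = 0) ∧
    ∀ b, ∃ c : Γ.H1 ℤ, j b ∈ cycleSupport c ∧ ∀ b' ≠ b, j b' ∉ cycleSupport c

theorem cycleSupport_nonempty {c : Γ.H1 ℤ} : (cycleSupport c).Nonempty ↔ c ≠ 0 := by
  constructor
  · rintro ⟨e, d, -, hd⟩ rfl
    exact hd (map_zero _)
  · intro h
    obtain ⟨d, hd⟩ := exists_coord_ne_zero h
    exact ⟨_, d, rfl, hd⟩

theorem exists_isCircuit_subset [Finite Γ.V] [Finite Γ.D] {c : Γ.H1 ℤ}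
    (hc : (cycleSupport c).Nonempty) : ∃ S, Γ.IsCircuit S ∧ S ⊆ cycleSupport c := by
  obtain ⟨S, ⟨⟨z, rfl⟩, hz, hzc⟩, hmin⟩ := Set.Finite.exists_minimal
    (s := {S | (∃ z : Γ.H1 ℤ, cycleSupport z = S) ∧ S.Nonempty ∧ S ⊆ cycleSupport c})
    (Set.toFinite _) ⟨_, ⟨c, rfl⟩, hc, subset_rfl⟩
  refine ⟨cycleSupport z, (Γ.isCircuit_iff _).2 ⟨hz, ⟨z, rfl⟩, fun y hy hyz => ?_⟩, hzc⟩
  exact Set.Subset.antisymm hyz (hmin ⟨⟨y, rfl⟩, hy, hyz.trans hzc⟩ hyz)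

/-- Being a cobasis depends on the circuits only. -/
theorem isCobasis_iff_isCircuit [Finite Γ.V] [Finite Γ.D] (j : B → Γ.E) : IsCobasis Γ j ↔
    (∀ S, Γ.IsCircuit S → ∃ b, j b ∈ S) ∧
      ∀ b, ∃ S, Γ.IsCircuit S ∧ j b ∈ S ∧ ∀ b' ≠ b, j b' ∉ S := by
  have h1 : (∀ c : Γ.H1 ℤ, (∀ b, j b ∉ cycleSupport c) → c = 0) ↔
      ∀ S, Γ.IsCircuit S → ∃ b, j b ∈ S := by
    constructor
    · intro h S hS
      obtain ⟨hne, ⟨c, rfl⟩, -⟩ := (Γ.isCircuit_iff S).1 hS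
      by_contra! hb
      exact cycleSupport_nonempty.1 hne (h c hb)
    · intro h c hc
      by_contra h0
      obtain ⟨S, hS, hSc⟩ := exists_isCircuit_subset (cycleSupport_nonempty.2 h0)
      obtain ⟨b, hb⟩ := h S hS
      exact hc b (hSc hb)
  unfold IsCobasis
  rw [h1]
  refine and_congr_right fun hmeet => forall_congr' fun b => ⟨?_, ?_⟩
  · rintro ⟨c, hc, hc'⟩
    obtain ⟨S, hS, hSc⟩ := exists_isCircuit_subset ⟨_, hc⟩
    have hb' : ∀ b' ≠ b, j b' ∉ S := fun b' hb' h => hc' b' hb' (hSc h)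
    obtain ⟨b₀, hb₀⟩ := hmeet S hS
    obtain rfl : b₀ = b := not_not.1 fun h => hb' b₀ h hb₀
    exact ⟨S, hS, hb₀, hb'⟩
  · rintro ⟨S, hS, hb, hb'⟩
    obtain ⟨-, ⟨c, rfl⟩, -⟩ := (Γ.isCircuit_iff S).1 hS
    exact ⟨c, hb, hb'⟩

/-- A minimal set of edges meeting all supports of nonzero cycles is a cobasis. -/
theorem exists_isCobasis [Finite Γ.D] : ∃ B : Set Γ.E, IsCobasis Γ (Subtype.val : B → Γ.E) := by
  obtain ⟨B, hB, hmin⟩ := Set.Finite.exists_minimal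
    (s := {B : Set Γ.E | ∀ c : Γ.H1 ℤ, (∀ e ∈ B, e ∉ cycleSupport c) → c = 0})
    (Set.toFinite _) ⟨Set.univ, fun c hc => not_not.1 fun h => by
      obtain ⟨e, he⟩ := cycleSupport_nonempty.2 h
      exact hc e trivial he⟩
  refine ⟨B, fun c hc => hB c fun e he => hc ⟨e, he⟩, fun ⟨b, hb⟩ => ?_⟩
  have h1 : ¬ ∀ c : Γ.H1 ℤ, (∀ e ∈ B \ {b}, e ∉ cycleSupport c) → c = 0 := fun h =>
    (hmin h Set.sdiff_subset hb).2 rfl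
  push Not at h1
  obtain ⟨c, hc, hc0⟩ := h1
  refine ⟨c, ?_, fun b' hb' => hc b'.1 ⟨b'.2, fun h => hb' (Subtype.ext h)⟩⟩
  by_contra hbc
  refine hc0 (hB c fun e he => ?_)
  by_cases heb : e = b
  · rw [heb]; exact hbc
  · exact hc e ⟨he, heb⟩

theorem mem_cycleSupport_iff (φ : Γ.Orientation) (e : Γ.E) (c : Γ.H1 ℤ) :
    e ∈ cycleSupport c ↔ edgeCoord φ e c ≠ 0 := by
  conv_lhs => rw [← φ.2 e]
  exact edge_mem_cycleSupport

theorem ext_edgeCoord (φ : Γ.Orientation) {c c' : Γ.H1 ℤ}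
    (h : ∀ e, edgeCoord φ e c = edgeCoord φ e c') : c = c' := by
  refine Γ.H1_ext ℤ fun d => ?_
  have h1 : Γ.coord ℤ (φ.1 (Γ.edge d)) c = Γ.coord ℤ (φ.1 (Γ.edge d)) c' := h (Γ.edge d)
  rcases Γ.eq_or_eq_inv φ d with hd | hd
  · rw [hd, h1]
  · rw [hd, Γ.coord_inv, Γ.coord_inv, h1]

/-- The cycles `x b` are the fundamental circuits of the cobasis `j`: they form a basis of the
lattice of cycles dual to the coordinates at the edges `j b`. -/
structure IsFundamental [Fintype B] [DecidableEq B] (φ : Γ.Orientation) (j : B → Γ.E)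
    (x : B → Γ.H1 ℤ) : Prop where
  dual : ∀ b b', edgeCoord φ (j b') (x b) = if b = b' then 1 else 0
  abs_coord_le : ∀ b e, |edgeCoord φ e (x b)| ≤ 1
  expand : ∀ c, c = ∑ b, edgeCoord φ (j b) c • x b

/-- A cobasis has fundamental circuits: a cycle through `j b` and no other edge of the cobasis
contains a directed simple closed walk through `j b`. -/
theorem IsCobasis.exists_isFundamental [Finite Γ.D] [Fintype B] [DecidableEq B]
    (φ : Γ.Orientation) {j : B → Γ.E} (hj : IsCobasis Γ j) :
    ∃ x, IsFundamental φ j x := by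
  have hx : ∀ b, ∃ x : Γ.H1 ℤ, (∀ b', edgeCoord φ (j b') x = if b = b' then 1 else 0) ∧
      ∀ e, |edgeCoord φ e x| ≤ 1 := by
    intro b
    obtain ⟨c, hc, hc'⟩ := hj.2 b
    simp only [mem_cycleSupport_iff φ] at hc hc'
    obtain ⟨c, hc, hc'⟩ : ∃ c : Γ.H1 ℤ, 0 < edgeCoord φ (j b) c ∧
        ∀ b' ≠ b, edgeCoord φ (j b') c = 0 := by
      rcases lt_or_gt_of_ne hc with h | h
      · exact ⟨-c, by rw [map_neg]; omega, fun b' hb' => by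
          rw [map_neg, not_not.1 (hc' b' hb'), neg_zero]⟩
      · exact ⟨c, h, fun b' hb' => not_not.1 (hc' b' hb')⟩
    obtain ⟨x, hx1, hx2, hx3⟩ := Γ.exists_conformal c (d := φ.1 (j b)) hc
    refine ⟨x, fun b' => ?_, fun e => ?_⟩
    · split_ifs with h
      · rw [← h]; exact hx1
      · have h1 : Γ.coord ℤ (φ.1 (j b')) c = 0 := hc' b' (Ne.symm h)
        refine le_antisymm ?_ ?_
        · by_contra h2
          have := hx3 (φ.1 (j b')) (not_le.1 h2)
          omega
        · by_contra h2
          have h3 : Γ.coord ℤ (φ.1 (j b')) x < 0 := not_le.1 h2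
          have := hx3 (Γ.inv (φ.1 (j b'))) (by rw [Γ.coord_inv]; omega)
          rw [Γ.coord_inv] at this
          omega
    · have h1 := hx2 (φ.1 e)
      have h2 := hx2 (Γ.inv (φ.1 e))
      rw [Γ.coord_inv] at h2
      exact abs_le.2 ⟨by change -1 ≤ Γ.coord ℤ (φ.1 e) x; omega, h1⟩
  choose x hx1 hx2 using hx
  refine ⟨x, hx1, hx2, fun c => ?_⟩
  refine sub_eq_zero.1 (hj.1 _ fun b => ?_)
  rw [mem_cycleSupport_iff φ, not_not, map_sub, map_sum]
  simp only [map_zsmul, hx1, smul_eq_mul, mul_ite, mul_one, mul_zero, Finset.sum_ite_eq',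
    Finset.mem_univ, if_true, sub_self]

namespace IsFundamental

variable [Fintype B] [DecidableEq B] {φ : Γ.Orientation} {j : B → Γ.E} {x : B → Γ.H1 ℤ}

theorem eq_one_or (hx : IsFundamental φ j x) {b : B} {e : Γ.E} (h : edgeCoord φ e (x b) ≠ 0) :
    edgeCoord φ e (x b) = 1 ∨ edgeCoord φ e (x b) = -1 := by
  have := abs_le.1 (hx.abs_coord_le b e)
  omega

theorem eq_smul (hx : IsFundamental φ j x) {c : Γ.H1 ℤ} {b : B}
    (hc : ∀ b' ≠ b, edgeCoord φ (j b') c = 0) : c = edgeCoord φ (j b) c • x b := by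
  conv_lhs => rw [hx.expand c]
  exact Finset.sum_eq_single b (fun b' _ h => by rw [hc b' h, zero_smul])
    fun h => absurd (Finset.mem_univ b) h

theorem cycleSupport_eq (hx : IsFundamental φ j x) {c : Γ.H1 ℤ} {b : B}
    (hc : ∀ b' ≠ b, j b' ∉ cycleSupport c) (hne : (cycleSupport c).Nonempty) :
    cycleSupport c = cycleSupport (x b) := by
  have h1 := hx.eq_smul (c := c) (b := b) fun b' hb' =>
    not_not.1 fun h => hc b' hb' ((mem_cycleSupport_iff φ _ _).2 h)
  have h2 : edgeCoord φ (j b) c ≠ 0 := by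
    intro h
    rw [h, zero_smul] at h1
    exact cycleSupport_nonempty.1 hne h1
  ext e
  rw [mem_cycleSupport_iff φ, mem_cycleSupport_iff φ, h1, map_zsmul, smul_eq_mul, mul_ne_zero_iff]
  exact and_iff_right h2

theorem notMem_cycleSupport (hx : IsFundamental φ j x) {b b' : B} (h : b' ≠ b) :
    j b' ∉ cycleSupport (x b) := by
  rw [mem_cycleSupport_iff φ, not_not, hx.dual, if_neg (Ne.symm h)]

theorem isCircuit [Finite Γ.V] [Finite Γ.D] (hx : IsFundamental φ j x) (b : B) :
    Γ.IsCircuit (cycleSupport (x b)) := by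
  refine (Γ.isCircuit_iff _).2 ⟨⟨j b, ?_⟩, ⟨x b, rfl⟩, fun c hc hcx => ?_⟩
  · rw [mem_cycleSupport_iff φ, hx.dual, if_pos rfl]
    exact one_ne_zero
  · exact hx.cycleSupport_eq (fun b' hb' h => hx.notMem_cycleSupport hb' (hcx h)) hc

/-- Reducing a sum of fundamental circuits modulo two keeps exactly these circuits, up to sign. -/
theorem isBalanced [Finite Γ.D] (hx : IsFundamental φ j x) {F : Type*} (i : F → Γ.E) :
    SignUniqueness.IsBalanced fun b e => edgeCoord φ (i e) (x b) := by
  intro R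
  obtain ⟨z, hz⟩ := Γ.exists_small_congruent (∑ b ∈ R, x b)
  have hz1 : ∀ e, |edgeCoord φ e z| ≤ 1 := fun e => (hz _).1
  have hz2 : ∀ b, edgeCoord φ (j b) z ≡ if b ∈ R then 1 else 0 [ZMOD 2] := by
    intro b
    have h1 : edgeCoord φ (j b) (∑ b ∈ R, x b) = if b ∈ R then 1 else 0 := by
      rw [map_sum]
      simp only [hx.dual, Finset.sum_ite_eq']
    rw [← h1]
    exact (hz _).2
  refine ⟨fun b => edgeCoord φ (j b) z, fun b hb => ?_, fun e => ?_⟩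
  · have h1 := abs_le.1 (hz1 (j b))
    have h2 := hz2 b
    rw [if_pos hb] at h2
    simp only [Int.ModEq] at h2
    change edgeCoord φ (j b) z = 1 ∨ edgeCoord φ (j b) z = -1
    omega
  · have h1 : ∑ b ∈ R, edgeCoord φ (j b) z * edgeCoord φ (i e) (x b) = edgeCoord φ (i e) z := by
      conv_rhs => rw [hx.expand z, map_sum]
      simp only [map_zsmul, smul_eq_mul]
      refine Finset.sum_subset (Finset.subset_univ R) fun b _ hb => ?_
      have h1 := abs_le.1 (hz1 (j b))
      have h2 := hz2 b
      rw [if_neg hb] at h2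
      simp only [Int.ModEq] at h2
      rw [show edgeCoord φ (j b) z = 0 by omega, zero_mul]
    rw [h1]
    exact hz1 _

end IsFundamental

end Cobasis

/-- A cyclic equivalence is induced by an isomorphism of the lattices of cycles that changes the
coordinates by signs only. -/
theorem CyclicEquivalent.exists_addEquiv {Γ' : SerreGraph.{u, v}} [Finite Γ.V] [Finite Γ.D]
    [Finite Γ'.V] [Finite Γ'.D] (h : CyclicEquivalent Γ Γ') :
    ∃ ψ : Γ.H1 ℤ ≃+ Γ'.H1 ℤ, ∀ a b, (∀ d, 0 ≤ Γ.coord ℤ d a * Γ.coord ℤ d b) ↔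
      ∀ d, 0 ≤ Γ'.coord ℤ d (ψ a) * Γ'.coord ℤ d (ψ b) := by
  classical
  obtain ⟨ε, hε⟩ := h
  obtain ⟨φ⟩ : Nonempty Γ.Orientation := inferInstance
  obtain ⟨φ'⟩ : Nonempty Γ'.Orientation := inferInstance
  obtain ⟨B, hB⟩ := exists_isCobasis (Γ := Γ)
  have := Fintype.ofFinite B
  have hB' : IsCobasis Γ' fun b : B => ε b.1 := by
    rw [isCobasis_iff_isCircuit] at hB ⊢
    refine ⟨fun S hS => ?_, fun b => ?_⟩
    · obtain ⟨b, hb⟩ := hB.1 (ε ⁻¹' S) (by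
        rw [hε, Set.image_preimage_eq _ ε.surjective]; exact hS)
      exact ⟨b, hb⟩
    · obtain ⟨S, hS, hb, hb'⟩ := hB.2 b
      refine ⟨ε '' S, (hε S).1 hS, Set.mem_image_of_mem ε hb, fun b' hne => ?_⟩
      rw [ε.injective.mem_set_image]
      exact hb' b' hne
  obtain ⟨x, hx⟩ := hB.exists_isFundamental φ
  obtain ⟨x', hx'⟩ := hB'.exists_isFundamental φ'
  -- corresponding fundamental circuits have the same support
  have hsupp : ∀ b, cycleSupport (x' b) = ε '' cycleSupport (x b) := by
    intro b
    have h1 := (hε _).1 (hx.isCircuit b)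
    obtain ⟨hne, ⟨y, hy⟩, -⟩ := (Γ'.isCircuit_iff _).1 h1
    rw [← hy]
    refine (hx'.cycleSupport_eq (fun b' hb' => ?_) (by rw [hy]; exact hne)).symm
    rw [hy, ε.injective.mem_set_image]
    exact hx.notMem_cycleSupport hb'
  obtain ⟨ρ, κ, hρκ⟩ := SignUniqueness.exists_signs (hx.isBalanced id) (hx'.isBalanced ε)
    (fun b e => hx.eq_one_or) (fun b e => hx'.eq_one_or) (fun b e => by
      rw [← not_iff_not, id, ← Ne, ← Ne, ← mem_cycleSupport_iff, ← mem_cycleSupport_iff, hsupp,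
        ε.injective.mem_set_image])
  simp only [id] at hρκ
  let f : Γ.H1 ℤ →+ Γ'.H1 ℤ := AddMonoidHom.mk'
    (fun c => ∑ b, ((ρ b : ℤ) * edgeCoord φ b.1 c) • x' b) fun c c' => by
      rw [← Finset.sum_add_distrib]
      refine Finset.sum_congr rfl fun b _ => ?_
      rw [map_add, mul_add, add_smul]
  have hρ2 : ∀ b, (ρ b : ℤ) * ρ b = 1 := fun b => SignArrangement.units_mul_self _
  have hκ2 : ∀ e, (κ e : ℤ) * κ e = 1 := fun b => SignArrangement.units_mul_self _
  have hf : ∀ c e, edgeCoord φ' (ε e) (f c) = κ e * edgeCoord φ e c := by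
    intro c e
    change edgeCoord φ' (ε e) (∑ b, ((ρ b : ℤ) * edgeCoord φ b.1 c) • x' b) = _
    conv_rhs => rw [hx.expand c]
    rw [map_sum, map_sum, Finset.mul_sum]
    refine Finset.sum_congr rfl fun b _ => ?_
    rw [map_zsmul, map_zsmul, smul_eq_mul, smul_eq_mul, hρκ]
    linear_combination (edgeCoord φ b.1 c * κ e * edgeCoord φ e (x b)) * hρ2 b
  have hbij : Function.Bijective f := by
    constructor
    · intro c c' hcc
      refine ext_edgeCoord φ fun e => ?_
      have h1 := hf c e
      rw [hcc, hf c' e] at h1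
      exact (mul_left_cancel₀ (Units.ne_zero (κ e)) h1).symm
    · intro c'
      refine ⟨∑ b, ((ρ b : ℤ) * edgeCoord φ' (ε b.1) c') • x b, ext_edgeCoord φ' fun e' => ?_⟩
      obtain ⟨e, rfl⟩ := ε.surjective e'
      rw [hf]
      conv_rhs => rw [hx'.expand c']
      rw [map_sum, map_sum, Finset.mul_sum]
      refine Finset.sum_congr rfl fun b _ => ?_
      rw [map_zsmul, map_zsmul, smul_eq_mul, smul_eq_mul, hρκ]
      ring
  refine ⟨AddEquiv.ofBijective f hbij, fun a b => ?_⟩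
  rw [forall_mul_nonneg_iff φ, forall_mul_nonneg_iff φ', ε.forall_congr_left]
  refine forall_congr' fun e' => ?_
  obtain ⟨e, rfl⟩ := ε.surjective e'
  rw [ε.symm_apply_apply]
  change _ ↔ 0 ≤ edgeCoord φ' (ε e) (f a) * edgeCoord φ' (ε e) (f b)
  rw [hf, hf, mul_mul_mul_comm, hκ2, one_mul]

/-! ### The Torelli theorem -/

/-- Contracting a contraction set does not change the cographic ring. -/
theorem IsContractionSet.nonempty_algEquiv [Finite Γ.V] [Finite Γ.D] (k : Type w) [Field k]
    {F : Set Γ.E} (hF : Γ.IsContractionSet F) :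
    Nonempty (Γ.CographicRing k ≃ₐ[k] (Γ.contract F).CographicRing k) := by
  obtain ⟨ψ, hψ⟩ := Γ.exists_contract_equiv hF
  refine nonempty_algEquiv_of_addEquiv k ψ fun a b => ?_
  have hψ' : (∀ d, 0 ≤ (Γ.contract F).coord ℤ d (ψ a) * (Γ.contract F).coord ℤ d (ψ b)) ↔
      ∀ d : {d // Γ.edge d ∉ F}, 0 ≤ Γ.coord ℤ d.1 a * Γ.coord ℤ d.1 b :=
    forall_congr' fun d => by rw [← hψ a d, ← hψ b d]
  rw [hψ']
  refine ⟨fun h d => h d.1, fun h d => ?_⟩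
  by_cases hd : Γ.IsSeparating (Γ.edge d)
  · rw [(Γ.isSeparating_iff d).1 hd a, zero_mul]
  · obtain ⟨f, ⟨hf, hf'⟩, -⟩ := hF.2 _ hd
    obtain ⟨f, rfl⟩ := edge_surjective f
    rw [Γ.mul_nonneg_iff_of_zero_iff ((Γ.eq_or_isSeparatingPair_iff hd).1 hf')]
    exact h ⟨f, hf⟩

/-- In a `3`-edge connectivization, different edges define different hyperplanes. -/
theorem IsContractionSet.isSimple [Finite Γ.V] [Finite Γ.D] {F : Set Γ.E}
    (hF : Γ.IsContractionSet F) (φ : (Γ.contract F).Orientation) :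
    SignArrangement.IsSimple (edgeCoord φ) := by
  obtain ⟨ψ, hψ⟩ := Γ.exists_contract_equiv hF
  have hval : ∀ e : (Γ.contract F).E, ∃ d : {d // Γ.edge d ∉ F},
      (Γ.contract F).edge d = e ∧ ∀ c, edgeCoord φ e (ψ c) = Γ.coord ℤ d.1 c :=
    fun e => ⟨φ.1 e, φ.2 e, fun c => hψ c _⟩
  have hnonsep : ∀ d : {d // Γ.edge d ∉ F}, ¬ Γ.IsSeparating (Γ.edge d.1) :=
    fun d h => d.2 (hF.1 _ h)
  constructor
  · intro e
    obtain ⟨d, -, hd⟩ := hval e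
    have h1 := hnonsep d
    rw [isSeparating_iff] at h1
    push Not at h1
    obtain ⟨c, hc⟩ := h1
    exact ⟨ψ c, by rwa [hd]⟩
  · intro e f hef
    obtain ⟨d, rfl, hd⟩ := hval e
    obtain ⟨d', rfl, hd'⟩ := hval f
    by_contra! hcon
    have hker : ∀ c, Γ.coord ℤ d.1 c = 0 → Γ.coord ℤ d'.1 c = 0 := fun c hc => by
      rw [← hd']
      exact hcon (ψ c) (by rw [hd]; exact hc)
    -- equal kernels follow from an inclusion of kernels, and then the two edges are equivalent
    have hiff : ∀ c, Γ.coord ℤ d.1 c = 0 ↔ Γ.coord ℤ d'.1 c = 0 := by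
      refine fun c => ⟨hker c, fun hc => ?_⟩
      have h1 := hnonsep d'
      rw [isSeparating_iff] at h1
      push Not at h1
      obtain ⟨z, hz⟩ := h1
      have h2 := hker ((Γ.coord ℤ d.1 z) • c - (Γ.coord ℤ d.1 c) • z) (by
        rw [map_sub, map_smul, map_smul, smul_eq_mul, smul_eq_mul]; ring)
      rw [map_sub, map_smul, map_smul, smul_eq_mul, smul_eq_mul, hc, mul_zero, zero_sub,
        neg_eq_zero] at h2
      exact (mul_eq_zero.1 h2).resolve_right hz
    have h1 := (Γ.eq_or_isSeparatingPair_iff (hnonsep d)).2 hiff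
    obtain ⟨g, -, hg⟩ := hF.2 _ (hnonsep d)
    have h2 : Γ.edge d'.1 = Γ.edge d.1 :=
      (hg _ ⟨d'.2, h1⟩).trans (hg _ ⟨d.2, Or.inl rfl⟩).symm
    refine hef ((Γ.contract F).edge_eq_iff.2 ?_)
    rcases Γ.edge_eq_iff.1 h2 with h3 | h3
    · exact Or.inl (Subtype.ext h3.symm)
    · refine Or.inr (Subtype.ext ?_)
      change d'.1 = Γ.inv d.1
      rw [h3, Γ.inv_inv]

/-- Graphs whose edges define pairwise different hyperplanes are cyclic equivalent if their
cographic rings are isomorphic. -/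
theorem cyclicEquivalent_of_ringEquiv {Γ' : SerreGraph.{u, v}} [Finite Γ.V] [Finite Γ.D]
    [Finite Γ'.V] [Finite Γ'.D] {k : Type w} [Field k] (φ : Γ.Orientation) (φ' : Γ'.Orientation)
    (h : SignArrangement.IsSimple (edgeCoord φ)) (h' : SignArrangement.IsSimple (edgeCoord φ'))
    (Φ : Γ.CographicRing k ≃+* Γ'.CographicRing k) : CyclicEquivalent Γ Γ' := by
  obtain ⟨b, hb⟩ := exists_tope_equiv k φ φ' h h' Φ
  obtain ⟨η, hη⟩ := SignArrangement.exists_equiv_zeroSets h h' b hb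
  refine cyclicEquivalent_of_cycleSupport η fun S => ?_
  have h1 : ∀ c : Γ.H1 ℤ, cycleSupport c = S ↔ ∀ e, edgeCoord φ e c = 0 ↔ e ∈ Sᶜ := by
    intro c
    rw [Set.ext_iff]
    refine forall_congr' fun e => ?_
    rw [mem_cycleSupport_iff φ, Set.mem_compl_iff]
    tauto
  have h2 : ∀ c : Γ'.H1 ℤ, cycleSupport c = η '' S ↔
      ∀ e, edgeCoord φ' (η e) c = 0 ↔ e ∈ Sᶜ := by
    intro c
    rw [Set.ext_iff, ← η.forall_congr_right]
    refine forall_congr' fun e => ?_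
    rw [mem_cycleSupport_iff φ', Set.mem_compl_iff, η.injective.mem_set_image]
    tauto
  simp only [h1, h2]
  exact hη Sᶜ

/-- Isomorphic cographic rings come from graphs all of whose `3`-edge connectivizations are cyclic
equivalent. -/
theorem cyclicEquivalent_contract_of_ringEquiv {Γ' : SerreGraph.{u, v}} [Finite Γ.V] [Finite Γ.D]
    [Finite Γ'.V] [Finite Γ'.D] {k : Type w} [Field k]
    (Φ : Γ.CographicRing k ≃+* Γ'.CographicRing k) {F : Set Γ.E} {F' : Set Γ'.E}
    (hF : Γ.IsContractionSet F) (hF' : Γ'.IsContractionSet F') :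
    CyclicEquivalent (Γ.contract F) (Γ'.contract F') := by
  obtain ⟨α⟩ := hF.nonempty_algEquiv k
  obtain ⟨α'⟩ := hF'.nonempty_algEquiv k
  obtain ⟨φ⟩ : Nonempty (Γ.contract F).Orientation := inferInstance
  obtain ⟨φ'⟩ : Nonempty (Γ'.contract F').Orientation := inferInstance
  exact cyclicEquivalent_of_ringEquiv φ φ' (hF.isSimple φ) (hF'.isSimple φ')
    (α.symm.toRingEquiv.trans (Φ.trans α'.toRingEquiv))

theorem threeEdgeConnectedClass_eq_of_ringEquiv {Γ' : SerreGraph.{u, v}} [Finite Γ.V] [Finite Γ.D]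
    [Finite Γ'.V] [Finite Γ'.D] {k : Type w} [Field k]
    (Φ : Γ.CographicRing k ≃+* Γ'.CographicRing k) :
    Γ.threeEdgeConnectedClass = Γ'.threeEdgeConnectedClass := by
  ext Δ
  constructor
  · rintro ⟨F, hF, hΔ⟩
    obtain ⟨F', hF'⟩ := Γ'.exists_isContractionSet
    exact ⟨F', hF', (cyclicEquivalent_contract_of_ringEquiv Φ hF hF').symm.trans hΔ⟩
  · rintro ⟨F', hF', hΔ⟩
    obtain ⟨F, hF⟩ := Γ.exists_isContractionSet
    exact ⟨F, hF, (cyclicEquivalent_contract_of_ringEquiv Φ hF hF').trans hΔ⟩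

theorem nonempty_algEquiv_of_threeEdgeConnectedClass_eq {Γ' : SerreGraph.{u, v}} [Finite Γ.V]
    [Finite Γ.D] [Finite Γ'.V] [Finite Γ'.D] (k : Type w) [Field k]
    (h : Γ.threeEdgeConnectedClass = Γ'.threeEdgeConnectedClass) :
    Nonempty (Γ.CographicRing k ≃ₐ[k] Γ'.CographicRing k) := by
  obtain ⟨F, hF⟩ := Γ.exists_isContractionSet
  have h1 : Γ.contract F ∈ Γ.threeEdgeConnectedClass := ⟨F, hF, .refl _⟩
  rw [h] at h1
  obtain ⟨F', hF', hcyc⟩ := h1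
  obtain ⟨ψ, hψ⟩ := hcyc.exists_addEquiv
  obtain ⟨β⟩ := nonempty_algEquiv_of_addEquiv k ψ hψ
  obtain ⟨α⟩ := hF.nonempty_algEquiv k
  obtain ⟨α'⟩ := hF'.nonempty_algEquiv k
  exact ⟨α.trans (β.symm.trans α'.symm)⟩

end SerreGraph

theorem mainTheorem3 (k : Type w) [Field k] (Γ Γ' : SerreGraph.{u, v})
    [Finite Γ.V] [Finite Γ.D] [Finite Γ'.V] [Finite Γ'.D] :
    (Nonempty (Γ.CographicRing k ≃ₐ[k] Γ'.CographicRing k) ↔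
      Γ.threeEdgeConnectedClass = Γ'.threeEdgeConnectedClass) ∧
    (Nonempty (Γ.CographicRing k ≃+* Γ'.CographicRing k) ↔
      Γ.threeEdgeConnectedClass = Γ'.threeEdgeConnectedClass) :=
  ⟨⟨fun ⟨Φ⟩ => SerreGraph.threeEdgeConnectedClass_eq_of_ringEquiv Φ.toRingEquiv,
      SerreGraph.nonempty_algEquiv_of_threeEdgeConnectedClass_eq k⟩,
    ⟨fun ⟨Φ⟩ => SerreGraph.threeEdgeConnectedClass_eq_of_ringEquiv Φ, fun h => by
      obtain ⟨Φ⟩ := SerreGraph.nonempty_algEquiv_of_threeEdgeConnectedClass_eq k h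
      exact ⟨Φ.toRingEquiv⟩⟩⟩
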